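/- **Setting.** Fix $T>0$, $X_0\in\mathbb R$, a set $\mathcal D\subseteq\mathbb R$ that is a nonempty open convex set or the closure of one, $Y_0\in\mathcal D$, and Borel functions $\mu_X,\sigma_X,\gamma_X,\mu_Y,\sigma_Y$ on $\mathcal D$. Consider $$dX_t=\mu_X(Y_t)\,dt+\sigma_X(Y_t)\,dB_t+\gamma_X(Y_t)\,dH_t,\qquad dY_t=\mu_Y(Y_t)\,dt+\sigma_Y(Y_t)\,dW_t,$$ where $B,W$ are Brownian motions and $H=\sum_{k\le K_t}J_k$ is a compound Poisson process with intensity $\lambda>0$ and i.i.d. jumps with density $p_{J_1}$; $B$, $W$, the Poisson process $K$ and $(J_k)_k$ are independent. Put $\nu=\lambda p_{J_1}$ and $d\nu=\nu(x)\,dx$. Assume: * $\mu_X,\mu_Y,\sigma_X$ have polynomial growth on $\mathcal D$, and either $\gamma_X\equiv0$ on $\mathcal D$ or $\inf_{\mathcal D}|\gamma_X|>0$; * for every $(t,x,y)\in[0,T]\times\mathbb R\times\mathcal D$ the system has a weak solution $(X^{t,x,y},Y^{t,y})$ on $[t,T]$, started from $(x,y)$ at time $t$, with $Y^{t,y}$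 in $\mathcal D$, and it is unique in law; $f:\mathbb R\times\mathcal D\to\mathbb R$ is such that $f(X_T^{t,x,y},Y_T^{t,y})$ is always integrable, and $u(t,x,y)=\mathbb E[f(X_T^{t,x,y},Y_T^{t,y})]$; * $u$ is a classical solution of $$\partial_tu+\tfrac12\big(\sigma_X^2\partial_x^2u+\sigma_Y^2\partial_y^2u\big)+\mu_X\partial_xu+\mu_Y\partial_yu+\int\big(u(t,x+\gamma_X(y)\zeta,y)-u(t,x,y)\big)\nu(\zeta)\,d\zeta=0\quad\text{on }[0,T)\times\mathbb R\times\mathcal D$$ with $u(T,\cdot)=f$ and $\lim_{t\uparrow T}u(t,x,y)=f(x,y)$ for all $(x,y)\in\mathbb R\times\mathcal D$. **The chain.** For every $N\ge1$, with $h=T/N$, let $(\hat Y^h_n)_{n=0,\dots,N}$ be a $\mathcal D$-valued Markov chain with $\hat Y^h_0=Y_0$. Below, $\|\cdot\|_p$ is the norm of $L^p(\Omega)$ and $\Delta_n=\hat Y^h_{n+1}-\hat Y^h_n$. * $\mathcal H_1$: there are $\bar h>0$ and functions $f_h,g_h,j_h$ such that for $h<\bar h$ and $0\le n<N$, $\mathbb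 E[\Delta_n\mid\hat Y^h_n]=\mu_Y(\hat Y^h_n)h+f_h(\hat Y^h_n)$, $\mathbb E[\Delta_n^2\mid\hat Y^h_n]=\sigma_Y^2(\hat Y^h_n)h+g_h(\hat Y^h_n)$, $\mathbb E[\Delta_n^3\mid\hat Y^h_n]=j_h(\hat Y^h_n)$, and there are $p>1$, $C>0$ such that $\|f_h(\hat Y^h_n)\|_p$, $\|g_h(\hat Y^h_n)\|_p$, $\|j_h(\hat Y^h_n)\|_p\le Ch^2$ for all $h<\bar h$, $0\le n\le N$. * $\mathcal H_2$: there is $\bar h>0$ such that for every $p>1$ there is $C_p>0$ with $\|\hat Y^h_n\|_p\le C_p$ for $0\le n\le N$ and $\|\Delta_n\|_p\le C_p\sqrt h$ for $0\le n<N$, for all $h<\bar h$. **The class $C^{2,6}_{\mathrm{pol},T}(\mathbb R,\mathcal D)$.** It consists of the functions $v$ on $[0,T)\times\mathbb R\times\mathcal D$ whose derivatives $\partial_t^k\partial_x^i\partial_y^jv$ with $2k+i+j\le6$ exist and are continuous, and for which there are $C,a>0$ with $|\partial_t^k\partial_x^i\partial_y^jv(t,x,y)|\le C(1+|(x,y)|^a)$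 and $\|\partial_t^k\partial_x^i\partial_y^jv(t,\cdot,y)\|_{L^2(\mathbb R,dx)}\le C(1+|y|^a)$ for all $t<T$, $x\in\mathbb R$, $y\in\mathcal D$, $2k+i+j\le6$. **The scheme.** For $\Delta x>0$ let $\mathcal X=\{X_0+i\Delta x\}_{i\in\mathbb Z}$ and let $l_2(\mathcal X)$ be the space of $\varphi:\mathcal X\to\mathbb R$ with $|\varphi|_2=\big(\sum_{x\in\mathcal X}\varphi(x)^2\Delta x\big)^{1/2}<\infty$. Let $\alpha=\frac{h}{2\Delta x}\mu_X(y)$, $\beta=\frac{h}{2\Delta x^2}\sigma_X^2(y)$, and $\nu_y(z)=\frac1{|\gamma_X(y)|}\nu\big(\frac z{\gamma_X(y)}\big)$ (with $\nu_y=0$ if $\gamma_X\equiv0$), and, for $\varphi\in l_2(\mathcal X)$, $\varphi_i=\varphi(X_0+i\Delta x)$, $$(A\varphi)_i=(\alpha-\beta)\varphi_{i-1}+(1+2\beta)\varphi_i-(\alpha+\beta)\varphi_{i+1},\qquad (B\varphi)_i=\varphi_i+h\sum_{l\in\mathbb Z}\nu_y(l\Delta x)\,(\varphi_{i+l}-\varphi_i)\,\Delta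 x .$$ With $\Pi^h_{\Delta x}(y)=A^{-1}B$, $A$ being inverted on $l_2(\mathcal X)$, set $u^h_N=f$ and, for $n=N-1,\dots,0$, $$u^h_n(x,y)=\mathbb E\big[\Pi^h_{\Delta x}(y)\,u^h_{n+1}(\cdot,\hat Y^h_{n+1})(x)\,\big|\,\hat Y^h_n=y\big],\qquad x\in\mathcal X.$$ **Theorem 4.5.** Assume moreover that $\nu$ is twice differentiable with $\nu'/\nu,\ \nu''/\nu\in L^2(\mathbb R,d\nu)$, that the chain satisfies $\mathcal H_1$ and $\mathcal H_2$, and that $u\in C^{2,6}_{\mathrm{pol},T}(\mathbb R,\mathcal D)$. Then there exist $\bar h,C>0$ such that for all $h=T/N<\bar h$ and all $0<\Delta x<1$ the function $u(0,\cdot,Y_0)-u^h_0(\cdot,Y_0)$ belongs to $l_2(\mathcal X)$ and $$|u(0,\cdot,Y_0)-u^h_0(\cdot,Y_0)|_2\le C\,T\,(h+\Delta x^2).$$ -/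

import Mathlib

open MeasureTheory ProbabilityTheory Filter Topology
open scoped NNReal ENNReal

namespace Hybrid

noncomputable section

/-! ### The jump-diffusion model -/

/-- The data of the system
`dX = μX(Y) dt + σX(Y) dB + γX(Y) dH`, `dY = μY(Y) dt + σY(Y) dW`,
where `H` is a compound Poisson process with intensity `lam` and jump density `pJ`.
`D` is the state space of `Y`; only the values of the coefficients on `D` matter. -/
structure Model where
  D : Set ℝ
  μX : ℝ → ℝ
  σX : ℝ → ℝ
  γX : ℝ → ℝ
  μY : ℝ → ℝ
  σY : ℝ → ℝ
  lam : ℝ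
  pJ : ℝ → ℝ

/-- The density of the Lévy measure of `H`. -/
def Model.ν (M : Model) (z : ℝ) : ℝ := M.lam * M.pJ z

/-- The Lévy measure `ν(z) dz`. -/
def Model.levyMeasure (M : Model) : Measure ℝ :=
  volume.withDensity fun z => ENNReal.ofReal (M.ν z)

/-- A (nonempty) convex domain or the closure of one. -/
def IsConvexDomain (D : Set ℝ) : Prop :=
  ∃ U : Set ℝ, IsOpen U ∧ Convex ℝ U ∧ U.Nonempty ∧ (D = U ∨ D = closure U)

/-- Polynomial growth on `D`. -/
def PolyGrowthOn (D : Set ℝ) (g : ℝ → ℝ) : Prop :=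
  ∃ C > 0, ∃ a > 0, ∀ y ∈ D, |g y| ≤ C * (1 + |y| ^ (a : ℝ))

/-- The standing assumptions on the data. -/
structure Model.Standing (M : Model) : Prop where
  domain : IsConvexDomain M.D
  meas_μX : Measurable M.μX
  meas_σX : Measurable M.σX
  meas_γX : Measurable M.γX
  meas_μY : Measurable M.μY
  meas_σY : Measurable M.σY
  lam_pos : 0 < M.lam
  meas_pJ : Measurable M.pJ
  pJ_nonneg : ∀ z, 0 ≤ M.pJ z
  pJ_lintegral : ∫⁻ z, ENNReal.ofReal (M.pJ z) = 1
  growth_μX : PolyGrowthOn M.D M.μX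
  growth_μY : PolyGrowthOn M.D M.μY
  growth_σX : PolyGrowthOn M.D M.σX
  /-- No jumps at all, or `|γX|` is bounded away from zero on `D`. -/
  jumps : (∀ y ∈ M.D, M.γX y = 0) ∨ ∃ ε > 0, ∀ y ∈ M.D, ε ≤ |M.γX y|

/-- `ν` is twice differentiable with `ν'/ν, ν''/ν ∈ L²(ℝ, dν)`. -/
structure Model.LevyRegular (M : Model) : Prop where
  diff : Differentiable ℝ M.ν
  diff_deriv : Differentiable ℝ (deriv M.ν)
  memLp_one : MemLp (fun z => deriv M.ν z / M.ν z) 2 M.levyMeasure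
  memLp_two : MemLp (fun z => deriv (deriv M.ν) z / M.ν z) 2 M.levyMeasure

/-! ### Weak solutions and the value function -/

section SDE

variable {Ω : Type} [mΩ : MeasurableSpace Ω]

/-! Processes are indexed by `ℝ≥0`; time integrals are Lebesgue integrals over real intervals. -/

/-- Simple processes `∑ i < n, ξ i * 1_{(τ i, τ (i+1)]}` with `ξ i` bounded and
`𝓕 (τ i)`-measurable. -/
structure SimpleProcess (𝓕 : Filtration ℝ≥0 mΩ) where
  n : ℕ
  τ : ℕ → ℝ≥0
  mono : Monotone τ
  ξ : ℕ → Ω → ℝ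
  meas : ∀ i, Measurable[𝓕 (τ i)] (ξ i)
  bdd : ∃ C : ℝ, ∀ i ω, |ξ i ω| ≤ C

/-- The value of a simple process at time `r`. -/
def SimpleProcess.eval {𝓕 : Filtration ℝ≥0 mΩ} (S : SimpleProcess 𝓕) (r : ℝ≥0) (ω : Ω) : ℝ :=
  ∑ i ∈ Finset.range S.n, (Set.Ioc (S.τ i) (S.τ (i + 1))).indicator (fun _ => S.ξ i ω) r

/-- The elementary stochastic integral `∫_0^s S dW`. -/
def SimpleProcess.integral {𝓕 : Filtration ℝ≥0 mΩ} (S : SimpleProcess 𝓕)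
    (W : ℝ≥0 → Ω → ℝ) (s : ℝ≥0) (ω : Ω) : ℝ :=
  ∑ i ∈ Finset.range S.n, S.ξ i ω * (W (min (S.τ (i + 1)) s) ω - W (min (S.τ i) s) ω)

/-- `I s = ∫_t^s G dW` for `s ∈ [t,T]` (Itô integral): `I` has continuous paths on `[t,T]` and is
the limit in probability of elementary integrals of simple processes approximating `G` in
`L²([t,T])` in probability. -/
def IsItoIntegral (P : Measure Ω) (𝓕 : Filtration ℝ≥0 mΩ) (W : ℝ≥0 → Ω → ℝ) (t T : ℝ≥0)
    (G I : ℝ≥0 → Ω → ℝ) : Prop :=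
  (∀ᵐ ω ∂P, ContinuousOn (fun s => I s ω) (Set.Icc t T)) ∧
  ∃ S : ℕ → SimpleProcess 𝓕,
    (∀ ε : ℝ≥0∞, 0 < ε → Tendsto
      (fun m => P {ω | ε ≤ ∫⁻ r in Set.Ioc (t : ℝ) T,
        ‖(S m).eval r.toNNReal ω - G r.toNNReal ω‖ₑ ^ 2}) atTop (𝓝 0)) ∧
    ∀ s ∈ Set.Icc t T, TendstoInMeasure P
      (fun m ω => (S m).integral W s ω - (S m).integral W t ω) atTop (I s)

/-- A Poisson process with intensity `lam`. -/
structure IsPoissonProcess (P : Measure Ω) (lam : ℝ) (K : ℝ≥0 → Ω → ℕ) : Prop where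
  zero : ∀ᵐ ω ∂P, K 0 ω = 0
  mono : ∀ᵐ ω ∂P, Monotone fun s => K s ω
  rightCont : ∀ᵐ ω ∂P, ∀ s, ContinuousWithinAt (fun r => K r ω) (Set.Ici s) s
  law : ∀ r s : ℝ≥0, r ≤ s →
    HasLaw (fun ω => K s ω - K r ω) (poissonMeasure (lam.toNNReal * (s - r))) P
  indep : HasIndepIncrements (fun s ω => (K s ω : ℝ)) P

/-- The compound Poisson process `H_s = ∑_{k < K_s} J_k`. -/
def compoundPoisson (K : ℝ≥0 → Ω → ℕ) (J : ℕ → Ω → ℝ) (s : ℝ≥0) (ω : Ω) : ℝ :=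
  ∑ k ∈ Finset.range (K s ω), J k ω

/-- The time of the jump numbered `k` (counting from `0`) of `K`. -/
def jumpTime (K : ℝ≥0 → Ω → ℕ) (k : ℕ) (ω : Ω) : ℝ≥0 := sInf {r | k < K r ω}

/-- The σ-algebra generated by a whole process. -/
@[reducible] def sigmaOf {ι E : Type} [MeasurableSpace E] (Z : ι → Ω → E) : MeasurableSpace Ω :=
  MeasurableSpace.comap (fun ω i => Z i ω) MeasurableSpace.pi

/-- The driving noises: Brownian motions `B`, `W`, a Poisson process `K` and jumps `J k` i.i.d.
with density `pJ`, all independent, and compatible with the filtration `𝓕`. -/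
structure IsNoise (M : Model) (P : Measure Ω) (𝓕 : Filtration ℝ≥0 mΩ)
    (B W : ℝ≥0 → Ω → ℝ) (K : ℝ≥0 → Ω → ℕ) (J : ℕ → Ω → ℝ) : Prop where
  brownian_B : IsBrownianReal B P
  brownian_W : IsBrownianReal W P
  poisson : IsPoissonProcess P M.lam K
  meas_J : ∀ k, Measurable (J k)
  law_J : ∀ k, HasLaw (J k) (volume.withDensity fun z => ENNReal.ofReal (M.pJ z)) P
  indep_J : iIndepFun J P
  indep : iIndep ![sigmaOf B, sigmaOf W, sigmaOf K, sigmaOf J] P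
  adapted_B : ∀ s, Measurable[𝓕 s] (B s)
  adapted_W : ∀ s, Measurable[𝓕 s] (W s)
  adapted_K : ∀ s, Measurable[𝓕 s] (K s)
  adapted_H : ∀ s, Measurable[𝓕 s] (compoundPoisson K J s)
  /-- The increments after time `r` are independent of `𝓕 r`. -/
  indep_past : ∀ r s : ℝ≥0, r ≤ s → Indep (𝓕 r)
    (MeasurableSpace.comap
      (fun ω => (B s ω - B r ω, W s ω - W r ω, (K s ω : ℝ) - K r ω,
        compoundPoisson K J s ω - compoundPoisson K J r ω)) inferInstance) P

/-- `(X, Y)`, with the noises `B, W, K, J`, is a weak solution on `[t,T]`, with `Y` in `D`,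
started from `(x, y)` at time `t`. Since `Y` is continuous, `Y` and its left limit agree at the
jump times, so `∫_{(t,s]} γX(Y) dH` is the sum of `γX(Y_{τ_k}) J_k` over the jumps in `(t,s]`. -/
structure IsWeakSolution (M : Model) (t T : ℝ≥0) (x y : ℝ) (P : Measure Ω)
    (𝓕 : Filtration ℝ≥0 mΩ) (B W : ℝ≥0 → Ω → ℝ) (K : ℝ≥0 → Ω → ℕ) (J : ℕ → Ω → ℝ)
    (X Y : ℝ≥0 → Ω → ℝ) : Prop where
  prob : IsProbabilityMeasure P
  noise : IsNoise M P 𝓕 B W K J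
  adapted_X : ∀ s ∈ Set.Icc t T, Measurable[𝓕 s] (X s)
  adapted_Y : ∀ s ∈ Set.Icc t T, Measurable[𝓕 s] (Y s)
  mem_D : ∀ᵐ ω ∂P, ∀ s ∈ Set.Icc t T, Y s ω ∈ M.D
  integrable : ∀ᵐ ω ∂P, IntegrableOn (fun r : ℝ => M.μX (Y r.toNNReal ω)) (Set.Ioc (t : ℝ) T) ∧
    IntegrableOn (fun r : ℝ => M.μY (Y r.toNNReal ω)) (Set.Ioc (t : ℝ) T)
  eqns : ∃ IX IY : ℝ≥0 → Ω → ℝ,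
    IsItoIntegral P 𝓕 B t T (fun r ω => M.σX (Y r ω)) IX ∧
    IsItoIntegral P 𝓕 W t T (fun r ω => M.σY (Y r ω)) IY ∧
    ∀ᵐ ω ∂P, ∀ s ∈ Set.Icc t T,
      X s ω = x + (∫ r in Set.Ioc (t : ℝ) s, M.μX (Y r.toNNReal ω)) + IX s ω
        + ∑ k ∈ Finset.Ico (K t ω) (K s ω), M.γX (Y (jumpTime K k ω) ω) * J k ω ∧
      Y s ω = y + (∫ r in Set.Ioc (t : ℝ) s, M.μY (Y r.toNNReal ω)) + IY s ω

end SDE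

/-- From every `(t, x, y)` there is a weak solution on `[t,T]`, and its law is unique. -/
def WellPosed (M : Model) (T : ℝ≥0) : Prop :=
  ∀ t ≤ T, ∀ x : ℝ, ∀ y ∈ M.D,
    (∃ (Ω : Type) (mΩ : MeasurableSpace Ω) (P : Measure Ω) (𝓕 : Filtration ℝ≥0 mΩ)
      (B W : ℝ≥0 → Ω → ℝ) (K : ℝ≥0 → Ω → ℕ) (J : ℕ → Ω → ℝ) (X Y : ℝ≥0 → Ω → ℝ),
      IsWeakSolution M t T x y P 𝓕 B W K J X Y) ∧
    ∀ (Ω : Type) (mΩ : MeasurableSpace Ω) (P : Measure Ω) (𝓕 : Filtration ℝ≥0 mΩ)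
      (B W : ℝ≥0 → Ω → ℝ) (K : ℝ≥0 → Ω → ℕ) (J : ℕ → Ω → ℝ) (X Y : ℝ≥0 → Ω → ℝ)
      (Ω' : Type) (mΩ' : MeasurableSpace Ω') (P' : Measure Ω') (𝓕' : Filtration ℝ≥0 mΩ')
      (B' W' : ℝ≥0 → Ω' → ℝ) (K' : ℝ≥0 → Ω' → ℕ) (J' : ℕ → Ω' → ℝ) (X' Y' : ℝ≥0 → Ω' → ℝ),
      IsWeakSolution M t T x y P 𝓕 B W K J X Y →
      IsWeakSolution M t T x y P' 𝓕' B' W' K' J' X' Y' →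
      P.map (fun ω (s : Set.Icc t T) => (X s ω, Y s ω)) =
        P'.map (fun ω (s : Set.Icc t T) => (X' s ω, Y' s ω))

/-- `u(t,x,y) = 𝔼[f(X_T^{t,x,y}, Y_T^{t,y})]` on `[0,T] × ℝ × D`. -/
def IsValueFunction (M : Model) (T : ℝ≥0) (f : ℝ → ℝ → ℝ) (u : ℝ → ℝ → ℝ → ℝ) : Prop :=
  ∀ t ≤ T, ∀ x : ℝ, ∀ y ∈ M.D,
    ∀ (Ω : Type) (mΩ : MeasurableSpace Ω) (P : Measure Ω) (𝓕 : Filtration ℝ≥0 mΩ)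
      (B W : ℝ≥0 → Ω → ℝ) (K : ℝ≥0 → Ω → ℕ) (J : ℕ → Ω → ℝ) (X Y : ℝ≥0 → Ω → ℝ),
      IsWeakSolution M t T x y P 𝓕 B W K J X Y →
      Integrable (fun ω => f (X T ω) (Y T ω)) P ∧ u t x y = ∫ ω, f (X T ω) (Y T ω) ∂P

/-! ### The backward equation and the regularity class -/

/-- `u` is a classical solution of `∂ₜu + 𝓛u = 0` on `[0,T) × ℝ × D`, `u(T,·) = f`, the terminal
value being attained continuously along every line `t ↦ (t,x,y)`. Derivatives at boundary points
of `[0,T)` and `D` are one-sided. -/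
structure SolvesPIDE (M : Model) (T : ℝ) (f : ℝ → ℝ → ℝ) (u : ℝ → ℝ → ℝ → ℝ) : Prop where
  integrable : ∀ t ∈ Set.Ico 0 T, ∀ x : ℝ, ∀ y ∈ M.D,
    Integrable fun ζ => (u t (x + M.γX y * ζ) y - u t x y) * M.ν ζ
  eqn : ∀ t ∈ Set.Ico 0 T, ∀ x : ℝ, ∀ y ∈ M.D,
    derivWithin (fun s => u s x y) (Set.Ico 0 T) t
      + (1 / 2 * (M.σX y ^ 2 * deriv (deriv fun x' => u t x' y) x
          + M.σY y ^ 2 * derivWithin (derivWithin (fun y' => u t x y') M.D) M.D y)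
        + M.μX y * deriv (fun x' => u t x' y) x
        + M.μY y * derivWithin (fun y' => u t x y') M.D y
        + ∫ ζ, (u t (x + M.γX y * ζ) y - u t x y) * M.ν ζ) = 0
  terminal : ∀ x : ℝ, ∀ y ∈ M.D, u T x y = f x y
  terminal_cont : ∀ x : ℝ, ∀ y ∈ M.D, Tendsto (fun t => u t x y) (𝓝[<] T) (𝓝 (f x y))

/-- `w k i j = ∂ₜᵏ ∂ₓⁱ ∂ᵧʲ v` on `[0,T) × ℝ × D` for all `2k + i + j ≤ q`, all of them existing
(in any order of differentiation) and continuous. -/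
structure IsJet (q : ℕ) (T : ℝ) (D : Set ℝ) (v : ℝ → ℝ → ℝ → ℝ)
    (w : ℕ → ℕ → ℕ → ℝ → ℝ → ℝ → ℝ) : Prop where
  zero : ∀ t ∈ Set.Ico 0 T, ∀ x : ℝ, ∀ y ∈ D, w 0 0 0 t x y = v t x y
  cont : ∀ k i j, 2 * k + i + j ≤ q →
    ContinuousOn (fun z : ℝ × ℝ × ℝ => w k i j z.1 z.2.1 z.2.2)
      (Set.Ico 0 T ×ˢ Set.univ ×ˢ D)
  deriv_t : ∀ k i j, 2 * (k + 1) + i + j ≤ q → ∀ t ∈ Set.Ico 0 T, ∀ x : ℝ, ∀ y ∈ D,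
    HasDerivWithinAt (fun s => w k i j s x y) (w (k + 1) i j t x y) (Set.Ico 0 T) t
  deriv_x : ∀ k i j, 2 * k + (i + 1) + j ≤ q → ∀ t ∈ Set.Ico 0 T, ∀ x : ℝ, ∀ y ∈ D,
    HasDerivAt (fun x' => w k i j t x' y) (w k (i + 1) j t x y) x
  deriv_y : ∀ k i j, 2 * k + i + (j + 1) ≤ q → ∀ t ∈ Set.Ico 0 T, ∀ x : ℝ, ∀ y ∈ D,
    HasDerivWithinAt (fun y' => w k i j t x y') (w k i (j + 1) t x y) D y

/-- The class `C^{p,q}_{pol,T}(ℝ, D)`. -/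
def MemCpolT (p : ℝ≥0∞) (q : ℕ) (T : ℝ) (D : Set ℝ) (v : ℝ → ℝ → ℝ → ℝ) : Prop :=
  ∃ w : ℕ → ℕ → ℕ → ℝ → ℝ → ℝ → ℝ, IsJet q T D v w ∧
    (∃ C > 0, ∃ a > 0, ∀ k i j, 2 * k + i + j ≤ q → ∀ t ∈ Set.Ico 0 T, ∀ x : ℝ, ∀ y ∈ D,
      |w k i j t x y| ≤ C * (1 + Real.sqrt (x ^ 2 + y ^ 2) ^ (a : ℝ))) ∧
    ∃ C > 0, ∃ a > 0, ∀ k i j, 2 * k + i + j ≤ q → ∀ t ∈ Set.Ico 0 T, ∀ y ∈ D,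
      eLpNorm (fun x => w k i j t x y) p volume ≤ ENNReal.ofReal (C * (1 + |y| ^ (a : ℝ)))

/-! ### The approximating Markov chain -/

section Chain

variable {Ω : Type*} [MeasurableSpace Ω]

/-- `Y 0, …, Y N` is a Markov chain in `D` started at `y₀`, with transition kernel `κ n` from
time `n` to time `n + 1`. -/
structure IsMarkovChain (P : Measure Ω) (D : Set ℝ) (y₀ : ℝ) (N : ℕ) (Y : ℕ → Ω → ℝ)
    (κ : ℕ → Kernel ℝ ℝ) : Prop where
  meas : ∀ n ≤ N, Measurable (Y n)
  init : ∀ᵐ ω ∂P, Y 0 ω = y₀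
  mem : ∀ n ≤ N, ∀ᵐ ω ∂P, Y n ω ∈ D
  markov_kernel : ∀ n < N, IsMarkovKernel (κ n)
  markov : ∀ n < N, ∀ s, MeasurableSet s →
    P[(Y (n + 1) ⁻¹' s).indicator (fun _ => (1 : ℝ)) |
        ⨆ (k : ℕ) (_ : k ≤ n), MeasurableSpace.comap (Y k) inferInstance]
      =ᵐ[P] fun ω => (κ n (Y n ω)).real s

/-- Assumption `H₁` on the local moments. `Y N` is the chain with `N` steps of length
`h = T / N`; `fh N`, `gh N`, `jh N` are the functions `f_h`, `g_h`, `j_h`. -/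
def AssumptionH1 (P : Measure Ω) (M : Model) (T : ℝ) (Y : ℕ → ℕ → Ω → ℝ) : Prop :=
  ∃ hbar > 0, ∃ fh gh jh : ℕ → ℝ → ℝ,
    (∀ N, Measurable (fh N) ∧ Measurable (gh N) ∧ Measurable (jh N)) ∧
    (∀ N : ℕ, 1 ≤ N → T / N < hbar → ∀ n < N,
      Integrable (fun ω => (Y N (n + 1) ω - Y N n ω) ^ 3) P ∧
      P[fun ω => Y N (n + 1) ω - Y N n ω | MeasurableSpace.comap (Y N n) inferInstance]
        =ᵐ[P] (fun ω => M.μY (Y N n ω) * (T / N) + fh N (Y N n ω)) ∧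
      P[fun ω => (Y N (n + 1) ω - Y N n ω) ^ 2 | MeasurableSpace.comap (Y N n) inferInstance]
        =ᵐ[P] (fun ω => M.σY (Y N n ω) ^ 2 * (T / N) + gh N (Y N n ω)) ∧
      P[fun ω => (Y N (n + 1) ω - Y N n ω) ^ 3 | MeasurableSpace.comap (Y N n) inferInstance]
        =ᵐ[P] (fun ω => jh N (Y N n ω))) ∧
    ∃ p : ℝ, 1 < p ∧ ∃ C > 0, ∀ N : ℕ, 1 ≤ N → T / N < hbar → ∀ n ≤ N,
      eLpNorm (fun ω => fh N (Y N n ω)) (ENNReal.ofReal p) P ≤ ENNReal.ofReal (C * (T / N) ^ 2) ∧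
      eLpNorm (fun ω => gh N (Y N n ω)) (ENNReal.ofReal p) P ≤ ENNReal.ofReal (C * (T / N) ^ 2) ∧
      eLpNorm (fun ω => jh N (Y N n ω)) (ENNReal.ofReal p) P ≤ ENNReal.ofReal (C * (T / N) ^ 2)

/-- Assumption `H₂` on the moments and the increments. -/
def AssumptionH2 (P : Measure Ω) (T : ℝ) (Y : ℕ → ℕ → Ω → ℝ) : Prop :=
  ∃ hbar > 0, ∀ p : ℝ, 1 < p → ∃ C > 0, ∀ N : ℕ, 1 ≤ N → T / N < hbar →
    (∀ n ≤ N, eLpNorm (Y N n) (ENNReal.ofReal p) P ≤ ENNReal.ofReal C) ∧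
    ∀ n < N, eLpNorm (fun ω => Y N (n + 1) ω - Y N n ω) (ENNReal.ofReal p) P
      ≤ ENNReal.ofReal (C * Real.sqrt (T / N))

end Chain

/-! ### The finite difference operators and the hybrid scheme -/

/-- `ν_y(z) = |γX(y)|⁻¹ ν(z / γX(y))`; this is `0` where `γX(y) = 0`. -/
def Model.νy (M : Model) (y z : ℝ) : ℝ := |M.γX y|⁻¹ * M.ν (z / M.γX y)

/-- `α = h μX(y) / (2Δx)`. -/
def Model.α (M : Model) (h dx y : ℝ) : ℝ := h / (2 * dx) * M.μX y

/-- `β = h σX(y)² / (2Δx²)`. -/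
def Model.β (M : Model) (h dx y : ℝ) : ℝ := h / (2 * dx ^ 2) * M.σX y ^ 2

/-- The implicit, centered matrix `A`. -/
def Model.matA (M : Model) (h dx y : ℝ) (i j : ℤ) : ℝ :=
  if i = j + 1 then M.α h dx y - M.β h dx y
  else if i = j then 1 + 2 * M.β h dx y
  else if i = j - 1 then -M.α h dx y - M.β h dx y
  else 0

/-- The explicit matrix `B` of the trapezoidal rule for the jump term. -/
def Model.matB (M : Model) (h dx y : ℝ) (i j : ℤ) : ℝ :=
  if i = j then 1 + h * (M.νy y 0 * dx - ∑' l : ℤ, M.νy y (l * dx) * dx)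
  else h * M.νy y ((j - i : ℤ) * dx) * dx

/-- The action of a biinfinite matrix on a sequence. -/
def applyMat (A : ℤ → ℤ → ℝ) (v : ℤ → ℝ) (i : ℤ) : ℝ := ∑' j, A i j * v j

/-- Square summability, i.e. membership in `l₂(𝒳)`, of a grid function `φ i = φ(X₀ + i Δx)`. -/
def MemL2 (φ : ℤ → ℝ) : Prop := Summable fun i => φ i ^ 2

/-- The norm of `l₂(𝒳)`, weighted by `Δx`. -/
def l2norm (dx : ℝ) (φ : ℤ → ℝ) : ℝ := Real.sqrt (∑' i, φ i ^ 2 * dx)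

open Classical in
/-- `A⁻¹ w`: the solution `v ∈ l₂` of `A v = w`. -/
def solveL2 (A : ℤ → ℤ → ℝ) (w : ℤ → ℝ) : ℤ → ℝ :=
  if hw : ∃ v, MemL2 v ∧ applyMat A v = w then hw.choose else 0

/-- The one-step operator `Π(y) = A(y)⁻¹ B(y)`. -/
def Model.step (M : Model) (h dx y : ℝ) (φ : ℤ → ℝ) : ℤ → ℝ :=
  solveL2 (M.matA h dx y) (applyMat (M.matB h dx y) φ)

/-- The backward hybrid scheme: `M.scheme h dx x₀ f N κ m i y` is `u^h_n(x₀ + i Δx, y)` for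
`n = N - m`, that is, with `m` steps still to go to maturity. -/
def Model.scheme (M : Model) (h dx x₀ : ℝ) (f : ℝ → ℝ → ℝ) (N : ℕ) (κ : ℕ → Kernel ℝ ℝ) :
    ℕ → ℤ → ℝ → ℝ
  | 0, i, y => f (x₀ + i * dx) y
  | m + 1, i, y =>
      ∫ z, M.step h dx y (fun j => M.scheme h dx x₀ f N κ m j z) i ∂(κ (N - (m + 1)) y)

/-- `u^h_n(x₀ + i Δx, y)`. -/
def Model.uh (M : Model) (h dx x₀ : ℝ) (f : ℝ → ℝ → ℝ) (N : ℕ) (κ : ℕ → Kernel ℝ ℝ)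
    (n : ℕ) (i : ℤ) (y : ℝ) : ℝ :=
  M.scheme h dx x₀ f N κ (N - n) i y

end

end Hybrid

/-!
The error of the scheme is controlled by `ℓ²`-stability of one step and consistency in mean.

Stability: the quadratic form of `A` dominates the identity, because its antisymmetric part drops
out and its symmetric part is `1` minus a multiple of the discrete Laplacian; so `A⁻¹` is a
contraction of `ℓ²` (`L2Bound.of_stencil`), and existence of `A⁻¹` follows from an explicit
factorization (`stencil_invStencil`). The trapezoidal weights of the jump term are nonnegative and
have a mass bounded by some `Λ`, uniformly in the state, hence one step has norm at most `1 + 2Λh`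
(`WeightBound.l2Bound_step`).

Consistency: `A u(s,·,y) - B 𝔼[u(s+h,·,Y')]` is expanded by Taylor's formula in `t` and `y` along
the chain and in `x` on the grid. The conditional moments of `H₁` reproduce the `y`-part of the
generator, the centered differences and the trapezoidal rule reproduce the `x`-part up to `Δx²`
(`Regular.stencil_consistent`, `Model.exists_jumpBound`), and the backward equation cancels the
terms of order `h` (`Regular.local_error`). No growth condition on `σY` is needed, since the term
with `∂ᵧ²u` occurs only through this cancellation. The derivatives of `u` are `L²` in `x`, with one
more derivative in `L²`, so their samples on the grid have norms of order `Δx^(-1/2)`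
(`L2Bound.sample`), which is compensated by the weight `Δx` in the norm. The weighted errors of `H₁`
and the Taylor remainder are of order `h²` in mean by Young's inequality and the moments of `H₂`
(`exists_consistency`). Derivatives are available only before maturity, and the last step is reached
by letting the time increase to `T`.

Accumulation: an `ℓ²` bound `k` of the error at time `n + 1` gives the bound
`ℓ(y) + (1 + 2Λh) ∫ k dκₙ(y)` at time `n`, with `ℓ` the local error (`Regular.error_step`). In mean
over the chain this is a scalar recursion with solution at most `N e^(2ΛT)` times the mean local
error (`Regular.scheme_error`), and at time `0` the chain sits at `y₀`.

All `ℓ²` bounds are stated by duality (`L2Bound`), so that sums over jumps, averages over the chain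
and Taylor remainders are estimated through real-valued linear functionals.
-/

namespace Hybrid

/-! ### Square-summable sequences -/

/-- `‖φ‖_{ℓ²(ℤ)} ≤ K`, expressed by duality against finitely supported sequences. In this form
the bound passes through sums, limits and integrals by linearity alone. -/
def L2Bound (φ : ℤ → ℝ) (K : ℝ) : Prop :=
  ∀ (F : Finset ℤ) (c : ℤ → ℝ), |∑ i ∈ F, c i * φ i| ≤ K * √(∑ i ∈ F, c i ^ 2)

namespace L2Bound

variable {φ ψ : ℤ → ℝ} {K L : ℝ}

lemma abs_le (h : L2Bound φ K) (i : ℤ) : |φ i| ≤ K := by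
  simpa using h {i} (fun _ => 1)

lemma nonneg (h : L2Bound φ K) : 0 ≤ K := (abs_nonneg _).trans (h.abs_le 0)

lemma mono (h : L2Bound φ K) (hKL : K ≤ L) : L2Bound φ L := fun F c =>
  (h F c).trans (mul_le_mul_of_nonneg_right hKL (Real.sqrt_nonneg _))

lemma add (h : L2Bound φ K) (h' : L2Bound ψ L) : L2Bound (fun i => φ i + ψ i) (K + L) := by
  intro F c
  simp only [mul_add, Finset.sum_add_distrib, add_mul]
  exact (abs_add_le _ _).trans (add_le_add (h F c) (h' F c))

lemma of_eq (h : L2Bound φ K) (e : φ = ψ) : L2Bound ψ K := e ▸ h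

lemma const_mul (h : L2Bound φ K) (a : ℝ) : L2Bound (fun i => a * φ i) (|a| * K) := by
  intro F c
  have : ∑ i ∈ F, c i * (a * φ i) = a * ∑ i ∈ F, c i * φ i := by
    rw [Finset.mul_sum]; exact Finset.sum_congr rfl fun _ _ => by ring
  rw [this, abs_mul, mul_assoc]
  exact mul_le_mul_of_nonneg_left (h F c) (abs_nonneg a)

lemma neg (h : L2Bound φ K) : L2Bound (fun i => -φ i) K := by
  simpa using h.const_mul (-1)

lemma sub (h : L2Bound φ K) (h' : L2Bound ψ L) : L2Bound (fun i => φ i - ψ i) (K + L) := by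
  simpa [sub_eq_add_neg] using h.add h'.neg

lemma zero : L2Bound (fun _ => 0) 0 := fun F c => by simp

lemma comp_equiv (h : L2Bound φ K) (e : ℤ ≃ ℤ) : L2Bound (fun i => φ (e i)) K := by
  intro F c
  have := h (F.map e.toEmbedding) (fun i => c (e.symm i))
  simpa using this

lemma shift (h : L2Bound φ K) (l : ℤ) : L2Bound (fun i => φ (i + l)) K :=
  h.comp_equiv (Equiv.addRight l)

lemma sum_sq_le (h : L2Bound φ K) (F : Finset ℤ) : ∑ i ∈ F, φ i ^ 2 ≤ K ^ 2 := by
  have h1 := h F φ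
  have h0 : 0 ≤ ∑ i ∈ F, φ i ^ 2 := Finset.sum_nonneg fun _ _ => sq_nonneg _
  have h2 : ∑ i ∈ F, φ i * φ i = √(∑ i ∈ F, φ i ^ 2) * √(∑ i ∈ F, φ i ^ 2) := by
    rw [Real.mul_self_sqrt h0]; exact Finset.sum_congr rfl fun _ _ => by ring
  rw [h2, abs_of_nonneg (by positivity)] at h1
  have h3 : √(∑ i ∈ F, φ i ^ 2) ≤ K := by
    rcases (Real.sqrt_nonneg (∑ i ∈ F, φ i ^ 2)).eq_or_lt with h4 | h4
    · rw [← h4]; exact h.nonneg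
    · exact le_of_mul_le_mul_right h1 h4
  calc ∑ i ∈ F, φ i ^ 2 = √(∑ i ∈ F, φ i ^ 2) ^ 2 := (Real.sq_sqrt h0).symm
    _ ≤ K ^ 2 := by gcongr

lemma memL2 (h : L2Bound φ K) : MemL2 φ :=
  summable_of_sum_le (fun _ => sq_nonneg _) h.sum_sq_le

lemma tsum_sq_le (h : L2Bound φ K) : ∑' i, φ i ^ 2 ≤ K ^ 2 :=
  h.memL2.tsum_le_of_sum_le h.sum_sq_le

lemma of_sum_sq_le (hK : 0 ≤ K) (h : ∀ F : Finset ℤ, ∑ i ∈ F, φ i ^ 2 ≤ K ^ 2) :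
    L2Bound φ K := by
  intro F c
  have h1 := Finset.sum_mul_sq_le_sq_mul_sq F c φ
  have hc : 0 ≤ ∑ i ∈ F, c i ^ 2 := Finset.sum_nonneg fun _ _ => sq_nonneg _
  apply abs_le_of_sq_le_sq _ (by positivity)
  rw [mul_pow, Real.sq_sqrt hc]
  nlinarith [mul_le_mul_of_nonneg_left (h F) hc]

lemma of_memL2 (h : MemL2 φ) : L2Bound φ √(∑' i, φ i ^ 2) := by
  refine of_sum_sq_le (Real.sqrt_nonneg _) fun F => ?_
  rw [Real.sq_sqrt (tsum_nonneg fun _ => sq_nonneg _)]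
  exact Summable.sum_le_tsum F (fun _ _ => sq_nonneg _) h

lemma of_tendsto {ι : Type*} {l : Filter ι} [l.NeBot] {φ' : ι → ℤ → ℝ}
    (hφ : ∀ i, Tendsto (fun n => φ' n i) l (𝓝 (φ i))) (h : ∀ᶠ n in l, L2Bound (φ' n) K) :
    L2Bound φ K := by
  intro F c
  have h1 : Tendsto (fun n => |∑ i ∈ F, c i * φ' n i|) l (𝓝 |∑ i ∈ F, c i * φ i|) :=
    (tendsto_finsetSum _ fun i _ => (hφ i).const_mul _).abs
  exact le_of_tendsto h1 (h.mono fun n hn => hn F c)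

lemma tsum {ι : Type*} {ψ : ι → ℤ → ℝ} {k : ι → ℝ} (h : ∀ l, L2Bound (ψ l) (k l))
    (hk : Summable k) : L2Bound (fun i => ∑' l, ψ l i) (∑' l, k l) := by
  intro F c
  have hs : ∀ i, Summable fun l => ψ l i := fun i =>
    Summable.of_norm_bounded hk fun l => (h l).abs_le i
  have h1 : ∑ i ∈ F, c i * ∑' l, ψ l i = ∑' l, ∑ i ∈ F, c i * ψ l i := by
    rw [Summable.tsum_finsetSum fun i _ => (hs i).mul_left _]
    exact Finset.sum_congr rfl fun i _ => (tsum_mul_left).symm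
  have hb : ∀ l, ‖∑ i ∈ F, c i * ψ l i‖ ≤ k l * √(∑ i ∈ F, c i ^ 2) := fun l => h l F c
  rw [h1, ← tsum_mul_right]
  exact tsum_of_norm_bounded (hk.mul_right _).hasSum hb

lemma integral {S : Type*} [MeasurableSpace S] {m : Measure S} {ψ : S → ℤ → ℝ} {k : S → ℝ}
    (hψ : ∀ i, AEStronglyMeasurable (fun z => ψ z i) m) (h : ∀ᵐ z ∂m, L2Bound (ψ z) (k z))
    (hk : Integrable k m) : L2Bound (fun i => ∫ z, ψ z i ∂m) (∫ z, k z ∂m) := by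
  intro F c
  have hint : ∀ i, Integrable (fun z => ψ z i) m := fun i =>
    hk.mono' (hψ i) (h.mono fun z hz => hz.abs_le i)
  have h1 : ∑ i ∈ F, c i * ∫ z, ψ z i ∂m = ∫ z, ∑ i ∈ F, c i * ψ z i ∂m := by
    rw [integral_finsetSum _ fun i _ => (hint i).const_mul _]
    exact Finset.sum_congr rfl fun i _ => (integral_const_mul _ _).symm
  rw [h1, ← integral_mul_const]
  rw [← Real.norm_eq_abs]
  exact norm_integral_le_of_norm_le (hk.mul_const _) (h.mono fun z hz => hz F c)

end L2Bound

/-- Taylor's formula with a bound of the remainder, in a normed space; `g k` is the derivative of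
order `k` of `g 0`. -/
lemma norm_sub_taylor_le {E : Type*} [NormedAddCommGroup E] [NormedSpace ℝ E] (m : ℕ)
    (g : ℕ → ℝ → E) (K : ℝ)
    (hg : ∀ k < m, ∀ s ∈ Set.Icc (0 : ℝ) 1,
      HasDerivWithinAt (g k) (g (k + 1) s) (Set.Icc 0 1) s)
    (hK : ∀ s ∈ Set.Icc (0 : ℝ) 1, ‖g m s‖ ≤ K) :
    ∀ s ∈ Set.Icc (0 : ℝ) 1,
      ‖g 0 s - ∑ k ∈ Finset.range m, (s ^ k / (k.factorial : ℝ)) • g k 0‖ ≤ K := by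
  induction m generalizing g with
  | zero => simpa using hK
  | succ m ih =>
    intro s hs
    have ih' := ih (fun k => g (k + 1)) (fun k hk s hs => hg (k + 1) (by omega) s hs) hK
    set R : ℝ → E := fun s =>
      g 0 s - ∑ k ∈ Finset.range (m + 1), (s ^ k / (k.factorial : ℝ)) • g k 0 with hR
    have hd : ∀ r ∈ Set.Icc (0 : ℝ) 1, HasDerivWithinAt R
        (g 1 r - ∑ k ∈ Finset.range m, (r ^ k / (k.factorial : ℝ)) • g (k + 1) 0)
        (Set.Icc 0 1) r := by
      intro r hr
      refine (hg 0 (by omega) r hr).sub ?_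
      have h2 : ∀ k, HasDerivWithinAt
          (fun s : ℝ => (s ^ (k + 1) / ((k + 1).factorial : ℝ)) • g (k + 1) 0)
          ((r ^ k / (k.factorial : ℝ)) • g (k + 1) 0) (Set.Icc 0 1) r := by
        intro k
        have h3 : HasDerivAt (fun s : ℝ => s ^ (k + 1) / ((k + 1).factorial : ℝ))
            (r ^ k / (k.factorial : ℝ)) r := by
          have := (hasDerivAt_pow (k + 1) r).div_const ((k + 1).factorial : ℝ)
          have hv : ((k + 1 : ℕ) : ℝ) * r ^ (k + 1 - 1) / ((k + 1).factorial : ℝ)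
              = r ^ k / (k.factorial : ℝ) := by
            rw [Nat.factorial_succ]
            push_cast
            rw [mul_div_mul_left _ _ (by positivity)]
          rwa [hv] at this
        exact (h3.smul_const _).hasDerivWithinAt
      have h4 := HasDerivWithinAt.fun_sum (u := Finset.range m) fun k _ => h2 k
      have h5 := h4.add_const (g 0 0)
      convert h5 using 1
      ext s
      rw [Finset.sum_range_succ']
      simp
    have h6 := (convex_Icc (0 : ℝ) 1).norm_image_sub_le_of_norm_hasDerivWithin_le hd ih'
      (Set.left_mem_Icc.2 zero_le_one) hs
    have hR0 : R 0 = 0 := by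
      simp [hR, Finset.sum_range_succ']
    rw [hR0, sub_zero] at h6
    have hK0 : 0 ≤ K := (norm_nonneg _).trans (hK 0 (Set.left_mem_Icc.2 zero_le_one))
    refine h6.trans ?_
    rw [sub_zero, Real.norm_eq_abs, abs_of_nonneg hs.1]
    nlinarith [hs.2]

/-- Taylor's formula on the unit interval, uniformly in `ℓ²`. -/
lemma L2Bound.taylor (m : ℕ) (g : ℕ → ℝ → ℤ → ℝ) (K : ℝ)
    (hg : ∀ k < m, ∀ i, ∀ s ∈ Set.Icc (0 : ℝ) 1,
      HasDerivWithinAt (fun r => g k r i) (g (k + 1) s i) (Set.Icc 0 1) s)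
    (hK : ∀ s ∈ Set.Icc (0 : ℝ) 1, L2Bound (g m s) K) :
    L2Bound (fun i => g 0 1 i - ∑ k ∈ Finset.range m, g k 0 i / (k.factorial : ℝ)) K := by
  intro F c
  have := norm_sub_taylor_le m (fun k s => ∑ i ∈ F, c i * g k s i) (K * √(∑ i ∈ F, c i ^ 2))
    (fun k hk s hs => HasDerivWithinAt.fun_sum fun i _ => (hg k hk i s hs).const_mul _)
    (fun s hs => hK s hs F c) 1 (Set.right_mem_Icc.2 zero_le_one)
  refine le_of_eq_of_le ?_ this
  rw [Real.norm_eq_abs]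
  congr 1
  simp only [mul_sub, Finset.sum_sub_distrib, one_pow, smul_eq_mul, Finset.mul_sum]
  rw [Finset.sum_comm]
  congr 1
  exact Finset.sum_congr rfl fun k _ => Finset.sum_congr rfl fun i _ => by ring

/-! ### The implicit difference operator and its inverse -/

/-- The tridiagonal operator `A` on sequences. -/
noncomputable def stencil (α β : ℝ) (v : ℤ → ℝ) (i : ℤ) : ℝ :=
  (α - β) * v (i - 1) + (1 + 2 * β) * v i - (α + β) * v (i + 1)

lemma applyMat_matA (M : Model) (h dx y : ℝ) (v : ℤ → ℝ) :
    applyMat (M.matA h dx y) v = stencil (M.α h dx y) (M.β h dx y) v := by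
  funext i
  have h1 : applyMat (M.matA h dx y) v i
      = ∑ j ∈ ({i - 1, i, i + 1} : Finset ℤ), M.matA h dx y i j * v j := by
    refine tsum_eq_sum fun j hj => ?_
    simp only [Finset.mem_insert, Finset.mem_singleton, not_or] at hj
    rw [Model.matA, if_neg (by omega), if_neg (by omega), if_neg (by omega), zero_mul]
  rw [h1, Finset.sum_insert (by simp; omega), Finset.sum_insert (by simp), Finset.sum_singleton]
  simp only [Model.matA, stencil]
  rw [if_pos (by omega), if_neg (show ¬i = i + 1 by omega), if_pos trivial,
    if_neg (show ¬i = i + 1 + 1 by omega), if_neg (show ¬i = i + 1 by omega), if_pos (by omega)]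
  ring

lemma summable_mul_of_memL2 {v w : ℤ → ℝ} (hv : MemL2 v) (hw : MemL2 w) :
    Summable fun i => v i * w i := by
  refine Summable.of_norm_bounded (Summable.add hv hw) fun i => ?_
  rw [Real.norm_eq_abs, abs_mul]
  nlinarith [sq_nonneg (|v i| - |w i|), sq_abs (v i), sq_abs (w i), sq_nonneg (v i + w i)]

lemma MemL2.comp_equiv {v : ℤ → ℝ} (hv : MemL2 v) (e : ℤ ≃ ℤ) : MemL2 fun i => v (e i) :=
  (Equiv.summable_iff e (f := fun i => v i ^ 2)).2 hv

/-- `A` is coercive, `⟨v, A v⟩ ≥ ‖v‖²`: the antisymmetric part does not contribute, and the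
symmetric part is `1` minus a multiple of the discrete Laplacian. Hence `A⁻¹` is a contraction. -/
lemma L2Bound.of_stencil {α β K : ℝ} (hβ : 0 ≤ β) {v : ℤ → ℝ} (hv : MemL2 v)
    (h : L2Bound (stencil α β v) K) : L2Bound v K := by
  have hs1 : MemL2 fun i => v (i + 1) := hv.comp_equiv (Equiv.addRight 1)
  have hs2 : MemL2 fun i => v (i - 1) := hv.comp_equiv (Equiv.subRight 1)
  have hp := summable_mul_of_memL2 hv hs1
  have hm := summable_mul_of_memL2 hv hs2
  have hv2 : Summable fun i => v i * v i := summable_mul_of_memL2 hv hv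
  set S := ∑' i, v i ^ 2 with hS
  set Q := ∑' i, v i * v (i + 1) with hQ
  have hS0 : 0 ≤ S := tsum_nonneg fun _ => sq_nonneg _
  have hQm : ∑' i, v i * v (i - 1) = Q := by
    rw [hQ, ← (Equiv.addRight (1 : ℤ)).tsum_eq]
    exact tsum_congr fun i => by simp [mul_comm]
  have hS1 : ∑' i, v (i + 1) ^ 2 = S := (Equiv.addRight (1 : ℤ)).tsum_eq fun i => v i ^ 2
  have hQS : Q ≤ S := by
    have h2 : Q ≤ ∑' i, (v i ^ 2 + v (i + 1) ^ 2) / 2 :=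
      hp.tsum_le_tsum (fun i => by nlinarith [sq_nonneg (v i - v (i + 1))])
        ((Summable.add hv hs1).div_const 2)
    rw [tsum_div_const, Summable.tsum_add hv hs1, hS1] at h2
    linarith
  have hsum : HasSum (fun i => v i * stencil α β v i)
      ((α - β) * Q + (1 + 2 * β) * S - (α + β) * Q) := by
    have h1 := (hm.hasSum.mul_left (α - β)).add (hv2.hasSum.mul_left (1 + 2 * β))
    have h2 := h1.sub (hp.hasSum.mul_left (α + β))
    rw [hQm, ← hQ] at h2
    have h3 : ∑' i, v i * v i = S := tsum_congr fun i => by ring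
    rw [h3] at h2
    exact h2.congr_fun fun i => by simp only [stencil]; ring
  have hle : (α - β) * Q + (1 + 2 * β) * S - (α + β) * Q ≤ K * √S := by
    refine hasSum_le_of_sum_le hsum fun F => ?_
    refine (le_abs_self _).trans ((h F v).trans ?_)
    exact mul_le_mul_of_nonneg_left
      (Real.sqrt_le_sqrt (Summable.sum_le_tsum F (fun _ _ => sq_nonneg _) hv)) h.nonneg
  have hSK : √S * √S ≤ K * √S := by
    rw [Real.mul_self_sqrt hS0]; nlinarith
  have hsq : √S ≤ K := by
    rcases (Real.sqrt_nonneg S).eq_or_lt with h4 | h4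
    · rw [← h4]; exact h.nonneg
    · exact le_of_mul_le_mul_right hSK h4
  exact (L2Bound.of_memL2 hv).mono hsq

lemma stencil_injective {α β : ℝ} (hβ : 0 ≤ β) {v v' : ℤ → ℝ} (hv : MemL2 v) (hv' : MemL2 v')
    (h : stencil α β v = stencil α β v') : v = v' := by
  have hd : MemL2 fun i => v i - v' i := ((L2Bound.of_memL2 hv).sub (.of_memL2 hv')).memL2
  have h0 : stencil α β (fun i => v i - v' i) = fun _ => 0 := by
    funext i
    have := congrFun h i
    simp only [stencil] at this ⊢
    linarith
  have h1 := L2Bound.of_stencil (K := 0) hβ hd (by rw [h0]; exact L2Bound.zero)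
  funext i
  exact sub_eq_zero.1 (abs_nonpos_iff.1 (h1.abs_le i))

/-- The leading factor in `A = c (1 - r₁ S) (1 - r₂ S⁻¹)`, where `S` is the shift. -/
noncomputable def facC (α β : ℝ) : ℝ := ((1 + 2 * β) + √(1 + 4 * β + 4 * α ^ 2)) / 2

/-- The inverse of `A` as a product of two geometric series in the shift and its inverse. It
provides existence of the `ℓ²` solution, and its measurable dependence on the parameters. -/
noncomputable def invStencil (α β : ℝ) (w : ℤ → ℝ) (i : ℤ) : ℝ :=
  (facC α β)⁻¹ * ∑' k : ℕ, ((β - α) / facC α β) ^ k *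
    ∑' m : ℕ, ((α + β) / facC α β) ^ m * w (i - k + m)

lemma facC_gt {α β : ℝ} (hβ : 0 ≤ β) : |α| + β < facC α β := by
  have h1 : 2 * |α| < √(1 + 4 * β + 4 * α ^ 2) := by
    apply Real.lt_sqrt_of_sq_lt
    rw [mul_pow, sq_abs]; linarith
  unfold facC; linarith

lemma facC_sq {α β : ℝ} (hβ : 0 ≤ β) :
    facC α β + (β - α) * (α + β) / facC α β = 1 + 2 * β := by
  have h0 : 0 < facC α β := lt_of_le_of_lt (by positivity) (facC_gt (α := α) hβ)
  have h1 := Real.sq_sqrt (show 0 ≤ 1 + 4 * β + 4 * α ^ 2 by positivity)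
  have h2 : √(1 + 4 * β + 4 * α ^ 2) = 2 * facC α β - (1 + 2 * β) := by unfold facC; ring
  rw [h2] at h1
  field_simp
  linarith

lemma abs_ratio_lt_one {α β : ℝ} (hβ : 0 ≤ β) :
    |(β - α) / facC α β| < 1 ∧ |(α + β) / facC α β| < 1 := by
  have h1 := facC_gt (α := α) hβ
  have h0 : 0 < facC α β := lt_of_le_of_lt (by positivity) h1
  have ha := neg_abs_le α
  have ha' := le_abs_self α
  simp only [abs_div, abs_of_pos h0, div_lt_one h0]
  constructor <;> rw [abs_lt] <;> constructor <;> linarith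

/-- The geometric series `∑ₘ rᵐ Sᵐ` in a shift inverts `1 - r S`. -/
lemma geom_tsum_shift {r : ℝ} (hr : |r| < 1) {w : ℤ → ℝ} {K : ℝ} (hw : ∀ i, |w i| ≤ K) (i e : ℤ) :
    ∑' m : ℕ, r ^ m * w (i + m * e) - r * ∑' m : ℕ, r ^ m * w (i + e + m * e) = w i := by
  have hs : Summable fun m : ℕ => r ^ m * w (i + m * e) := by
    refine Summable.of_norm_bounded ((summable_geometric_of_lt_one (abs_nonneg r) hr).mul_right K)
      fun m => ?_
    rw [Real.norm_eq_abs, abs_mul, abs_pow]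
    exact mul_le_mul_of_nonneg_left (hw _) (by positivity)
  rw [hs.tsum_eq_zero_add, ← tsum_mul_left]
  have : ∀ m : ℕ, r ^ (m + 1) * w (i + ((m + 1 : ℕ) : ℤ) * e)
      = r * (r ^ m * w (i + e + m * e)) := by
    intro m
    rw [pow_succ']
    push_cast
    rw [show i + ((m : ℤ) + 1) * e = i + e + m * e by ring]
    ring
  simp only [this]
  simp

lemma L2Bound.geom {r K : ℝ} (hr : |r| < 1) {w : ℤ → ℝ} (hw : L2Bound w K) (e : ℤ) :
    L2Bound (fun i => ∑' m : ℕ, r ^ m * w (i + m * e)) (∑' m : ℕ, |r ^ m| * K) := by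
  refine L2Bound.tsum (fun m => (hw.shift (m * e)).const_mul (r ^ m)) ?_
  simp only [abs_pow]
  exact (summable_geometric_of_lt_one (abs_nonneg r) hr).mul_right K

lemma invStencil_memL2 {α β K : ℝ} (hβ : 0 ≤ β) {w : ℤ → ℝ} (hw : L2Bound w K) :
    MemL2 (invStencil α β w) := by
  have h1 := (hw.geom (abs_ratio_lt_one (α := α) hβ).2 1).geom (abs_ratio_lt_one (α := α) hβ).1 (-1)
  have h2 := (h1.const_mul (facC α β)⁻¹).memL2
  convert h2 using 2 with i
  simp only [invStencil, mul_one, mul_neg, ← sub_eq_add_neg]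

lemma stencil_invStencil {α β K : ℝ} (hβ : 0 ≤ β) {w : ℤ → ℝ} (hw : L2Bound w K) :
    stencil α β (invStencil α β w) = w := by
  obtain ⟨hr1, hr2⟩ := abs_ratio_lt_one (α := α) hβ
  have hc : 0 < facC α β := lt_of_le_of_lt (by positivity) (facC_gt (α := α) hβ)
  have hsq := facC_sq (α := α) hβ
  set c := facC α β with hcdef
  set r₁ := (β - α) / c with hr₁
  set r₂ := (α + β) / c with hr₂
  set q : ℤ → ℝ := fun i => ∑' m : ℕ, r₂ ^ m * w (i + m * 1) with hq
  have hqb : L2Bound q _ := hw.geom hr2 1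
  have hqw : ∀ i, q i - r₂ * q (i + 1) = w i := fun i => geom_tsum_shift hr2 hw.abs_le i 1
  have hv : ∀ i, invStencil α β w i = c⁻¹ * ∑' k : ℕ, r₁ ^ k * q (i + k * (-1)) := by
    intro i
    simp only [invStencil, hq, mul_one, mul_neg, ← sub_eq_add_neg, ← hcdef, ← hr₁, ← hr₂]
  have hvq : ∀ i, invStencil α β w i - r₁ * invStencil α β w (i - 1) = c⁻¹ * q i := by
    intro i
    have := geom_tsum_shift hr1 hqb.abs_le i (-1)
    rw [hv, hv, sub_eq_add_neg i 1]
    rw [← this]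
    ring
  funext i
  have e1 := hvq i
  have e2 := hvq (i + 1)
  rw [add_sub_cancel_right] at e2
  have e3 := hqw i
  set v := invStencil α β w
  have f1 : α - β = -(c * r₁) := by rw [hr₁]; field_simp; ring
  have f2 : α + β = c * r₂ := by rw [hr₂]; field_simp
  have f3 : 1 + 2 * β = c + c * r₁ * r₂ := by
    rw [← hsq, hr₁, hr₂]; field_simp
  have g1 : q i = c * (v i - r₁ * v (i - 1)) := by rw [e1]; field_simp
  have g2 : q (i + 1) = c * (v (i + 1) - r₁ * v i) := by rw [e2]; field_simp
  rw [← e3, g1, g2]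
  simp only [stencil, f1, f2, f3]
  ring

/-! ### The explicit jump operator and one step of the scheme -/

/-- The operator `φ ↦ ∑ₗ bₗ (φ(· + l) - φ)` on sequences. -/
noncomputable def jumpSum (b φ : ℤ → ℝ) (i : ℤ) : ℝ := ∑' l, b l * (φ (i + l) - φ i)

lemma L2Bound.jumpSum {b φ : ℤ → ℝ} {K Λ : ℝ} (hφ : L2Bound φ K) (hb : ∀ l, 0 ≤ b l)
    (hs : Summable b) (hΛ : ∑' l, b l ≤ Λ) : L2Bound (jumpSum b φ) (2 * Λ * K) := by
  have h1 : ∀ l, L2Bound (fun i => b l * (φ (i + l) - φ i)) (b l * (K + K)) := fun l => by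
    have := ((hφ.shift l).sub hφ).const_mul (b l)
    rwa [abs_of_nonneg (hb l)] at this
  refine (L2Bound.tsum h1 (hs.mul_right _)).mono ?_
  rw [tsum_mul_right]
  nlinarith [hφ.nonneg]

lemma jumpSum_sub {b φ ψ : ℤ → ℝ} {K L : ℝ} (hb : Summable b) (hφ : ∀ i, |φ i| ≤ K)
    (hψ : ∀ i, |ψ i| ≤ L) (i : ℤ) :
    jumpSum b (fun i => φ i - ψ i) i = jumpSum b φ i - jumpSum b ψ i := by
  have hsum : ∀ {χ : ℤ → ℝ} {L : ℝ}, (∀ i, |χ i| ≤ L) →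
      Summable fun l => b l * (χ (i + l) - χ i) := fun {χ L} hχ => by
    refine Summable.of_norm_bounded (hb.norm.mul_right (L + L)) fun l => ?_
    rw [norm_mul]
    exact mul_le_mul_of_nonneg_left
      ((abs_sub _ _).trans (add_le_add (hχ _) (hχ _))) (norm_nonneg _)
  rw [jumpSum, jumpSum, jumpSum, ← (hsum hφ).tsum_sub (hsum hψ)]
  exact tsum_congr fun l => by ring

/-- The weights `ν_y(l Δx) Δx` of the trapezoidal rule. -/
noncomputable def Model.weight (M : Model) (dx y : ℝ) (l : ℤ) : ℝ := M.νy y (l * dx) * dx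

lemma applyMat_matB (M : Model) (h dx y : ℝ) {φ : ℤ → ℝ} {K : ℝ} (hφ : ∀ i, |φ i| ≤ K)
    (hs : Summable (M.weight dx y)) :
    applyMat (M.matB h dx y) φ = fun i => φ i + h * jumpSum (M.weight dx y) φ i := by
  funext i
  have hbφ : ∀ i, Summable fun l => M.weight dx y l * φ (i + l) := fun i => by
    refine Summable.of_norm_bounded (hs.norm.mul_right K) fun l => ?_
    rw [norm_mul]
    exact mul_le_mul_of_nonneg_left (hφ _) (norm_nonneg _)
  have h1 : HasSum (fun j => M.matB h dx y i j * φ j)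
      (h * (∑' l, M.weight dx y l * φ (i + l)) + (1 - h * ∑' l, M.weight dx y l) * φ i) := by
    have e1 : HasSum (fun j => h * (M.weight dx y (j - i) * φ j))
        (h * ∑' l, M.weight dx y l * φ (i + l)) := by
      refine HasSum.mul_left h ?_
      rw [← (Equiv.addLeft i).hasSum_iff]
      refine (hbφ i).hasSum.congr_fun fun l => ?_
      simp
    have e2 := hasSum_ite_eq i ((1 - h * ∑' l, M.weight dx y l) * φ i)
    refine (e1.add e2).congr_fun fun j => ?_
    simp only [Model.matB, Model.weight]
    by_cases hij : i = j
    · subst hij; simp; ring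
    · rw [if_neg hij, if_neg (fun hji => hij hji.symm)]; ring
  rw [applyMat, h1.tsum_eq]
  have h2 : jumpSum (M.weight dx y) φ i
      = (∑' l, M.weight dx y l * φ (i + l)) - (∑' l, M.weight dx y l) * φ i := by
    rw [← tsum_mul_right, ← (hbφ i).tsum_sub (hs.mul_right _)]
    exact tsum_congr fun l => by ring
  rw [h2]; ring

section Step

variable {M : Model} {h dx y : ℝ}

lemma step_eq_of_stencil_eq (hβ : 0 ≤ M.β h dx y) {φ v : ℤ → ℝ} (hv : MemL2 v)
    (hvφ : stencil (M.α h dx y) (M.β h dx y) v = applyMat (M.matB h dx y) φ) :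
    M.step h dx y φ = v := by
  have hex : ∃ v, MemL2 v ∧ applyMat (M.matA h dx y) v = applyMat (M.matB h dx y) φ :=
    ⟨v, hv, by rw [applyMat_matA, hvφ]⟩
  rw [Model.step, solveL2, dif_pos hex]
  refine stencil_injective (α := M.α h dx y) hβ hex.choose_spec.1 hv ?_
  rw [hvφ, ← applyMat_matA, hex.choose_spec.2]

/-- What the analysis uses about the trapezoidal weights at the state `y`. -/
structure WeightBound (M : Model) (h dx y Λ : ℝ) : Prop where
  h_nonneg : 0 ≤ h
  nonneg : ∀ l, 0 ≤ M.weight dx y l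
  summable : Summable (M.weight dx y)
  tsum_le : ∑' l, M.weight dx y l ≤ Λ

namespace WeightBound

variable {Λ K : ℝ} {φ : ℤ → ℝ}

lemma β_nonneg (hw : WeightBound M h dx y Λ) : 0 ≤ M.β h dx y := by
  have := hw.h_nonneg
  unfold Model.β; positivity

lemma applyMat_eq (hw : WeightBound M h dx y Λ) (hφ : L2Bound φ K) :
    applyMat (M.matB h dx y) φ = fun i => φ i + h * jumpSum (M.weight dx y) φ i :=
  applyMat_matB M h dx y hφ.abs_le hw.summable

lemma l2Bound_applyMat (hw : WeightBound M h dx y Λ) (hφ : L2Bound φ K) :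
    L2Bound (applyMat (M.matB h dx y) φ) ((1 + 2 * Λ * h) * K) := by
  rw [hw.applyMat_eq hφ]
  have := hφ.add ((hφ.jumpSum hw.nonneg hw.summable hw.tsum_le).const_mul h)
  rw [abs_of_nonneg hw.h_nonneg] at this
  exact this.mono (by linarith)

lemma step_eq_invStencil (hw : WeightBound M h dx y Λ) (hφ : L2Bound φ K) :
    M.step h dx y φ
      = invStencil (M.α h dx y) (M.β h dx y) (applyMat (M.matB h dx y) φ) :=
  step_eq_of_stencil_eq hw.β_nonneg (invStencil_memL2 hw.β_nonneg (hw.l2Bound_applyMat hφ))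
    (stencil_invStencil hw.β_nonneg (hw.l2Bound_applyMat hφ))

lemma stencil_step (hw : WeightBound M h dx y Λ) (hφ : L2Bound φ K) :
    stencil (M.α h dx y) (M.β h dx y) (M.step h dx y φ) = applyMat (M.matB h dx y) φ := by
  rw [hw.step_eq_invStencil hφ]
  exact stencil_invStencil hw.β_nonneg (hw.l2Bound_applyMat hφ)

/-- One step of the scheme is `ℓ²`-stable. -/
lemma l2Bound_step (hw : WeightBound M h dx y Λ) (hφ : L2Bound φ K) :
    L2Bound (M.step h dx y φ) ((1 + 2 * Λ * h) * K) := by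
  refine L2Bound.of_stencil hw.β_nonneg ?_ (hw.stencil_step hφ ▸ hw.l2Bound_applyMat hφ)
  rw [hw.step_eq_invStencil hφ]
  exact invStencil_memL2 hw.β_nonneg (hw.l2Bound_applyMat hφ)

lemma step_sub (hw : WeightBound M h dx y Λ) {ψ : ℤ → ℝ} {L : ℝ} (hφ : L2Bound φ K)
    (hψ : L2Bound ψ L) : M.step h dx y (fun i => φ i - ψ i)
      = fun i => M.step h dx y φ i - M.step h dx y ψ i := by
  refine step_eq_of_stencil_eq hw.β_nonneg
    ((hw.l2Bound_step hφ).sub (hw.l2Bound_step hψ)).memL2 ?_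
  have h1 := hw.stencil_step hφ
  have h2 := hw.stencil_step hψ
  rw [hw.applyMat_eq hφ] at h1
  rw [hw.applyMat_eq hψ] at h2
  rw [hw.applyMat_eq (hφ.sub hψ)]
  funext i
  have e1 := congrFun h1 i
  have e2 := congrFun h2 i
  have e3 := jumpSum_sub hw.summable hφ.abs_le hψ.abs_le i
  simp only [stencil] at e1 e2 ⊢
  rw [e3]
  linarith

end WeightBound

end Step

/-! ### Quadrature on a grid -/

lemma hasSum_integral_cells {d : ℝ} (hd : 0 < d) {g : ℝ → ℝ} (hg : Integrable g) :
    HasSum (fun l : ℤ => ∫ x in (l * d)..((l + 1) * d), g x) (∫ x, g x) := by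
  have hU := iUnion_Ioc_zsmul hd
  have h1 := hasSum_integral_iUnion (μ := volume) (f := g)
    (s := fun n : ℤ => Set.Ioc (n • d) ((n + 1) • d)) (fun _ => measurableSet_Ioc)
    (Set.pairwise_disjoint_Ioc_zsmul d) (by rw [hU]; exact hg.integrableOn)
  rw [hU, setIntegral_univ] at h1
  refine h1.congr_fun fun l => ?_
  rw [intervalIntegral.integral_of_le (by nlinarith)]
  simp

/-- The left rectangle rule on one cell. -/
lemma abs_rect_sub_integral_le {a b : ℝ} (hab : a ≤ b) {g g' : ℝ → ℝ}
    (hg : ∀ x, HasDerivAt g (g' x) x) (hi' : Integrable g') :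
    |g a * (b - a) - ∫ x in a..b, g x| ≤ (b - a) * ∫ x in a..b, |g' x| := by
  have hc : Continuous g := continuous_iff_continuousAt.2 fun x => (hg x).continuousAt
  have hV : ∀ x ∈ Set.uIoc a b, ‖g a - g x‖ ≤ ∫ x in a..b, |g' x| := by
    intro x hx
    rw [Set.uIoc_of_le hab] at hx
    have h1 := intervalIntegral.integral_eq_sub_of_hasDerivAt (a := a) (b := x)
      (fun z _ => hg z) hi'.intervalIntegrable
    rw [norm_sub_rev, ← h1]
    refine (intervalIntegral.norm_integral_le_integral_norm hx.1.le).trans ?_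
    exact intervalIntegral.integral_mono_interval le_rfl hx.1.le hx.2
      (Eventually.of_forall fun _ => abs_nonneg _) hi'.abs.intervalIntegrable
  have h2 := intervalIntegral.norm_integral_le_of_norm_le_const hV
  rw [intervalIntegral.integral_sub (by simp) (hc.intervalIntegrable _ _)] at h2
  simp only [intervalIntegral.integral_const, smul_eq_mul, Real.norm_eq_abs,
    abs_of_nonneg (sub_nonneg.2 hab)] at h2
  rw [mul_comm (g a), mul_comm (b - a) (∫ x in a..b, |g' x|)]
  exact h2

/-- The rectangle rule on the line, of first order with one integrable derivative. -/
lemma rect_sum {d : ℝ} (hd : 0 < d) {g g' : ℝ → ℝ}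
    (hg : ∀ x, HasDerivAt g (g' x) x) (hi : Integrable g) (hi' : Integrable g') :
    Summable (fun l : ℤ => g (l * d) * d) ∧
      |∑' l : ℤ, g (l * d) * d - ∫ x, g x| ≤ d * ∫ x, |g' x| := by
  have h1 := hasSum_integral_cells hd hi
  have h2 := (hasSum_integral_cells hd hi'.abs).mul_left d
  have h3 : ∀ l : ℤ, ‖g (l * d) * d - ∫ x in (l * d)..((l + 1) * d), g x‖
      ≤ d * ∫ x in (l * d)..((l + 1) * d), |g' x| := by
    intro l
    have := abs_rect_sub_integral_le (a := l * d) (b := (l + 1) * d) (by nlinarith) hg hi'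
    rwa [show (l + 1) * d - l * d = d by ring] at this
  have h4 : Summable fun l : ℤ => g (l * d) * d - ∫ x in (l * d)..((l + 1) * d), g x :=
    Summable.of_norm_bounded h2.summable h3
  have h5 : Summable fun l : ℤ => g (l * d) * d := by simpa using h4.add h1.summable
  refine ⟨h5, ?_⟩
  rw [← h1.tsum_eq, ← h5.tsum_sub h1.summable]
  exact tsum_of_norm_bounded h2 h3

/-- The trapezoidal rule on one cell. -/
lemma abs_trapezoid_sub_integral_le {a b : ℝ} (hab : a ≤ b) {g g' g'' : ℝ → ℝ}
    (hg : ∀ x, HasDerivAt g (g' x) x) (hg' : ∀ x, HasDerivAt g' (g'' x) x)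
    (hi : Integrable g'') :
    |(g a + g b) * ((b - a) / 2) - ∫ x in a..b, g x| ≤ (b - a) ^ 2 * ∫ x in a..b, |g'' x| := by
  have hc : Continuous g := continuous_iff_continuousAt.2 fun x => (hg x).continuousAt
  set V := ∫ x in a..b, |g'' x| with hV
  have hV0 : 0 ≤ V := intervalIntegral.integral_nonneg hab fun _ _ => abs_nonneg _
  have h1 : ∀ s ∈ Set.Icc a b, ∀ r ∈ Set.Icc a s, ‖g' r - g' s‖ ≤ V := by
    intro s hs r hr
    have h2 := intervalIntegral.integral_eq_sub_of_hasDerivAt (a := r) (b := s)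
      (fun z _ => hg' z) hi.intervalIntegrable
    rw [norm_sub_rev, ← h2]
    refine (intervalIntegral.norm_integral_le_integral_norm hr.2).trans ?_
    exact intervalIntegral.integral_mono_interval hr.1 hr.2 hs.2
      (Eventually.of_forall fun _ => abs_nonneg _) hi.abs.intervalIntegrable
  have h3 : ∀ s ∈ Set.Icc a b, ‖g s - g a - (s - a) * g' s‖ ≤ V * (b - a) := by
    intro s hs
    have h4 := (convex_Icc a s).norm_image_sub_le_of_norm_hasDerivWithin_le
      (f := fun r => g r - r * g' s) (f' := fun r => g' r - 1 * g' s) (C := V)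
      (fun r _ => ((hg r).sub ((hasDerivAt_id r).mul_const (g' s))).hasDerivWithinAt)
      (fun r hr => by simpa using h1 s hs r hr) (Set.left_mem_Icc.2 hs.1)
      (Set.right_mem_Icc.2 hs.1)
    rw [Real.norm_eq_abs (s - a), abs_of_nonneg (sub_nonneg.2 hs.1)] at h4
    refine le_trans (le_of_eq ?_) (h4.trans (mul_le_mul_of_nonneg_left (by linarith [hs.2]) hV0))
    congr 1; ring
  have h5 := (convex_Icc a b).norm_image_sub_le_of_norm_hasDerivWithin_le
    (f := fun s => (g a + g s) * ((s - a) / 2) - ∫ x in a..s, g x)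
    (f' := fun s => g' s * ((s - a) / 2) + (g a + g s) * (1 / 2) - g s) (C := V * (b - a))
    (fun s _ => ((((hg s).const_add (g a)).mul
      (((hasDerivAt_id s).sub_const a).div_const 2)).sub
      (intervalIntegral.integral_hasDerivAt_right (hc.intervalIntegrable _ _)
        hc.aestronglyMeasurable.stronglyMeasurableAtFilter hc.continuousAt)).hasDerivWithinAt)
    (fun s hs => by
      have h6 : g' s * ((s - a) / 2) + (g a + g s) * (1 / 2) - g s
          = -(1 / 2) * (g s - g a - (s - a) * g' s) := by ring
      rw [h6, norm_mul]
      have h7 : ‖(-(1 / 2) : ℝ)‖ = 1 / 2 := by rw [norm_neg, Real.norm_eq_abs]; norm_num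
      have h8 := h3 s hs
      rw [h7]
      nlinarith [norm_nonneg (g s - g a - (s - a) * g' s)])
    (Set.left_mem_Icc.2 hab) (Set.right_mem_Icc.2 hab)
  rw [Real.norm_eq_abs (b - a), abs_of_nonneg (sub_nonneg.2 hab)] at h5
  simp only [sub_self, zero_div, mul_zero, intervalIntegral.integral_same, sub_zero] at h5
  exact h5.trans (le_of_eq (by ring))

/-- The trapezoidal rule on the line, of second order with two integrable derivatives. -/
lemma trapezoid_sum {d : ℝ} (hd : 0 < d) {g g' g'' : ℝ → ℝ}
    (hg : ∀ x, HasDerivAt g (g' x) x) (hg' : ∀ x, HasDerivAt g' (g'' x) x)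
    (hi : Integrable g) (hi'' : Integrable g'') (hs : Summable fun l : ℤ => g (l * d) * d) :
    |∑' l : ℤ, g (l * d) * d - ∫ x, g x| ≤ d ^ 2 * ∫ x, |g'' x| := by
  have h1 := hasSum_integral_cells hd hi
  have h2 := (hasSum_integral_cells hd hi''.abs).mul_left (d ^ 2)
  have h3 : ∀ l : ℤ, ‖(g (l * d) + g ((l + 1) * d)) * (d / 2)
      - ∫ x in (l * d)..((l + 1) * d), g x‖ ≤ d ^ 2 * ∫ x in (l * d)..((l + 1) * d), |g'' x| := by
    intro l
    have := abs_trapezoid_sub_integral_le (a := l * d) (b := (l + 1) * d) (by nlinarith) hg hg' hi''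
    rwa [show (l + 1) * d - l * d = d by ring] at this
  have h4 : HasSum (fun l : ℤ => g ((l + 1) * d) * d) (∑' l : ℤ, g (l * d) * d) := by
    have := (Equiv.addRight (1 : ℤ)).hasSum_iff.2 hs.hasSum
    exact this.congr_fun fun l => by simp
  have h5 : HasSum (fun l : ℤ => (g (l * d) + g ((l + 1) * d)) * (d / 2))
      (∑' l : ℤ, g (l * d) * d) := by
    have := (hs.hasSum.add h4).div_const 2
    rw [add_self_div_two] at this
    exact this.congr_fun fun l => by ring
  rw [← h1.tsum_eq]
  conv_lhs => rw [← h5.tsum_eq]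
  rw [← h5.summable.tsum_sub h1.summable]
  exact tsum_of_norm_bounded h2 h3

/-- Sampling on a grid of a function in `H¹(ℝ)`. -/
lemma L2Bound.sample {d : ℝ} (hd : 0 < d) (hd1 : d ≤ 1) {g g' : ℝ → ℝ} {K : ℝ} (hK : 0 ≤ K)
    (hg : ∀ x, HasDerivAt g (g' x) x) (h : MemLp g 2 volume) (h' : MemLp g' 2 volume)
    (hb : ∫ x, g x ^ 2 ≤ K ^ 2) (hb' : ∫ x, g' x ^ 2 ≤ K ^ 2) (x : ℝ) :
    L2Bound (fun l => g (x + l * d)) (2 * K / √d) := by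
  have hi : Integrable fun z => g z ^ 2 := h.integrable_sq
  have hi' : Integrable fun z => g' z ^ 2 := h'.integrable_sq
  have hp : Integrable fun z => g z * g' z := h.integrable_mul h'
  have hder : ∀ z, HasDerivAt (fun z => g (x + z) ^ 2) (2 * (g (x + z) * g' (x + z))) z := by
    intro z
    have h1 : HasDerivAt (fun z => g (x + z)) (g' (x + z)) z := by
      simpa using (hg (x + z)).comp_const_add x z
    exact (h1.fun_pow 2).congr_deriv (by norm_num; ring)
  obtain ⟨h2, h3⟩ := rect_sum hd hder (hi.comp_add_left x) ((hp.comp_add_left x).const_mul 2)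
  rw [integral_add_left_eq_self (fun z => g z ^ 2) x,
    integral_add_left_eq_self (fun z => |2 * (g z * g' z)|) x] at h3
  have h4 : ∫ z, |2 * (g z * g' z)| ≤ K ^ 2 + K ^ 2 := by
    refine le_trans (integral_mono (hp.const_mul 2).abs (hi.add hi') fun z => ?_)
      (le_trans (le_of_eq (integral_add hi hi')) (add_le_add hb hb'))
    simp only [Pi.add_apply]
    rw [_root_.abs_le]
    constructor <;> nlinarith [sq_nonneg (g z + g' z), sq_nonneg (g z - g' z)]
  have h5 : ∑' l : ℤ, g (x + l * d) ^ 2 * d ≤ 4 * K ^ 2 := by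
    have := (_root_.abs_le.1 h3).2
    have h6 : 0 ≤ ∫ z, |2 * (g z * g' z)| := integral_nonneg fun _ => abs_nonneg _
    nlinarith [mul_le_mul_of_nonneg_right hd1 h6]
  refine L2Bound.of_sum_sq_le (by positivity) fun F => ?_
  have h7 : ∑ l ∈ F, g (x + l * d) ^ 2 * d ≤ 4 * K ^ 2 :=
    (Summable.sum_le_tsum F (fun _ _ => by positivity) h2).trans h5
  rw [div_pow, Real.sq_sqrt hd.le, le_div_iff₀ hd, Finset.sum_mul]
  linarith

/-! ### The Lévy density -/

namespace Model

variable {M : Model}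

lemma ν_nonneg (hM : M.Standing) (z : ℝ) : 0 ≤ M.ν z :=
  mul_nonneg hM.lam_pos.le (hM.pJ_nonneg z)

lemma measurable_ν (hM : M.Standing) : Measurable M.ν := hM.meas_pJ.const_mul _

lemma integrable_ν (hM : M.Standing) : Integrable M.ν := by
  refine Integrable.const_mul ⟨hM.meas_pJ.aestronglyMeasurable, ?_⟩ _
  rw [hasFiniteIntegral_iff_ofReal (Eventually.of_forall hM.pJ_nonneg), hM.pJ_lintegral]
  exact ENNReal.one_lt_top

/-- A function that is integrable against the Lévy measure after division by `ν`, and vanishes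
almost everywhere where `ν` does, is integrable. -/
lemma integrable_of_div_memLp (hM : M.Standing) {g : ℝ → ℝ}
    (hg : MemLp (fun z => g z / M.ν z) 2 M.levyMeasure) (h0 : ∀ᵐ z, M.ν z = 0 → g z = 0) :
    Integrable g := by
  have hfin : IsFiniteMeasure M.levyMeasure := by
    refine ⟨?_⟩
    rw [Model.levyMeasure, withDensity_apply _ MeasurableSet.univ, setLIntegral_univ]
    have := (integrable_ν hM).2
    rwa [hasFiniteIntegral_iff_ofReal (Eventually.of_forall (ν_nonneg hM))] at this
  have h1 : Integrable (fun z => g z / M.ν z) M.levyMeasure := hg.integrable one_le_two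
  rw [Model.levyMeasure, integrable_withDensity_iff_integrable_smul'
    (measurable_ν hM).ennreal_ofReal (by simp)] at h1
  refine h1.congr (h0.mono fun z hz => ?_)
  simp only [ENNReal.toReal_ofReal (ν_nonneg hM z), smul_eq_mul]
  by_cases hν : M.ν z = 0
  · rw [hz hν, hν, zero_mul]
  · field_simp

lemma deriv_ν_eq_zero (hM : M.Standing) {z : ℝ} (hz : M.ν z = 0) : deriv M.ν z = 0 :=
  IsLocalMin.deriv_eq_zero (Eventually.of_forall fun x => by rw [hz]; exact ν_nonneg hM x)

lemma integrable_deriv_ν (hM : M.Standing) (hν : M.LevyRegular) : Integrable (deriv M.ν) :=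
  integrable_of_div_memLp hM hν.memLp_one (Eventually.of_forall fun _ => deriv_ν_eq_zero hM)

/-- A zero of `ν` at which `ν''` does not vanish is an isolated zero of `ν'`; there are only
countably many of these. -/
lemma integrable_deriv_deriv_ν (hM : M.Standing) (hν : M.LevyRegular) :
    Integrable (deriv (deriv M.ν)) := by
  refine integrable_of_div_memLp hM hν.memLp_two ?_
  set S : Set ℝ := {z | deriv M.ν z = 0 ∧ deriv (deriv M.ν) z ≠ 0} with hS
  have hdisc : DiscreteTopology S := by
    rw [discreteTopology_subtype_iff]
    intro z hz
    have h1 := (hν.diff_deriv z).hasDerivAt.eventually_ne hz.2 (c := 0)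
    rw [← disjoint_iff]
    exact Filter.disjoint_principal_right.2 (h1.mono fun x hx hxS => hx hxS.1)
  have hc : S.Countable := (HereditarilyLindelofSpace.isLindelof S).countable hdisc
  have h2 : ∀ᵐ z, z ∉ S := hc.ae_notMem _
  refine h2.mono fun z hz h0 => ?_
  by_contra h3
  exact hz ⟨deriv_ν_eq_zero hM h0, h3⟩

/-- The uniform bounds of the jump part: mass of the trapezoidal weights, `ℓ²`-norm of the
nonlocal operator, and second order consistency of the trapezoidal rule. -/
structure JumpBound (M : Model) (dx y Λ : ℝ) : Prop where
  weight_nonneg : ∀ l, 0 ≤ M.weight dx y l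
  weight_summable : Summable (M.weight dx y)
  weight_tsum_le : ∑' l, M.weight dx y l ≤ Λ
  nonlocal : ∀ (g : ℝ → ℤ → ℝ) (K : ℝ), (∀ i, Continuous fun z => g z i) →
    (∀ z, L2Bound (g z) K) →
    L2Bound (fun i => ∫ ζ, (g (M.γX y * ζ) i - g 0 i) * M.ν ζ) (2 * Λ * K)
  trapezoid : ∀ (g : ℕ → ℝ → ℤ → ℝ) (K : ℝ),
    (∀ k < 2, ∀ i z, HasDerivAt (fun z => g k z i) (g (k + 1) z i) z) →
    (∀ k ≤ 2, ∀ z, L2Bound (g k z) K) →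
    L2Bound (fun i => (∑' l : ℤ, M.weight dx y l * (g 0 (l * dx) i - g 0 0 i))
      - ∫ ζ, (g 0 (M.γX y * ζ) i - g 0 0 i) * M.ν ζ) (dx ^ 2 * Λ * K)

lemma hasDerivAt_νy {g : ℝ → ℝ} (hg : Differentiable ℝ g) (a γ z : ℝ) :
    HasDerivAt (fun z => a * g (z / γ)) (a * γ⁻¹ * deriv g (z / γ)) z := by
  have h1 : HasDerivAt (fun z : ℝ => z / γ) (1 / γ) z := (hasDerivAt_id z).div_const γ
  exact (((hg (z / γ)).hasDerivAt.comp z h1).const_mul a).congr_deriv (by ring)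

lemma integral_abs_comp_div (g : ℝ → ℝ) (a γ : ℝ) :
    ∫ z, |a * g (z / γ)| = |a| * (|γ| * ∫ z, |g z|) := by
  simp only [abs_mul]
  rw [integral_const_mul, Measure.integral_comp_div (fun z => |g z|) γ, smul_eq_mul]

lemma nonlocal_bound (hM : M.Standing) (y : ℝ) (g : ℝ → ℤ → ℝ) (K : ℝ)
    (hc : ∀ i, Continuous fun z => g z i) (hK : ∀ z, L2Bound (g z) K) :
    L2Bound (fun i => ∫ ζ, (g (M.γX y * ζ) i - g 0 i) * M.ν ζ) (2 * (∫ ζ, M.ν ζ) * K) := by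
  have h1 := L2Bound.integral (m := volume) (ψ := fun ζ i => (g (M.γX y * ζ) i - g 0 i) * M.ν ζ)
    (k := fun ζ => M.ν ζ * (K + K)) (fun i => (Continuous.aestronglyMeasurable
      (((hc i).comp (continuous_const.mul continuous_id)).sub continuous_const)).mul
      (measurable_ν hM).aestronglyMeasurable)
    (Eventually.of_forall fun ζ => by
      have := ((hK (M.γX y * ζ)).sub (hK 0)).const_mul (M.ν ζ)
      rw [abs_of_nonneg (ν_nonneg hM ζ)] at this
      simpa only [mul_comm] using this) ((integrable_ν hM).mul_const _)
  refine h1.mono (le_of_eq ?_)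
  rw [integral_mul_const]; ring

/-- Where `γX` is bounded away from zero, `ν_y` and its two derivatives are bounded in `L¹` uniformly
in `y`, by scaling. The trapezoidal rule is applied to `z ↦ ν_y(z) (g(z) - g(0))`, whose second
derivative is then integrable. -/
lemma exists_jumpBound (hM : M.Standing) (hν : M.LevyRegular) :
    ∃ Λ > 0, ∀ y ∈ M.D, ∀ dx, 0 < dx → dx < 1 → JumpBound M dx y Λ := by
  have hI0 := integrable_ν hM
  have hI1 := integrable_deriv_ν hM hν
  have hI2 := integrable_deriv_deriv_ν hM hν
  set N0 := ∫ z, M.ν z with hN0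
  set N1 := ∫ z, |deriv M.ν z| with hN1
  set N2 := ∫ z, |deriv (deriv M.ν) z| with hN2
  have hN0' : 0 ≤ N0 := integral_nonneg (ν_nonneg hM)
  have hN1' : 0 ≤ N1 := integral_nonneg fun _ => abs_nonneg _
  have hN2' : 0 ≤ N2 := integral_nonneg fun _ => abs_nonneg _
  rcases hM.jumps with h0 | ⟨ε, hε, hγ⟩
  · refine ⟨N0 + 1, by positivity, fun y hy dx hdx _ => ?_⟩
    have hw : M.weight dx y = fun _ => 0 := by
      funext l
      simp [Model.weight, Model.νy, h0 y hy]
    refine ⟨fun l => by simp [hw], by rw [hw]; exact summable_zero, by simp [hw]; positivity,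
      fun g K hc hK => (nonlocal_bound hM y g K hc hK).mono ?_, fun g K _ hK => ?_⟩
    · have := (hK 0).nonneg
      nlinarith
    · have hK0 := (hK 0 (by omega) 0).nonneg
      simp only [hw, h0 y hy, zero_mul, sub_self, tsum_zero, integral_zero]
      exact L2Bound.zero.mono (by positivity)
  · refine ⟨N0 + 2 * (N1 / ε) + 2 * (N2 / ε ^ 2) + 1, by positivity, fun y hy dx hdx hdx1 => ?_⟩
    set Λ := N0 + 2 * (N1 / ε) + 2 * (N2 / ε ^ 2) + 1 with hΛ
    have hγy := hγ y hy
    set γ := M.γX y with hγdef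
    have hγa : 0 < |γ| := hε.trans_le hγy
    have hγ0 : γ ≠ 0 := abs_pos.1 hγa
    set n : ℝ → ℝ := fun z => |γ|⁻¹ * M.ν (z / γ) with hn
    set n' : ℝ → ℝ := fun z => |γ|⁻¹ * γ⁻¹ * deriv M.ν (z / γ) with hn'
    set n'' : ℝ → ℝ := fun z => |γ|⁻¹ * γ⁻¹ * γ⁻¹ * deriv (deriv M.ν) (z / γ) with hn''
    have hnn : ∀ z, 0 ≤ n z := fun z => mul_nonneg (by positivity) (ν_nonneg hM _)
    have hd : ∀ z, HasDerivAt n (n' z) z := hasDerivAt_νy hν.diff _ γ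
    have hd' : ∀ z, HasDerivAt n' (n'' z) z := hasDerivAt_νy hν.diff_deriv _ γ
    have hi : Integrable n := (hI0.comp_div hγ0).const_mul _
    have hi' : Integrable n' := (hI1.comp_div hγ0).const_mul _
    have hi'' : Integrable n'' := (hI2.comp_div hγ0).const_mul _
    have hnc : Continuous n := continuous_iff_continuousAt.2 fun x => (hd x).continuousAt
    have hJ0 : ∫ z, n z = N0 := by
      rw [hn, integral_const_mul, Measure.integral_comp_div, smul_eq_mul, ← mul_assoc,
        inv_mul_cancel₀ hγa.ne', one_mul]
    have hJ1 : ∫ z, |n' z| ≤ N1 / ε := by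
      rw [hn', integral_abs_comp_div, ← hN1, abs_mul, abs_inv, abs_inv, abs_abs]
      rw [show |γ|⁻¹ * |γ|⁻¹ * (|γ| * N1) = N1 / |γ| by field_simp]
      gcongr
    have hJ2 : ∫ z, |n'' z| ≤ N2 / ε ^ 2 := by
      rw [hn'', integral_abs_comp_div, ← hN2, abs_mul, abs_mul, abs_inv, abs_inv, abs_abs]
      rw [show |γ|⁻¹ * |γ|⁻¹ * |γ|⁻¹ * (|γ| * N2) = N2 / |γ| ^ 2 by field_simp]
      gcongr
    obtain ⟨hs, hsum⟩ := rect_sum hdx hd hi hi'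
    refine ⟨fun l => mul_nonneg (hnn _) hdx.le, hs, ?_,
      fun g K hc hK => (nonlocal_bound hM y g K hc hK).mono ?_, fun g K hg hK F c => ?_⟩
    · have h1 := (abs_le.1 hsum).2
      rw [hJ0] at h1
      have h2 : dx * ∫ z, |n' z| ≤ 1 * (N1 / ε) :=
        mul_le_mul hdx1.le hJ1 (integral_nonneg fun _ => abs_nonneg _) zero_le_one
      have h3 : 0 ≤ N1 / ε := by positivity
      have h4 : 0 ≤ N2 / ε ^ 2 := by positivity
      change ∑' l : ℤ, n (l * dx) * dx ≤ Λ
      linarith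
    · have h1 := (hK 0).nonneg
      have h3 : 0 ≤ N1 / ε := by positivity
      have h4 : 0 ≤ N2 / ε ^ 2 := by positivity
      have : N0 ≤ Λ := by linarith
      gcongr
    · have hK0 := (hK 0 (by omega) 0).nonneg
      set s := √(∑ i ∈ F, c i ^ 2) with hs_def
      have hs0 : 0 ≤ s := Real.sqrt_nonneg _
      set U : ℕ → ℝ → ℝ := fun k z => ∑ i ∈ F, c i * g k z i with hU
      have hUd : ∀ k < 2, ∀ z, HasDerivAt (U k) (U (k + 1) z) z := fun k hk z =>
        HasDerivAt.fun_sum fun i _ => (hg k hk i z).const_mul _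
      have hUb : ∀ k ≤ 2, ∀ z, |U k z| ≤ K * s := fun k hk z => hK k hk z F c
      have hUc : ∀ k < 2, Continuous (U k) := fun k hk =>
        continuous_iff_continuousAt.2 fun z => (hUd k hk z).continuousAt
      have hUm : Measurable (U 2) := by
        have : U 2 = deriv (U 1) := funext fun z => (hUd 1 (by omega) z).deriv.symm
        rw [this]; exact measurable_deriv _
      have hUb0 : ∀ z, |U 0 z - U 0 0| ≤ 2 * (K * s) := fun z => by
        have := (abs_sub (U 0 z) (U 0 0)).trans
          (add_le_add (hUb 0 (by omega) z) (hUb 0 (by omega) 0))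
        linarith
      set G : ℝ → ℝ := fun z => n z * (U 0 z - U 0 0) with hG
      set G' : ℝ → ℝ := fun z => n' z * (U 0 z - U 0 0) + n z * U 1 z with hG'
      set G'' : ℝ → ℝ := fun z => (n'' z * (U 0 z - U 0 0) + n' z * U 1 z)
        + (n' z * U 1 z + n z * U 2 z) with hG''
      have hGd : ∀ z, HasDerivAt G (G' z) z := fun z =>
        (hd z).mul ((hUd 0 (by omega) z).sub_const _)
      have hGd' : ∀ z, HasDerivAt G' (G'' z) z := fun z =>
        ((hd' z).mul ((hUd 0 (by omega) z).sub_const _)).add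
          ((hd z).mul (hUd 1 (by omega) z))
      have hU0m : AEStronglyMeasurable (fun z => U 0 z - U 0 0) volume :=
        ((hUc 0 (by omega)).sub continuous_const).aestronglyMeasurable
      have hGi : Integrable G := hi.mul_bdd hU0m (Eventually.of_forall hUb0)
      have hGi'' : Integrable G'' :=
        ((hi''.mul_bdd hU0m (Eventually.of_forall hUb0)).add
          (hi'.mul_bdd (hUc 1 (by omega)).aestronglyMeasurable
            (Eventually.of_forall (hUb 1 (by omega))))).add
        ((hi'.mul_bdd (hUc 1 (by omega)).aestronglyMeasurable
            (Eventually.of_forall (hUb 1 (by omega)))).add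
          (hi.mul_bdd hUm.aestronglyMeasurable (Eventually.of_forall (hUb 2 le_rfl))))
      have hGs : Summable fun l : ℤ => G (l * dx) * dx := by
        refine Summable.of_norm_bounded (hs.norm.mul_right (2 * (K * s))) fun l => ?_
        have h1 : G (l * dx) * dx = n (l * dx) * dx * (U 0 (l * dx) - U 0 0) := by
          simp only [hG]; ring
        rw [h1, norm_mul]
        exact mul_le_mul_of_nonneg_left (hUb0 _) (norm_nonneg _)
      have hT := trapezoid_sum hdx hGd hGd' hGi hGi'' hGs
      have hbound : ∫ z, |G'' z| ≤ Λ * (K * s) := by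
        have hKs : 0 ≤ K * s := by positivity
        have h1 : ∀ z, |G'' z| ≤ (2 * |n'' z| + 2 * |n' z| + n z) * (K * s) := by
          intro z
          have e1 : |n'' z * (U 0 z - U 0 0)| ≤ |n'' z| * (2 * (K * s)) := by
            rw [abs_mul]; exact mul_le_mul_of_nonneg_left (hUb0 z) (abs_nonneg _)
          have e2 : |n' z * U 1 z| ≤ |n' z| * (K * s) := by
            rw [abs_mul]
            exact mul_le_mul_of_nonneg_left (hUb 1 (by omega) z) (abs_nonneg _)
          have e3 : |n z * U 2 z| ≤ n z * (K * s) := by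
            rw [abs_mul, abs_of_nonneg (hnn z)]
            exact mul_le_mul_of_nonneg_left (hUb 2 le_rfl z) (hnn z)
          refine (abs_add_le _ _).trans ((add_le_add (abs_add_le _ _) (abs_add_le _ _)).trans ?_)
          linarith
        refine (integral_mono hGi''.abs ((((hi''.abs.const_mul 2).add
          (hi'.abs.const_mul 2)).add hi).mul_const _) h1).trans ?_
        simp only [Pi.add_apply]
        rw [integral_mul_const, integral_add (f := fun z => 2 * |n'' z| + 2 * |n' z|)
          ((hi''.abs.const_mul 2).add (hi'.abs.const_mul 2)) hi,
          integral_add (hi''.abs.const_mul 2) (hi'.abs.const_mul 2),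
          integral_const_mul, integral_const_mul, hJ0]
        refine mul_le_mul_of_nonneg_right ?_ hKs
        linarith
      have hsumeq : ∑ i ∈ F, c i * ((∑' l : ℤ, M.weight dx y l * (g 0 (l * dx) i - g 0 0 i))
          - ∫ ζ, (g 0 (γ * ζ) i - g 0 0 i) * M.ν ζ)
          = ∑' l : ℤ, G (l * dx) * dx - ∫ z, G z := by
        have hwdef : ∀ l : ℤ, M.weight dx y l = n (l * dx) * dx := fun l => rfl
        have hgc : ∀ i, Continuous fun z => g 0 z i := fun i =>
          continuous_iff_continuousAt.2 fun z => (hg 0 (by omega) i z).continuousAt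
        have hgb : ∀ i z, |g 0 z i - g 0 0 i| ≤ K + K := fun i z => (abs_sub _ _).trans
          (add_le_add ((hK 0 (by omega) z).abs_le i) ((hK 0 (by omega) 0).abs_le i))
        have f1 : ∀ i, Summable fun l : ℤ => M.weight dx y l * (g 0 (l * dx) i - g 0 0 i) := by
          intro i
          refine Summable.of_norm_bounded (hs.norm.mul_right (K + K)) fun l => ?_
          rw [norm_mul]
          exact mul_le_mul_of_nonneg_left (hgb i _) (norm_nonneg _)
        have f2 : ∀ i, ∫ ζ, (g 0 (γ * ζ) i - g 0 0 i) * M.ν ζ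
            = ∫ z, n z * (g 0 z i - g 0 0 i) := by
          intro i
          have := Measure.integral_comp_mul_left
            (fun z => (g 0 z i - g 0 0 i) * M.ν (z / γ)) γ
          simp only [mul_div_cancel_left₀ _ hγ0] at this
          rw [this, smul_eq_mul, ← integral_const_mul, abs_inv]
          exact integral_congr_ae (Eventually.of_forall fun z => by simp only [hn]; ring)
        have f3 : ∀ i, Integrable fun z => n z * (g 0 z i - g 0 0 i) := fun i =>
          hi.mul_bdd ((hgc i).sub continuous_const).aestronglyMeasurable
            (Eventually.of_forall (hgb i))
        simp only [f2, mul_sub, Finset.sum_sub_distrib]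
        congr 1
        · simp only [← tsum_mul_left, ← mul_sub]
          rw [← Summable.tsum_finsetSum fun i _ => (f1 i).mul_left _]
          refine tsum_congr fun l => ?_
          simp only [hG, hU, hwdef, ← Finset.sum_sub_distrib, ← mul_sub]
          rw [Finset.mul_sum, Finset.sum_mul]
          exact Finset.sum_congr rfl fun i _ => by ring
        · simp only [← integral_const_mul, ← mul_sub]
          rw [← integral_finsetSum _ fun i _ => (f3 i).const_mul _]
          refine integral_congr_ae (Eventually.of_forall fun z => ?_)
          simp only [hG, hU, ← Finset.sum_sub_distrib, ← mul_sub]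
          rw [Finset.mul_sum]
          exact Finset.sum_congr rfl fun i _ => by ring
      rw [hsumeq]
      refine hT.trans ?_
      calc dx ^ 2 * ∫ z, |G'' z| ≤ dx ^ 2 * (Λ * (K * s)) := by gcongr
        _ = dx ^ 2 * Λ * K * s := by ring

end Model

/-! ### Grid bounds for the derivatives of the value function -/

lemma one_add_rpow_le (a y : ℝ) {q : ℕ} (hq : a ≤ q) (ha : 0 < a) :
    1 + |y| ^ a ≤ 2 * (1 + |y|) ^ q := by
  have h0 := abs_nonneg y
  have h1 : (1 : ℝ) ≤ (1 + |y|) ^ q := one_le_pow₀ (by linarith)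
  have h2 : |y| ^ a ≤ (1 + |y|) ^ q := by
    rw [← Real.rpow_natCast]
    exact (Real.rpow_le_rpow h0 (by linarith) ha.le).trans
      (Real.rpow_le_rpow_of_exponent_le (by linarith) hq)
  linarith

lemma PolyGrowthOn.exists_pow {D : Set ℝ} {g : ℝ → ℝ} (h : PolyGrowthOn D g) :
    ∃ C > 0, ∃ q : ℕ, ∀ y ∈ D, |g y| ≤ C * (1 + |y|) ^ q := by
  obtain ⟨C, hC, a, ha, hg⟩ := h
  refine ⟨C * 2, by positivity, ⌈a⌉₊, fun y hy => (hg y hy).trans ?_⟩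
  rw [mul_assoc]
  exact mul_le_mul_of_nonneg_left (one_add_rpow_le a y (Nat.le_ceil a) ha) hC.le

lemma mul_pow_le_mul_pow {C K y : ℝ} {r q : ℕ} (hC : 0 ≤ C) (hCK : C ≤ K) (hrq : r ≤ q) :
    C * (1 + |y|) ^ r ≤ K * (1 + |y|) ^ q := by
  have h0 := abs_nonneg y
  exact mul_le_mul hCK (pow_le_pow_right₀ (by linarith) hrq) (by positivity) (hC.trans hCK)

lemma memLp_two_and_integral_sq_le {g : ℝ → ℝ} (hg : Continuous g) {B : ℝ} (hB : 0 ≤ B)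
    (h : eLpNorm g 2 volume ≤ ENNReal.ofReal B) :
    MemLp g 2 volume ∧ ∫ x, g x ^ 2 ≤ B ^ 2 := by
  have hm : MemLp g 2 volume := ⟨hg.aestronglyMeasurable, h.trans_lt ENNReal.ofReal_lt_top⟩
  refine ⟨hm, ?_⟩
  have h0 : 0 ≤ ∫ x, g x ^ 2 := integral_nonneg fun _ => sq_nonneg _
  have h1 := hm.eLpNorm_eq_integral_rpow_norm (by simp) (by simp)
  rw [h1, ENNReal.ofReal_le_ofReal_iff hB] at h
  simp only [ENNReal.toReal_ofNat, Real.rpow_ofNat, Real.norm_eq_abs, sq_abs] at h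
  have h2 : ((∫ x, g x ^ 2) ^ (2⁻¹ : ℝ)) ^ 2 = ∫ x, g x ^ 2 := by
    rw [← Real.rpow_natCast, ← Real.rpow_mul h0]; norm_num
  rw [← h2]
  gcongr

/-- The regularity of the value function `u` with jet `w` and the growth of the coefficients, in
the form used below: all bounds share one constant and one degree. -/
structure Regular (M : Model) (T : ℝ) (u : ℝ → ℝ → ℝ → ℝ) (w : ℕ → ℕ → ℕ → ℝ → ℝ → ℝ → ℝ)
    (K : ℝ) (q : ℕ) : Prop where
  one_le : 1 ≤ K
  jet : IsJet 6 T M.D u w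
  grid : ∀ k i j, 2 * k + i + j ≤ 5 → ∀ t ∈ Set.Ico 0 T, ∀ x : ℝ, ∀ y ∈ M.D, ∀ dx : ℝ,
    0 < dx → dx < 1 →
    L2Bound (fun l : ℤ => w k i j t (x + l * dx) y) (K * (1 + |y|) ^ q / √dx)
  growth_μX : ∀ y ∈ M.D, |M.μX y| ≤ K * (1 + |y|) ^ q
  growth_μY : ∀ y ∈ M.D, |M.μY y| ≤ K * (1 + |y|) ^ q
  growth_σX : ∀ y ∈ M.D, M.σX y ^ 2 ≤ K * (1 + |y|) ^ q

lemma IsJet.continuous_x {q : ℕ} {T : ℝ} {D : Set ℝ} {u : ℝ → ℝ → ℝ → ℝ}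
    {w : ℕ → ℕ → ℕ → ℝ → ℝ → ℝ → ℝ} (hw : IsJet q T D u w) {k i j : ℕ} (h : 2 * k + i + j ≤ q)
    {t y : ℝ} (ht : t ∈ Set.Ico 0 T) (hy : y ∈ D) : Continuous fun x => w k i j t x y :=
  (hw.cont k i j h).comp_continuous (f := fun x : ℝ => (t, x, y)) (by fun_prop)
    fun x => ⟨ht, Set.mem_univ _, hy⟩

lemma IsJet.continuousOn_y {q : ℕ} {T : ℝ} {D : Set ℝ} {u : ℝ → ℝ → ℝ → ℝ}
    {w : ℕ → ℕ → ℕ → ℝ → ℝ → ℝ → ℝ} (hw : IsJet q T D u w) {k i j : ℕ} (h : 2 * k + i + j ≤ q)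
    {t : ℝ} (ht : t ∈ Set.Ico 0 T) (x : ℝ) : ContinuousOn (fun y => w k i j t x y) D :=
  (hw.cont k i j h).comp (f := fun y : ℝ => (t, x, y)) (by fun_prop)
    fun y hy => ⟨ht, Set.mem_univ _, hy⟩

/-- Sampling an `L²` bound on the grid costs one derivative in `x`, so that of the six derivatives of
`u` five are controlled on the grid. -/
lemma exists_regular {M : Model} (hM : M.Standing) {T : ℝ} {u : ℝ → ℝ → ℝ → ℝ}
    (hreg : MemCpolT 2 6 T M.D u) : ∃ w K q, Regular M T u w K q := by
  obtain ⟨w, hw, -, C, hC, a, ha, hb⟩ := hreg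
  obtain ⟨C1, hC1, q1, h1⟩ := hM.growth_μX.exists_pow
  obtain ⟨C2, hC2, q2, h2⟩ := hM.growth_μY.exists_pow
  obtain ⟨C3, hC3, q3, h3⟩ := hM.growth_σX.exists_pow
  set K := 1 + 4 * C + C1 + C2 + C3 ^ 2 with hK
  set q := ⌈a⌉₊ + q1 + q2 + 2 * q3 with hq
  have hC3' : 0 < C3 ^ 2 := by positivity
  refine ⟨w, K, q, by linarith, hw, ?_, fun y hy => (h1 y hy).trans ?_,
    fun y hy => (h2 y hy).trans ?_, fun y hy => ?_⟩
  · intro k i j hkij t ht x y hy dx hdx hdx1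
    have hB : 0 ≤ C * (1 + |y| ^ a) := by positivity
    obtain ⟨m0, b0⟩ := memLp_two_and_integral_sq_le
      (hw.continuous_x (k := k) (i := i) (j := j) (by omega) ht hy) hB
      (hb k i j (by omega) t ht y hy)
    obtain ⟨m1, b1⟩ := memLp_two_and_integral_sq_le
      (hw.continuous_x (k := k) (i := i + 1) (j := j) (by omega) ht hy) hB
      (hb k (i + 1) j (by omega) t ht y hy)
    refine (L2Bound.sample hdx hdx1.le hB (fun x => hw.deriv_x k i j (by omega) t ht x y hy)
      m0 m1 b0 b1 x).mono ?_
    refine div_le_div_of_nonneg_right ?_ (Real.sqrt_nonneg dx)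
    have e1 := one_add_rpow_le a y (Nat.le_ceil a) ha
    calc 2 * (C * (1 + |y| ^ a)) ≤ 2 * (C * (2 * (1 + |y|) ^ ⌈a⌉₊)) := by gcongr
      _ = (4 * C) * (1 + |y|) ^ ⌈a⌉₊ := by ring
      _ ≤ _ := mul_pow_le_mul_pow (by positivity) (by linarith) (by omega)
  · exact mul_pow_le_mul_pow hC1.le (by linarith) (by omega)
  · exact mul_pow_le_mul_pow hC2.le (by linarith) (by omega)
  · have e1 := h3 y hy
    calc M.σX y ^ 2 = |M.σX y| ^ 2 := (sq_abs _).symm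
      _ ≤ (C3 * (1 + |y|) ^ q3) ^ 2 := by gcongr
      _ = C3 ^ 2 * (1 + |y|) ^ (2 * q3) := by ring
      _ ≤ _ := mul_pow_le_mul_pow (by positivity) (by linarith) (by omega)

lemma IsConvexDomain.convex {D : Set ℝ} (h : IsConvexDomain D) : Convex ℝ D := by
  obtain ⟨U, -, hU, -, rfl | rfl⟩ := h
  exacts [hU, hU.closure]

lemma IsConvexDomain.uniqueDiffOn {D : Set ℝ} (h : IsConvexDomain D) : UniqueDiffOn ℝ D := by
  refine uniqueDiffOn_convex h.convex ?_
  obtain ⟨U, hU, -, hne, rfl | rfl⟩ := h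
  · rwa [hU.interior_eq]
  · exact hne.mono (interior_maximal subset_closure hU)

lemma IsConvexDomain.measurableSet {D : Set ℝ} (h : IsConvexDomain D) : MeasurableSet D :=
  h.convex.ordConnected.measurableSet

namespace Regular

variable {M : Model} {T : ℝ} {u : ℝ → ℝ → ℝ → ℝ} {w : ℕ → ℕ → ℕ → ℝ → ℝ → ℝ → ℝ}
  {K : ℝ} {q : ℕ}

lemma taylor_t (hR : Regular M T u w K q) {s h z dx : ℝ} (hs : 0 ≤ s) (hh : 0 ≤ h)
    (hsh : s + h < T) (hz : z ∈ M.D) (hdx : 0 < dx) (hdx1 : dx < 1) (x : ℝ) :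
    L2Bound (fun l : ℤ => w 0 0 0 (s + h) (x + l * dx) z
      - (w 0 0 0 s (x + l * dx) z + h * w 1 0 0 s (x + l * dx) z))
      (h ^ 2 * (K * (1 + |z|) ^ q / √dx)) := by
  have hmem : ∀ r ∈ Set.Icc (0 : ℝ) 1, s + r * h ∈ Set.Ico 0 T := fun r hr =>
    ⟨by nlinarith [hr.1], by nlinarith [hr.2]⟩
  have := L2Bound.taylor 2 (fun k r (l : ℤ) => h ^ k * w k 0 0 (s + r * h) (x + l * dx) z)
    (h ^ 2 * (K * (1 + |z|) ^ q / √dx))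
    (fun k hk l r hr => by
      have h1 := hR.jet.deriv_t k 0 0 (by omega) (s + r * h) (hmem r hr) (x + l * dx) z hz
      have h2 : HasDerivWithinAt (fun r : ℝ => s + r * h) h (Set.Icc 0 1) r := by
        simpa using (((hasDerivAt_id r).mul_const h).const_add s).hasDerivWithinAt
      exact ((h1.comp r h2 hmem).const_mul (h ^ k)).congr_deriv (by ring))
    (fun r hr => by
      have := (hR.grid 2 0 0 (by omega) (s + r * h) (hmem r hr) x z hz dx hdx hdx1).const_mul
        (h ^ 2)
      rwa [abs_of_nonneg (by positivity)] at this)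
  simpa [Finset.sum_range_succ] using this

lemma taylor_y (hR : Regular M T u w K q) (hD : Convex ℝ M.D) {s y z dx : ℝ}
    (hs : s ∈ Set.Ico 0 T) (hy : y ∈ M.D) (hz : z ∈ M.D) (hdx : 0 < dx) (hdx1 : dx < 1)
    (x : ℝ) {k m : ℕ} (hm : 2 * k + m ≤ 5) :
    L2Bound (fun l : ℤ => w k 0 0 s (x + l * dx) z
      - ∑ r ∈ Finset.range m, (z - y) ^ r * w k 0 r s (x + l * dx) y / (r.factorial : ℝ))
      (|z - y| ^ m * (K * ((1 + |y|) ^ q * (1 + |z|) ^ q) / √dx)) := by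
  have hK := hR.one_le
  have hmem : ∀ r ∈ Set.Icc (0 : ℝ) 1, y + r * (z - y) ∈ M.D := fun r hr => by
    have := hD hy hz (sub_nonneg.2 hr.2) hr.1 (by ring)
    convert this using 1
    simp only [smul_eq_mul]; ring
  have hbd : ∀ r ∈ Set.Icc (0 : ℝ) 1, 1 + |y + r * (z - y)| ≤ (1 + |y|) * (1 + |z|) := by
    intro r hr
    have h1 : |y + r * (z - y)| ≤ (1 - r) * |y| + r * |z| := by
      rw [show y + r * (z - y) = (1 - r) * y + r * z by ring]
      refine (abs_add_le _ _).trans ?_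
      rw [abs_mul, abs_mul, abs_of_nonneg hr.1, abs_of_nonneg (sub_nonneg.2 hr.2)]
    have h2 := abs_nonneg y
    have h3 := abs_nonneg z
    nlinarith [hr.1, hr.2, mul_nonneg h2 h3, mul_nonneg hr.1 h2,
      mul_nonneg (sub_nonneg.2 hr.2) h3]
  have := L2Bound.taylor m
    (fun k' r (l : ℤ) => (z - y) ^ k' * w k 0 k' s (x + l * dx) (y + r * (z - y)))
    (|z - y| ^ m * (K * ((1 + |y|) ^ q * (1 + |z|) ^ q) / √dx))
    (fun k' hk l r hr => by
      have h1 := hR.jet.deriv_y k 0 k' (by omega) s hs (x + l * dx) _ (hmem r hr)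
      have h2 : HasDerivWithinAt (fun r : ℝ => y + r * (z - y)) (z - y) (Set.Icc 0 1) r := by
        simpa using (((hasDerivAt_id r).mul_const (z - y)).const_add y).hasDerivWithinAt
      exact ((h1.comp r h2 hmem).const_mul ((z - y) ^ k')).congr_deriv (by ring))
    (fun r hr => by
      have := (hR.grid k 0 m (by omega) s hs x _ (hmem r hr) dx hdx hdx1).const_mul
        ((z - y) ^ m)
      rw [abs_pow] at this
      refine this.mono ?_
      rw [← mul_pow]
      have := hbd r hr
      gcongr)
  simpa using this

lemma taylor_x (hR : Regular M T u w K q) {s y dx : ℝ}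
    (hs : s ∈ Set.Ico 0 T) (hy : y ∈ M.D) (hdx : 0 < dx) (hdx1 : dx < 1)
    (x δ : ℝ) {m : ℕ} (hm : m ≤ 5) :
    L2Bound (fun l : ℤ => w 0 0 0 s (x + l * dx + δ) y
      - ∑ r ∈ Finset.range m, δ ^ r * w 0 r 0 s (x + l * dx) y / (r.factorial : ℝ))
      (|δ| ^ m * (K * (1 + |y|) ^ q / √dx)) := by
  have := L2Bound.taylor m
    (fun k' r (l : ℤ) => δ ^ k' * w 0 k' 0 s (x + l * dx + r * δ) y)
    (|δ| ^ m * (K * (1 + |y|) ^ q / √dx))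
    (fun k' hk l r hr => by
      have h1 := hR.jet.deriv_x 0 k' 0 (by omega) s hs (x + l * dx + r * δ) y hy
      have h2 : HasDerivAt (fun r : ℝ => x + l * dx + r * δ) δ r := by
        simpa using ((hasDerivAt_id r).mul_const δ).const_add (x + l * dx)
      exact ((h1.comp r h2).const_mul (δ ^ k')).hasDerivWithinAt.congr_deriv (by ring))
    (fun r hr => by
      have := (hR.grid 0 m 0 (by omega) s hs (x + r * δ) y hy dx hdx hdx1).const_mul (δ ^ m)
      rw [abs_pow] at this
      convert this using 4
      ring)
  simpa using this

/-- Second order consistency of the centered differences. -/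
lemma stencil_consistent (hR : Regular M T u w K q) {s y dx h : ℝ} (hh : 0 ≤ h)
    (hs : s ∈ Set.Ico 0 T) (hy : y ∈ M.D) (hdx : 0 < dx) (hdx1 : dx < 1) (x : ℝ) :
    L2Bound (fun l : ℤ =>
      stencil (M.α h dx y) (M.β h dx y) (fun l => w 0 0 0 s (x + l * dx) y) l
      - (w 0 0 0 s (x + l * dx) y - h * (M.μX y * w 0 1 0 s (x + l * dx) y
        + 1 / 2 * (M.σX y ^ 2 * w 0 2 0 s (x + l * dx) y))))
      (h * dx ^ 2 * (2 * (K * (1 + |y|) ^ q)) * (K * (1 + |y|) ^ q / √dx)) := by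
  have hK := hR.one_le
  have hμ := hR.growth_μX y hy
  have hσ := hR.growth_σX y hy
  set P := K * (1 + |y|) ^ q with hP
  have hP0 : 0 ≤ P := (abs_nonneg _).trans hμ
  have r3 := (hR.taylor_x hs hy hdx hdx1 x dx (m := 3) (by omega)).sub
    (hR.taylor_x hs hy hdx hdx1 x (-dx) (m := 3) (by omega))
  have r4 := (hR.taylor_x hs hy hdx hdx1 x dx (m := 4) (by omega)).add
    (hR.taylor_x hs hy hdx hdx1 x (-dx) (m := 4) (by omega))
  have r := (r3.const_mul (-(M.α h dx y))).add (r4.const_mul (-(M.β h dx y)))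
  rw [abs_neg dx, abs_of_pos hdx] at r
  rw [abs_neg, abs_neg, ← hP] at r
  refine L2Bound.mono (K := |M.α h dx y| * (dx ^ 3 * (P / √dx) + dx ^ 3 * (P / √dx))
      + |M.β h dx y| * (dx ^ 4 * (P / √dx) + dx ^ 4 * (P / √dx))) ?_ ?_
  · convert r using 2 with l
    have e1 : x + (((l : ℤ) + 1 : ℤ) : ℝ) * dx = x + l * dx + dx := by push_cast; ring
    have e2 : x + (((l : ℤ) - 1 : ℤ) : ℝ) * dx = x + l * dx + -dx := by push_cast; ring
    simp only [stencil, e1, e2, Finset.sum_range_succ, Finset.sum_range_zero, Nat.factorial,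
      Model.α, Model.β]
    field_simp
    push_cast
    ring
  · have hα : |M.α h dx y| * dx ≤ h * P / 2 := by
      rw [Model.α, abs_mul, abs_of_nonneg (by positivity)]
      calc h / (2 * dx) * |M.μX y| * dx = h * |M.μX y| / 2 := by field_simp
        _ ≤ _ := by gcongr
    have hβ : |M.β h dx y| * dx ^ 2 ≤ h * P / 2 := by
      rw [Model.β, abs_mul, abs_of_nonneg (by positivity), abs_of_nonneg (by positivity)]
      calc h / (2 * dx ^ 2) * M.σX y ^ 2 * dx ^ 2 = h * M.σX y ^ 2 / 2 := by field_simp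
        _ ≤ _ := by gcongr
    have hB : 0 ≤ 2 * dx ^ 2 * (P / √dx) := by positivity
    have e1 := mul_le_mul_of_nonneg_right hα hB
    have e2 := mul_le_mul_of_nonneg_right hβ hB
    nlinarith

end Regular

/-! ### Consistency of one step -/

/-- The transition law `m` of the chain from the state `y` lives on the domain and has the first
three conditional moments of `H₁`, with errors `f`, `g`, `j`. -/
structure StepMoments (M : Model) (h y : ℝ) (q : ℕ) (m : Measure ℝ) (f g j : ℝ) : Prop where
  prob : IsProbabilityMeasure m
  mem : ∀ᵐ z ∂m, z ∈ M.D
  int_pow : Integrable (fun z => (1 + |z|) ^ q) m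
  int_rem : Integrable (fun z => (1 + |z|) ^ q * (h ^ 2 + h * (z - y) ^ 2 + (z - y) ^ 4)) m
  int_one : Integrable (fun z => z - y) m
  int_two : Integrable (fun z => (z - y) ^ 2) m
  int_three : Integrable (fun z => (z - y) ^ 3) m
  moment_one : ∫ z, (z - y) ∂m = M.μY y * h + f
  moment_two : ∫ z, (z - y) ^ 2 ∂m = M.σY y ^ 2 * h + g
  moment_three : ∫ z, (z - y) ^ 3 ∂m = j

/-- The weighted moment of the transition law that controls the Taylor remainder. -/
noncomputable def remMoment (h y : ℝ) (q : ℕ) (m : Measure ℝ) : ℝ :=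
  ∫ z, (1 + |z|) ^ q * (h ^ 2 + h * (z - y) ^ 2 + (z - y) ^ 4) ∂m

/-- Bound of the difference between `𝔼[u(s + h, ·, Y')]` and `u - h 𝓛 u`; here `P` bounds the
coefficients, `G` the derivatives of `u`, and `S` is the weighted moment of the transition. -/
def remBound (h P G f g j S : ℝ) : ℝ := G * (|f| + |g| + |j| + h * (h * P + |f|) + S)

/-- Bound of the local truncation error of the scheme. -/
def localBound (h dx Λ P G f g j S : ℝ) : ℝ :=
  h * dx ^ 2 * (2 * P) * G + remBound h P G f g j S + h * (dx ^ 2 * Λ * G)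
    + 2 * Λ * h * (remBound h P G f g j S + h * (2 * P * G + 2 * Λ * G))

namespace Regular

variable {M : Model} {T : ℝ} {u : ℝ → ℝ → ℝ → ℝ} {w : ℕ → ℕ → ℕ → ℝ → ℝ → ℝ → ℝ}
  {K : ℝ} {q : ℕ}

/-- Expansion of `u(s + h, ·, z)` around `(s, ·, y)`. -/
lemma taylor_ty (hR : Regular M T u w K q) (hD : Convex ℝ M.D) {s h y z dx : ℝ}
    (hs : 0 ≤ s) (hh : 0 ≤ h) (hsh : s + h < T) (hy : y ∈ M.D) (hz : z ∈ M.D) (hdx : 0 < dx)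
    (hdx1 : dx < 1) (x : ℝ) :
    L2Bound (fun l : ℤ => w 0 0 0 (s + h) (x + l * dx) z
      - (w 0 0 0 s (x + l * dx) y + (z - y) * w 0 0 1 s (x + l * dx) y
        + (z - y) ^ 2 * (w 0 0 2 s (x + l * dx) y / 2)
        + (z - y) ^ 3 * (w 0 0 3 s (x + l * dx) y / 6)
        + h * w 1 0 0 s (x + l * dx) y + (z - y) * (h * w 1 0 1 s (x + l * dx) y)))
      (K * (1 + |y|) ^ q / √dx * ((1 + |z|) ^ q * (h ^ 2 + h * (z - y) ^ 2 + (z - y) ^ 4))) := by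
  have hK := hR.one_le
  have hsT : s ∈ Set.Ico 0 T := ⟨hs, by linarith⟩
  have h1 := hR.taylor_t hs hh hsh hz hdx hdx1 x
  have h2 := hR.taylor_y hD hsT hy hz hdx hdx1 x (k := 0) (m := 4) (by omega)
  have h3 := (hR.taylor_y hD hsT hy hz hdx hdx1 x (k := 1) (m := 2) (by omega)).const_mul h
  have h4 := (h1.add h2).add h3
  simp only [Finset.sum_range_succ, Finset.sum_range_zero, Nat.factorial] at h4
  refine L2Bound.mono (K := h ^ 2 * (K * (1 + |z|) ^ q / √dx)
    + |z - y| ^ 4 * (K * ((1 + |y|) ^ q * (1 + |z|) ^ q) / √dx)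
    + |h| * (|z - y| ^ 2 * (K * ((1 + |y|) ^ q * (1 + |z|) ^ q) / √dx))) ?_ ?_
  · convert h4 using 2 with l
    push_cast
    ring
  · rw [sq_abs, abs_of_nonneg hh, show |z - y| ^ 4 = (z - y) ^ 4 from Even.pow_abs (by decide) _]
    have e1 : (1 : ℝ) ≤ (1 + |y|) ^ q := one_le_pow₀ (by linarith [abs_nonneg y])
    have e2 : 0 ≤ h ^ 2 * (K * (1 + |z|) ^ q / √dx) := by positivity
    have e3 := mul_le_mul_of_nonneg_left e1 e2
    calc _ ≤ h ^ 2 * (K * (1 + |z|) ^ q / √dx) * (1 + |y|) ^ q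
          + (z - y) ^ 4 * (K * ((1 + |y|) ^ q * (1 + |z|) ^ q) / √dx)
          + h * ((z - y) ^ 2 * (K * ((1 + |y|) ^ q * (1 + |z|) ^ q) / √dx)) := by linarith
      _ = _ := by ring

lemma aestronglyMeasurable_jet (hR : Regular M T u w K q) (hM : M.Standing) {m : Measure ℝ}
    (hm : ∀ᵐ z ∂m, z ∈ M.D) {t : ℝ} (ht : t ∈ Set.Ico 0 T) (x : ℝ) :
    AEStronglyMeasurable (fun z => w 0 0 0 t x z) m := by
  have h1 := (hR.jet.continuousOn_y (k := 0) (i := 0) (j := 0) (by omega) ht x).aestronglyMeasurable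
    (μ := m) hM.domain.measurableSet
  rwa [Measure.restrict_eq_self_of_ae_mem hm] at h1

lemma l2Bound_u (hR : Regular M T u w K q) {t z dx : ℝ} (ht : t ∈ Set.Ico 0 T) (hz : z ∈ M.D)
    (hdx : 0 < dx) (hdx1 : dx < 1) (x : ℝ) :
    L2Bound (fun l : ℤ => w 0 0 0 t (x + l * dx) z) (K * (1 + |z|) ^ q / √dx) :=
  hR.grid 0 0 0 (by omega) t ht x z hz dx hdx hdx1

lemma integrable_jet (hR : Regular M T u w K q) (hM : M.Standing) {h y dx f g j : ℝ}
    {m : Measure ℝ} (hm : StepMoments M h y q m f g j) {t : ℝ} (ht : t ∈ Set.Ico 0 T)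
    (hdx : 0 < dx) (hdx1 : dx < 1) (x : ℝ) (l : ℤ) :
    Integrable (fun z => w 0 0 0 t (x + l * dx) z) m := by
  refine Integrable.mono' ((hm.int_pow.const_mul K).div_const √dx)
    (hR.aestronglyMeasurable_jet hM hm.mem ht _) (hm.mem.mono fun z hz => ?_)
  exact (hR.l2Bound_u ht hz hdx hdx1 x).abs_le l

/-- Averaging the Taylor expansion over one step of the chain. -/
lemma mean_taylor (hR : Regular M T u w K q) (hM : M.Standing) {s h y dx f g j : ℝ}
    {m : Measure ℝ} (hm : StepMoments M h y q m f g j) (hs : 0 ≤ s) (hh : 0 ≤ h)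
    (hsh : s + h < T) (hy : y ∈ M.D) (hdx : 0 < dx) (hdx1 : dx < 1) (x : ℝ) :
    L2Bound (fun l : ℤ => (∫ z, w 0 0 0 (s + h) (x + l * dx) z ∂m)
      - (w 0 0 0 s (x + l * dx) y + h * (w 1 0 0 s (x + l * dx) y
        + (1 / 2 * (M.σY y ^ 2 * w 0 0 2 s (x + l * dx) y)
          + M.μY y * w 0 0 1 s (x + l * dx) y))))
      (remBound h (K * (1 + |y|) ^ q) (K * (1 + |y|) ^ q / √dx) f g j (remMoment h y q m)) := by
  have hprob := hm.prob
  have hsT : s ∈ Set.Ico 0 T := ⟨hs, by linarith⟩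
  have hshT : s + h ∈ Set.Ico 0 T := ⟨by linarith, hsh⟩
  set P := K * (1 + |y|) ^ q with hP
  set G := P / √dx with hG
  have hμ := hR.growth_μY y hy
  have hP0 : 0 ≤ P := (abs_nonneg _).trans hμ
  have hG0 : 0 ≤ G := by positivity
  have hu := fun l => hR.integrable_jet hM hm hshT hdx hdx1 x l
  have i1 : ∀ a : ℝ, Integrable (fun z => (z - y) * a) m := fun a => hm.int_one.mul_const a
  have i2 : ∀ a : ℝ, Integrable (fun z => (z - y) ^ 2 * a) m := fun a => hm.int_two.mul_const a
  have i3 : ∀ a : ℝ, Integrable (fun z => (z - y) ^ 3 * a) m := fun a => hm.int_three.mul_const a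
  have j1 : ∀ a b : ℝ, Integrable (fun z => a + (z - y) * b) m := fun a b =>
    (integrable_const a).add (i1 b)
  have j2 : ∀ a b c : ℝ, Integrable (fun z => a + (z - y) * b + (z - y) ^ 2 * c) m :=
    fun a b c => (j1 a b).add (i2 c)
  have j3 : ∀ a b c d : ℝ,
      Integrable (fun z => a + (z - y) * b + (z - y) ^ 2 * c + (z - y) ^ 3 * d) m :=
    fun a b c d => (j2 a b c).add (i3 d)
  have j4 : ∀ a b c d e : ℝ,
      Integrable (fun z => a + (z - y) * b + (z - y) ^ 2 * c + (z - y) ^ 3 * d + e) m :=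
    fun a b c d e => (j3 a b c d).add (integrable_const e)
  have j5 : ∀ a b c d e e' : ℝ, Integrable (fun z => a + (z - y) * b + (z - y) ^ 2 * c
      + (z - y) ^ 3 * d + e + (z - y) * e') m :=
    fun a b c d e e' => (j4 a b c d e).add (i1 e')
  have hrem := L2Bound.integral (m := m) (fun l => (hu l).aestronglyMeasurable.sub
    (j5 (w 0 0 0 s (x + l * dx) y) (w 0 0 1 s (x + l * dx) y) (w 0 0 2 s (x + l * dx) y / 2)
      (w 0 0 3 s (x + l * dx) y / 6) (h * w 1 0 0 s (x + l * dx) y)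
      (h * w 1 0 1 s (x + l * dx) y)).aestronglyMeasurable)
    (hm.mem.mono fun z hz => hR.taylor_ty hM.domain.convex hs hh hsh hy hz hdx hdx1 x)
    (hm.int_rem.const_mul G)
  rw [integral_const_mul] at hrem
  change L2Bound _ (G * remMoment h y q m) at hrem
  have hy1 := (hR.grid 0 0 1 (by omega) s hsT x y hy dx hdx hdx1).const_mul f
  have hy2 := (hR.grid 0 0 2 (by omega) s hsT x y hy dx hdx hdx1).const_mul (g / 2)
  have hy3 := (hR.grid 0 0 3 (by omega) s hsT x y hy dx hdx hdx1).const_mul (j / 6)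
  have hty := (hR.grid 1 0 1 (by omega) s hsT x y hy dx hdx hdx1).const_mul
    (h * (M.μY y * h + f))
  have hall := (((hrem.add hy1).add hy2).add hy3).add hty
  rw [← hP, ← hG] at hall
  refine L2Bound.mono (K := G * remMoment h y q m + |f| * G + |g / 2| * G + |j / 6| * G
    + |h * (M.μY y * h + f)| * G) ?_ ?_
  · convert hall using 2 with l
    simp only [Pi.sub_apply]
    rw [integral_sub (hu l) (j5 _ _ _ _ _ _), integral_add (j4 _ _ _ _ _) (i1 _),
      integral_add (j3 _ _ _ _) (integrable_const _), integral_add (j2 _ _ _) (i3 _),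
      integral_add (j1 _ _) (i2 _), integral_add (integrable_const _) (i1 _)]
    simp only [integral_mul_const, integral_const, probReal_univ, one_smul, hm.moment_one,
      hm.moment_two, hm.moment_three]
    ring
  · have e1 : |g / 2| ≤ |g| := by
      rw [abs_div, abs_two]; linarith [abs_nonneg g]
    have e2 : |j / 6| ≤ |j| := by
      rw [abs_div, abs_of_pos (by norm_num : (0 : ℝ) < 6)]; linarith [abs_nonneg j]
    have e3 : |h * (M.μY y * h + f)| ≤ h * (h * P + |f|) := by
      rw [abs_mul, abs_of_nonneg hh]
      refine mul_le_mul_of_nonneg_left ((abs_add_le _ _).trans ?_) hh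
      rw [abs_mul, abs_of_nonneg hh]
      nlinarith
    rw [remBound]
    have := mul_le_mul_of_nonneg_right e1 hG0
    have := mul_le_mul_of_nonneg_right e2 hG0
    have := mul_le_mul_of_nonneg_right e3 hG0
    linarith

/-- The backward equation in terms of the jet. -/
lemma pide (hR : Regular M T u w K q) (hM : M.Standing) {f : ℝ → ℝ → ℝ}
    (hp : SolvesPIDE M T f u) {s x y : ℝ} (hs : s ∈ Set.Ico 0 T) (hy : y ∈ M.D) :
    w 1 0 0 s x y + (1 / 2 * (M.σX y ^ 2 * w 0 2 0 s x y + M.σY y ^ 2 * w 0 0 2 s x y)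
      + M.μX y * w 0 1 0 s x y + M.μY y * w 0 0 1 s x y
      + ∫ ζ, (w 0 0 0 s (x + M.γX y * ζ) y - w 0 0 0 s x y) * M.ν ζ) = 0 := by
  have hJ := hR.jet
  have hUD := hM.domain.uniqueDiffOn
  have h0 : ∀ t ∈ Set.Ico 0 T, ∀ x, ∀ y ∈ M.D, u t x y = w 0 0 0 t x y := fun t ht x y hy =>
    (hJ.zero t ht x y hy).symm
  have ht : derivWithin (fun t => u t x y) (Set.Ico 0 T) s = w 1 0 0 s x y := by
    rw [derivWithin_congr (fun t ht => h0 t ht x y hy) (h0 s hs x y hy)]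
    exact (hJ.deriv_t 0 0 0 (by omega) s hs x y hy).derivWithin (uniqueDiffOn_Ico 0 T s hs)
  have hx : (fun x => u s x y) = fun x => w 0 0 0 s x y := funext fun x => h0 s hs x y hy
  have hx1 : deriv (fun x => w 0 0 0 s x y) = fun x => w 0 1 0 s x y :=
    funext fun x => (hJ.deriv_x 0 0 0 (by omega) s hs x y hy).deriv
  have hx2 : deriv (fun x => w 0 1 0 s x y) x = w 0 2 0 s x y :=
    (hJ.deriv_x 0 1 0 (by omega) s hs x y hy).deriv
  have hy1 : ∀ z ∈ M.D, derivWithin (fun y => u s x y) M.D z = w 0 0 1 s x z := fun z hz => by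
    rw [derivWithin_congr (fun y hy => h0 s hs x y hy) (h0 s hs x z hz)]
    exact (hJ.deriv_y 0 0 0 (by omega) s hs x z hz).derivWithin (hUD z hz)
  have hy2 : derivWithin (derivWithin (fun y => u s x y) M.D) M.D y = w 0 0 2 s x y := by
    rw [derivWithin_congr hy1 (hy1 y hy)]
    exact (hJ.deriv_y 0 0 1 (by omega) s hs x y hy).derivWithin (hUD y hy)
  have := hp.eqn s hs x y hy
  rw [ht, hy2, hy1 y hy, hx, hx1, hx2] at this
  simpa only [h0 s hs _ y hy] using this

/-- The local truncation error `A u(s, ·, y) - B 𝔼[u(s + h, ·, Y')]` before maturity. The growth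
of `σY` is not controlled: the second order term in `y` is eliminated by the backward equation. -/
lemma local_error_of_lt (hR : Regular M T u w K q) (hM : M.Standing) {f : ℝ → ℝ → ℝ}
    (hp : SolvesPIDE M T f u) {Λ s h y dx f₁ g₁ j₁ : ℝ}
    (hJ : M.JumpBound dx y Λ) {m : Measure ℝ} (hm : StepMoments M h y q m f₁ g₁ j₁) (hs : 0 ≤ s)
    (hh : 0 ≤ h) (hsh : s + h < T) (hy : y ∈ M.D) (hdx : 0 < dx) (hdx1 : dx < 1) (x : ℝ) :
    L2Bound (fun l : ℤ =>
        stencil (M.α h dx y) (M.β h dx y) (fun l => w 0 0 0 s (x + l * dx) y) l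
        - ((∫ z, w 0 0 0 (s + h) (x + l * dx) z ∂m)
          + h * jumpSum (M.weight dx y) (fun l => ∫ z, w 0 0 0 (s + h) (x + l * dx) z ∂m) l))
      (localBound h dx Λ (K * (1 + |y|) ^ q) (K * (1 + |y|) ^ q / √dx) f₁ g₁ j₁
        (remMoment h y q m)) := by
  have hsT : s ∈ Set.Ico 0 T := ⟨hs, by linarith⟩
  have hshT : s + h ∈ Set.Ico 0 T := ⟨by linarith, hsh⟩
  have hP0 : 0 ≤ K * (1 + |y|) ^ q := (abs_nonneg _).trans (hR.growth_μX y hy)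
  have hG0 : 0 ≤ K * (1 + |y|) ^ q / √dx := by positivity
  have hst := hR.stencil_consistent hh hsT hy hdx hdx1 x
  have hmt := hR.mean_taylor hM hm hs hh hsh hy hdx hdx1 x
  have hx1 := (hR.grid 0 1 0 (by omega) s hsT x y hy dx hdx hdx1).const_mul (M.μX y)
  have hx2 := (hR.grid 0 2 0 (by omega) s hsT x y hy dx hdx hdx1).const_mul (M.σX y ^ 2 / 2)
  have hU := hR.l2Bound_u hsT hy hdx hdx1 x
  have hnl := hJ.nonlocal (fun z l => w 0 0 0 s (x + l * dx + z) y) (K * (1 + |y|) ^ q / √dx)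
    (fun l => (hR.jet.continuous_x (by omega) hsT hy).comp (by fun_prop))
    (fun z => by simpa [add_right_comm] using hR.grid 0 0 0 (by omega) s hsT (x + z) y hy dx hdx hdx1)
  have htr := hJ.trapezoid (fun k z l => w 0 k 0 s (x + l * dx + z) y) (K * (1 + |y|) ^ q / √dx)
    (fun k hk l z => by
      have := hR.jet.deriv_x 0 k 0 (by omega) s hsT (x + l * dx + z) y hy
      exact this.comp_const_add (x + l * dx) z)
    (fun k hk z => by
      simpa [add_right_comm] using hR.grid 0 k 0 (by omega) s hsT (x + z) y hy dx hdx hdx1)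
  simp only [add_zero] at hnl htr
  have hμ := hR.growth_μX y hy
  have hσ := hR.growth_σX y hy
  set P := K * (1 + |y|) ^ q with hP
  set G := P / √dx with hG
  set S := remMoment h y q m with hS
  set B := remBound h P G f₁ g₁ j₁ S with hB
  set W : ℤ → ℝ := fun l => ∫ z, w 0 0 0 (s + h) (x + l * dx) z ∂m with hW
  set U : ℤ → ℝ := fun l => w 0 0 0 s (x + l * dx) y with hUdef
  set N : ℤ → ℝ := fun l =>
    ∫ ζ, (w 0 0 0 s (x + l * dx + M.γX y * ζ) y - w 0 0 0 s (x + l * dx) y) * M.ν ζ with hN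
  set L : ℤ → ℝ := fun l => M.μX y * w 0 1 0 s (x + l * dx) y
    + M.σX y ^ 2 / 2 * w 0 2 0 s (x + l * dx) y + N l with hL
  -- The size of the generator in `x` applied to `u`.
  have hLb : L2Bound L (2 * P * G + 2 * Λ * G) := by
    refine ((hx1.add hx2).add hnl).mono ?_
    have e1 : |M.μX y| * G ≤ P * G := mul_le_mul_of_nonneg_right hμ hG0
    have e2 : |M.σX y ^ 2 / 2| * G ≤ P * G := by
      rw [abs_of_nonneg (by positivity)]
      exact mul_le_mul_of_nonneg_right (by linarith [sq_nonneg (M.σX y)]) hG0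
    linarith
  have hrem : L2Bound (fun l => W l - (U l - h * L l)) B := by
    convert hmt using 2 with l
    have := hR.pide hM hp (x := x + l * dx) hsT hy
    simp only [hL, hN]
    linear_combination h * this
  have hdiff : L2Bound (fun l => W l - U l) (B + h * (2 * P * G + 2 * Λ * G)) := by
    have := hrem.sub (hLb.const_mul h)
    rw [abs_of_nonneg hh] at this
    refine (this.of_eq ?_)
    funext l; ring
  have hWb : L2Bound W (B + h * (2 * P * G + 2 * Λ * G) + G) := by
    refine ((hdiff.add hU).of_eq ?_)
    funext l; ring
  have hjump := (hdiff.jumpSum hJ.weight_nonneg hJ.weight_summable hJ.weight_tsum_le).const_mul h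
  have htr' : L2Bound (fun l => jumpSum (M.weight dx y) U l - N l) (dx ^ 2 * Λ * G) := by
    convert htr using 2 with l
    simp only [jumpSum, hUdef]
    congr 1
    refine tsum_congr fun k => ?_
    rw [show x + ((l + k : ℤ) : ℝ) * dx = x + l * dx + k * dx by push_cast; ring]
  have hall := ((hst.sub hrem).sub (htr'.const_mul h)).sub hjump
  rw [abs_of_nonneg hh] at hall
  refine L2Bound.mono (K := h * dx ^ 2 * (2 * P) * G + B + h * (dx ^ 2 * Λ * G)
    + h * (2 * Λ * (B + h * (2 * P * G + 2 * Λ * G)))) ?_ ?_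
  · refine hall.of_eq ?_
    funext l
    rw [jumpSum_sub hJ.weight_summable hWb.abs_le hU.abs_le]
    simp only [hL]
    ring
  · rw [localBound, ← hB]
    linarith

/-- At maturity the value function inherits the grid bounds from earlier times. -/
lemma l2Bound_u_of_le (hR : Regular M T u w K q) {f : ℝ → ℝ → ℝ} (hp : SolvesPIDE M T f u)
    (hT : 0 < T) {t z dx : ℝ} (ht : 0 ≤ t) (htT : t ≤ T) (hz : z ∈ M.D)
    (hdx : 0 < dx) (hdx1 : dx < 1) (x : ℝ) :
    L2Bound (fun l : ℤ => u t (x + l * dx) z) (K * (1 + |z|) ^ q / √dx) := by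
  have h1 : ∀ s ∈ Set.Ico 0 T, L2Bound (fun l : ℤ => u s (x + l * dx) z)
      (K * (1 + |z|) ^ q / √dx) := fun s hs => by
    simpa only [hR.jet.zero s hs _ z hz] using hR.l2Bound_u hs hz hdx hdx1 x
  rcases htT.lt_or_eq with h | rfl
  · exact h1 t ⟨ht, h⟩
  · refine L2Bound.of_tendsto (l := 𝓝[<] t) (φ' := fun s l => u s (x + l * dx) z) (fun l => ?_) ?_
    · rw [hp.terminal _ z hz]; exact hp.terminal_cont _ z hz
    · filter_upwards [Ico_mem_nhdsLT hT] with s hs using h1 s hs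

/-- The local truncation error, up to maturity: the estimates before maturity are uniform, and
the terminal value is attained in the limit. -/
lemma local_error (hR : Regular M T u w K q) (hM : M.Standing) {f : ℝ → ℝ → ℝ}
    (hp : SolvesPIDE M T f u) {Λ s h y dx f₁ g₁ j₁ : ℝ}
    (hJ : M.JumpBound dx y Λ) {m : Measure ℝ} (hm : StepMoments M h y q m f₁ g₁ j₁) (hs : 0 ≤ s)
    (hh : 0 < h) (hsh : s + h ≤ T) (hhT : h < T) (hy : y ∈ M.D) (hdx : 0 < dx) (hdx1 : dx < 1)
    (x : ℝ) :
    L2Bound (fun l : ℤ =>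
        stencil (M.α h dx y) (M.β h dx y) (fun l => u s (x + l * dx) y) l
        - ((∫ z, u (s + h) (x + l * dx) z ∂m)
          + h * jumpSum (M.weight dx y) (fun l => ∫ z, u (s + h) (x + l * dx) z ∂m) l))
      (localBound h dx Λ (K * (1 + |y|) ^ q) (K * (1 + |y|) ^ q / √dx) f₁ g₁ j₁
        (remMoment h y q m)) := by
  have hlt : ∀ s, 0 ≤ s → s + h < T → L2Bound (fun l : ℤ =>
        stencil (M.α h dx y) (M.β h dx y) (fun l => u s (x + l * dx) y) l
        - ((∫ z, u (s + h) (x + l * dx) z ∂m)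
          + h * jumpSum (M.weight dx y) (fun l => ∫ z, u (s + h) (x + l * dx) z ∂m) l))
      (localBound h dx Λ (K * (1 + |y|) ^ q) (K * (1 + |y|) ^ q / √dx) f₁ g₁ j₁
        (remMoment h y q m)) := by
    intro s hs hsh
    have e1 : ∀ x, ∫ z, u (s + h) x z ∂m = ∫ z, w 0 0 0 (s + h) x z ∂m := fun x =>
      integral_congr_ae (hm.mem.mono fun z hz =>
        (hR.jet.zero (s + h) ⟨by linarith, hsh⟩ x z hz).symm)
    have := hR.local_error_of_lt hM hp hJ hm hs hh.le hsh hy hdx hdx1 x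
    simpa only [e1, hR.jet.zero s ⟨hs, by linarith⟩ _ y hy] using this
  rcases hsh.lt_or_eq with hsT | hsT
  · exact hlt s hs hsT
  -- Since `h < T`, the last step starts at a positive time, which can be approached from below.
  have hs0 : 0 < s := by linarith
  have hsmem : s ∈ Set.Ico 0 T := ⟨hs, by linarith⟩
  have hev : ∀ᶠ t in 𝓝[<] s, 0 ≤ t ∧ t < s :=
    (eventually_mem_nhdsWithin.and (Ico_mem_nhdsLT hs0)).mono fun t ht => ⟨ht.2.1, ht.1⟩
  have hsub : ∀ᶠ t in 𝓝[<] s, t ∈ Set.Ico 0 T :=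
    hev.mono fun t ht => ⟨ht.1, ht.2.trans hsmem.2⟩
  have hU : ∀ x, Tendsto (fun t => u t x y) (𝓝[<] s) (𝓝 (u s x y)) := fun x => by
    have h1 := (hR.jet.deriv_t 0 0 0 (by omega) s hsmem x y hy).continuousWithinAt
    have h2 : Tendsto (fun t => w 0 0 0 t x y) (𝓝[<] s) (𝓝 (w 0 0 0 s x y)) :=
      h1.tendsto.comp (tendsto_nhdsWithin_iff.2 ⟨tendsto_nhdsWithin_of_tendsto_nhds tendsto_id, hsub⟩)
    rw [hR.jet.zero s hsmem x y hy] at h2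
    exact h2.congr' (hsub.mono fun t ht => hR.jet.zero t ht x y hy)
  have hshift : Tendsto (fun t => t + h) (𝓝[<] s) (𝓝[<] T) := by
    refine tendsto_nhdsWithin_iff.2 ⟨?_, hev.mono fun t ht => ?_⟩
    · have : Tendsto (fun t : ℝ => t + h) (𝓝 s) (𝓝 (s + h)) := (continuous_add_const h).tendsto s
      rw [hsT] at this
      exact tendsto_nhdsWithin_of_tendsto_nhds this
    · exact Set.mem_Iio.2 (by linarith [ht.2])
  have hbd : ∀ᶠ t in 𝓝[<] s, ∀ z ∈ M.D,
      L2Bound (fun l : ℤ => u (t + h) (x + l * dx) z) (K * (1 + |z|) ^ q / √dx) :=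
    hev.mono fun t ht z hz => by
      have hmem : t + h ∈ Set.Ico 0 T := ⟨by linarith [ht.1], by linarith [ht.2]⟩
      simpa only [hR.jet.zero _ hmem _ z hz] using hR.l2Bound_u hmem hz hdx hdx1 x
  have hdom : Integrable (fun z => K * (1 + |z|) ^ q / √dx) m :=
    (hm.int_pow.const_mul K).div_const _
  have hW : ∀ l : ℤ, Tendsto (fun t => ∫ z, u (t + h) (x + l * dx) z ∂m) (𝓝[<] s)
      (𝓝 (∫ z, u (s + h) (x + l * dx) z ∂m)) := fun l => by
    refine tendsto_integral_filter_of_dominated_convergence _ (hev.mono fun t ht => ?_)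
      (hbd.mono fun t ht => hm.mem.mono fun z hz => (ht z hz).abs_le l) hdom
      (hm.mem.mono fun z hz => ?_)
    · have hmem : t + h ∈ Set.Ico 0 T := ⟨by linarith [ht.1], by linarith [ht.2]⟩
      exact (hR.aestronglyMeasurable_jet hM hm.mem hmem _).congr
        (hm.mem.mono fun z hz => hR.jet.zero _ hmem _ z hz)
    · rw [hsT, hp.terminal _ z hz]
      exact (hp.terminal_cont _ z hz).comp hshift
  have hWb : ∀ᶠ t in 𝓝[<] s, ∀ l : ℤ, |∫ z, u (t + h) (x + l * dx) z ∂m|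
      ≤ ∫ z, K * (1 + |z|) ^ q / √dx ∂m := hbd.mono fun t ht l =>
    (Real.norm_eq_abs _).symm.trans_le <|
      norm_integral_le_of_norm_le hdom (hm.mem.mono fun z hz => (ht z hz).abs_le l)
  refine L2Bound.of_tendsto (l := 𝓝[<] s) (fun l => ?_)
    (hev.mono fun t ht => hlt t ht.1 (by linarith [ht.2]))
  refine Tendsto.sub ?_ ((hW l).add (Tendsto.const_mul h ?_))
  · exact (((hU _).const_mul _).add ((hU _).const_mul _)).sub ((hU _).const_mul _)
  · refine tendsto_tsum_of_dominated_convergence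
      (hJ.weight_summable.mul_right (2 * ∫ z, K * (1 + |z|) ^ q / √dx ∂m))
      (fun k => ((hW _).sub (hW _)).const_mul _) (hWb.mono fun t ht k => ?_)
    rw [norm_mul, Real.norm_eq_abs, abs_of_nonneg (hJ.weight_nonneg k)]
    refine mul_le_mul_of_nonneg_left ?_ (hJ.weight_nonneg k)
    have := (abs_sub (∫ z, u (t + h) (x + ((l + k : ℤ) : ℝ) * dx) z ∂m)
      (∫ z, u (t + h) (x + l * dx) z ∂m)).trans (add_le_add (ht (l + k)) (ht l))
    rw [Real.norm_eq_abs]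
    linarith

end Regular

/-! ### Propagation of the error over one step -/

lemma measurable_invStencil {S : Type*} [MeasurableSpace S] {a b : S → ℝ} {W : ℤ → S → ℝ}
    (ha : Measurable a) (hb : Measurable b) (hW : ∀ i, Measurable (W i)) (i : ℤ) :
    Measurable fun s => invStencil (a s) (b s) (fun j => W j s) i := by
  have hc : Measurable fun s => facC (a s) (b s) := by unfold facC; fun_prop
  unfold invStencil
  refine hc.inv.mul (Measurable.tsum fun k => (((hb.sub ha).div hc).pow_const k).mul
    (Measurable.tsum fun m => (((ha.add hb).div hc).pow_const m).mul (hW _)))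

lemma measurable_applyMat_matB {M : Model} (hM : M.Standing) {S : Type*} [MeasurableSpace S]
    (h dx : ℝ) {y : S → ℝ} {W : ℤ → S → ℝ} (hy : Measurable y) (hW : ∀ i, Measurable (W i))
    (i : ℤ) : Measurable fun s => applyMat (M.matB h dx (y s)) (fun j => W j s) i := by
  have hν : ∀ z : ℝ, Measurable fun s => M.νy (y s) z := fun z => by
    have hγ : Measurable fun s => M.γX (y s) := hM.meas_γX.comp hy
    unfold Model.νy
    exact hγ.abs.inv.mul ((Model.measurable_ν hM).comp (measurable_const.div hγ))
  unfold applyMat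
  refine Measurable.tsum fun j => Measurable.mul ?_ (hW j)
  unfold Model.matB
  by_cases hij : i = j
  · simp only [hij, if_true]
    exact measurable_const.add (measurable_const.mul (((hν 0).mul_const dx).sub
      (Measurable.tsum fun l => (hν _).mul_const dx)))
  · simp only [hij, if_false]
    exact ((hν _).const_mul h).mul_const dx

lemma measurable_invStencil_matB {M : Model} (hM : M.Standing) {S : Type*} [MeasurableSpace S]
    (h dx : ℝ) {y : S → ℝ} {W : ℤ → S → ℝ} (hy : Measurable y) (hW : ∀ i, Measurable (W i))
    (i : ℤ) : Measurable fun s => invStencil (M.α h dx (y s)) (M.β h dx (y s))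
      (applyMat (M.matB h dx (y s)) (fun j => W j s)) i :=
  measurable_invStencil ((hM.meas_μX.comp hy).const_mul _)
    (((hM.meas_σX.comp hy).pow_const 2).const_mul _)
    (fun j => measurable_applyMat_matB hM h dx hy hW j) i

lemma Model.JumpBound.weightBound {M : Model} {h dx y Λ : ℝ} (hJ : M.JumpBound dx y Λ)
    (hh : 0 ≤ h) : WeightBound M h dx y Λ :=
  ⟨hh, hJ.weight_nonneg, hJ.weight_summable, hJ.weight_tsum_le⟩

/-- The operator `A⁻¹` of the scheme is given by a choice; the explicit inverse shows that the step is
measurable in the state of the chain. -/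
lemma aemeasurable_step {M : Model} (hM : M.Standing) {h dx Λ : ℝ} {S : Type*}
    [MeasurableSpace S] {m : Measure S} {y : S → ℝ} {v : ℤ → S → ℝ} {k : S → ℝ}
    (hy : Measurable y) (hw : ∀ᵐ s ∂m, WeightBound M h dx (y s) Λ)
    (hv : ∀ i, AEMeasurable (v i) m) (hk : ∀ᵐ s ∂m, L2Bound (fun j => v j s) (k s)) (i : ℤ) :
    AEMeasurable (fun s => M.step h dx (y s) (fun j => v j s) i) m := by
  refine ⟨_, measurable_invStencil_matB hM h dx hy (fun j => (hv j).measurable_mk) i, ?_⟩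
  have hall : ∀ᵐ s ∂m, ∀ j, v j s = (hv j).mk (v j) s := ae_all_iff.2 fun j => (hv j).ae_eq_mk
  filter_upwards [hw, hk, hall] with s h1 h2 h3
  rw [h1.step_eq_invStencil h2]
  simp only [h3]

/-- The one-step operator commutes with averaging over the chain. -/
lemma integral_step {M : Model} (hM : M.Standing) {h dx y Λ : ℝ} (hw : WeightBound M h dx y Λ)
    {S : Type*} [MeasurableSpace S] {m : Measure S} {v : ℤ → S → ℝ} {k : S → ℝ}
    (hv : ∀ i, AEMeasurable (v i) m) (hk : ∀ᵐ s ∂m, L2Bound (fun j => v j s) (k s))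
    (hki : Integrable k m) :
    (fun i => ∫ s, M.step h dx y (fun j => v j s) i ∂m)
      = M.step h dx y (fun j => ∫ s, v j s ∂m) := by
  have hstep : ∀ i, AEStronglyMeasurable (fun s => M.step h dx y (fun j => v j s) i) m := fun i =>
    (aemeasurable_step hM (y := fun _ : S => y) measurable_const
      (Eventually.of_forall fun _ => hw) hv hk i).aestronglyMeasurable
  have hb := L2Bound.integral hstep (hk.mono fun s hs => hw.l2Bound_step hs)
    (hki.const_mul (1 + 2 * Λ * h))
  have hV := L2Bound.integral (fun i => (hv i).aestronglyMeasurable) hk hki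
  have hvi : ∀ i, Integrable (v i) m := fun i =>
    hki.mono' (hv i).aestronglyMeasurable (hk.mono fun s hs => hs.abs_le i)
  have hsi : ∀ i, Integrable (fun s => M.step h dx y (fun j => v j s) i) m := fun i =>
    (hki.const_mul (1 + 2 * Λ * h)).mono' (hstep i)
      (hk.mono fun s hs => (hw.l2Bound_step hs).abs_le i)
  refine (step_eq_of_stencil_eq hw.β_nonneg hb.memL2 ?_).symm
  funext i
  have e1 : stencil (M.α h dx y) (M.β h dx y)
      (fun i => ∫ s, M.step h dx y (fun j => v j s) i ∂m) i
      = ∫ s, stencil (M.α h dx y) (M.β h dx y) (M.step h dx y (fun j => v j s)) i ∂m := by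
    simp only [stencil]
    have g1 : Integrable (fun s => (M.α h dx y - M.β h dx y)
        * M.step h dx y (fun j => v j s) (i - 1)
        + (1 + 2 * M.β h dx y) * M.step h dx y (fun j => v j s) i) m :=
      ((hsi _).const_mul _).add ((hsi _).const_mul _)
    rw [integral_sub g1 ((hsi _).const_mul _),
      integral_add ((hsi _).const_mul _) ((hsi _).const_mul _), integral_const_mul,
      integral_const_mul, integral_const_mul]
  have e2 : ∫ s, stencil (M.α h dx y) (M.β h dx y) (M.step h dx y (fun j => v j s)) i ∂m
      = ∫ s, (v i s + h * jumpSum (M.weight dx y) (fun j => v j s) i) ∂m := by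
    refine integral_congr_ae (hk.mono fun s hs => ?_)
    simp only
    rw [hw.stencil_step hs, hw.applyMat_eq hs]
  have hF : ∀ l : ℤ, Integrable (fun s => M.weight dx y l * (v (i + l) s - v i s)) m := fun l =>
    ((hvi _).sub (hvi _)).const_mul _
  have hS : Summable fun l : ℤ => ∫ s, ‖M.weight dx y l * (v (i + l) s - v i s)‖ ∂m := by
    refine Summable.of_nonneg_of_le (fun l => integral_nonneg fun _ => norm_nonneg _) (fun l => ?_)
      (hw.summable.mul_right (∫ s, (k s + k s) ∂m))
    rw [← integral_const_mul]
    refine integral_mono_ae (hF l).norm ((hki.add hki).const_mul _) (hk.mono fun s hs => ?_)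
    simp only [norm_mul, Real.norm_eq_abs, abs_of_nonneg (hw.nonneg l)]
    exact mul_le_mul_of_nonneg_left
      ((abs_sub _ _).trans (add_le_add (hs.abs_le _) (hs.abs_le _))) (hw.nonneg l)
  have hsum := hasSum_integral_of_summable_integral_norm hF hS
  have hJi : Integrable (fun s => jumpSum (M.weight dx y) (fun j => v j s) i) m := by
    refine (hki.const_mul (2 * Λ)).mono' ?_ (hk.mono fun s hs =>
      (hs.jumpSum hw.nonneg hw.summable hw.tsum_le).abs_le i)
    exact (AEMeasurable.tsum fun l => ((hv _).sub (hv _)).const_mul _).aestronglyMeasurable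
  rw [e1, e2, integral_add (hvi i) (hJi.const_mul h), integral_const_mul, hw.applyMat_eq hV]
  congr 2
  simp only [jumpSum]
  rw [← hsum.tsum_eq]
  refine tsum_congr fun l => ?_
  rw [integral_const_mul, integral_sub (hvi _) (hvi _)]

namespace Regular

variable {M : Model} {T : ℝ} {u : ℝ → ℝ → ℝ → ℝ} {w : ℕ → ℕ → ℕ → ℝ → ℝ → ℝ → ℝ}
  {K : ℝ} {q : ℕ}

lemma aestronglyMeasurable_u (hR : Regular M T u w K q) (hM : M.Standing) {f : ℝ → ℝ → ℝ}
    (hp : SolvesPIDE M T f u) (hT : 0 < T) {m : Measure ℝ} (hm : ∀ᵐ z ∂m, z ∈ M.D) {t : ℝ}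
    (ht : 0 ≤ t) (htT : t ≤ T) (x : ℝ) : AEStronglyMeasurable (fun z => u t x z) m := by
  have h1 : ∀ s ∈ Set.Ico 0 T, AEStronglyMeasurable (fun z => u s x z) m := fun s hs =>
    (hR.aestronglyMeasurable_jet hM hm hs x).congr
      (hm.mono fun z hz => hR.jet.zero s hs x z hz)
  rcases htT.lt_or_eq with h | rfl
  · exact h1 t ⟨ht, h⟩
  · obtain ⟨s, -, hs, hst⟩ := exists_seq_strictMono_tendsto' hT
    refine aestronglyMeasurable_of_tendsto_ae atTop (f := fun n z => u (s n) x z)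
      (fun n => h1 _ ⟨(hs n).1.le, (hs n).2⟩) (hm.mono fun z hz => ?_)
    rw [hp.terminal x z hz]
    exact (hp.terminal_cont x z hz).comp
      (tendsto_nhdsWithin_iff.2 ⟨hst, Eventually.of_forall fun n => (hs n).2⟩)

/-- The error of one step is the local truncation error plus the averaged error at the next
time, amplified by the norm of the one-step operator. -/
lemma error_step (hR : Regular M T u w K q) (hM : M.Standing) {f : ℝ → ℝ → ℝ}
    (hp : SolvesPIDE M T f u) {Λ s h y dx f₁ g₁ j₁ : ℝ}
    (hJ : M.JumpBound dx y Λ) {m : Measure ℝ} (hm : StepMoments M h y q m f₁ g₁ j₁) (hs : 0 ≤ s)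
    (hh : 0 < h) (hsh : s + h ≤ T) (hhT : h < T) (hy : y ∈ M.D) (hdx : 0 < dx) (hdx1 : dx < 1)
    (x : ℝ) {v : ℤ → ℝ → ℝ} {k : ℝ → ℝ} (hv : ∀ i, AEMeasurable (v i) m)
    (hk : ∀ᵐ z ∂m, L2Bound (fun i => u (s + h) (x + i * dx) z - v i z) (k z))
    (hki : Integrable k m) :
    (fun i => ∫ z, M.step h dx y (fun j => v j z) i ∂m)
        = M.step h dx y (fun j => ∫ z, v j z ∂m) ∧
      L2Bound (fun i : ℤ => u s (x + i * dx) y - ∫ z, M.step h dx y (fun j => v j z) i ∂m)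
        (localBound h dx Λ (K * (1 + |y|) ^ q) (K * (1 + |y|) ^ q / √dx) f₁ g₁ j₁
          (remMoment h y q m) + (1 + 2 * Λ * h) * ∫ z, k z ∂m) ∧
      L2Bound (fun i => ∫ z, v i z ∂m) (∫ z, (K * (1 + |z|) ^ q / √dx + k z) ∂m) := by
  have hT : 0 < T := hh.trans hhT
  have hw := hJ.weightBound hh.le
  have hub : ∀ᵐ z ∂m, L2Bound (fun i : ℤ => u (s + h) (x + i * dx) z) (K * (1 + |z|) ^ q / √dx) :=
    hm.mem.mono fun z hz => hR.l2Bound_u_of_le hp hT (by linarith) hsh hz hdx hdx1 x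
  have hdom : Integrable (fun z => K * (1 + |z|) ^ q / √dx) m :=
    (hm.int_pow.const_mul K).div_const _
  have hum : ∀ i : ℤ, AEStronglyMeasurable (fun z => u (s + h) (x + i * dx) z) m := fun i =>
    hR.aestronglyMeasurable_u hM hp hT hm.mem (by linarith) hsh _
  have hvb : ∀ᵐ z ∂m, L2Bound (fun i => v i z) (K * (1 + |z|) ^ q / √dx + k z) := by
    filter_upwards [hub, hk] with z h1 h2
    refine (h1.sub h2).of_eq ?_
    funext i; ring
  have hcomm := integral_step hM hw hv hvb (hdom.add hki)
  have hui : ∀ i : ℤ, Integrable (fun z => u (s + h) (x + i * dx) z) m := fun i =>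
    hdom.mono' (hum i) (hub.mono fun z hz => hz.abs_le i)
  have hvi : ∀ i : ℤ, Integrable (v i) m := fun i =>
    (hdom.add hki).mono' (hv i).aestronglyMeasurable (hvb.mono fun z hz => hz.abs_le i)
  have hWb := L2Bound.integral hum hub hdom
  have hVb := L2Bound.integral (fun i => (hv i).aestronglyMeasurable) hvb (hdom.add hki)
  refine ⟨hcomm, ?_, hVb⟩
  have hDb : L2Bound (fun i : ℤ => (∫ z, u (s + h) (x + i * dx) z ∂m) - ∫ z, v i z ∂m)
      (∫ z, k z ∂m) := by
    have := L2Bound.integral (fun i => (hum i).sub (hv i).aestronglyMeasurable) hk hki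
    refine this.of_eq ?_
    funext i
    exact integral_sub (hui i) (hvi i)
  have h1 := hw.l2Bound_step hDb
  rw [hw.step_sub hWb hVb] at h1
  have hUs := hR.l2Bound_u_of_le hp hT hs (by linarith) hy hdx hdx1 x
  have h2 : L2Bound (fun i : ℤ => u s (x + i * dx) y
      - M.step h dx y (fun j : ℤ => ∫ z, u (s + h) (x + j * dx) z ∂m) i)
      (localBound h dx Λ (K * (1 + |y|) ^ q) (K * (1 + |y|) ^ q / √dx) f₁ g₁ j₁
          (remMoment h y q m)) := by
    refine L2Bound.of_stencil (α := M.α h dx y) hw.β_nonneg (hUs.sub (hw.l2Bound_step hWb)).memL2 ?_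
    refine (hR.local_error hM hp hJ hm hs hh hsh hhT hy hdx hdx1 x).of_eq ?_
    funext i
    have e1 := congrFun (hw.stencil_step hWb) i
    rw [hw.applyMat_eq hWb] at e1
    simp only at e1
    rw [← e1]
    simp only [stencil]
    ring
  refine (h2.add h1).of_eq ?_
  funext i
  rw [congrFun hcomm i]
  ring

end Regular

/-! ### The transition kernels of the chain -/

section Joint

variable {Ω : Type*} [MeasurableSpace Ω] {P : Measure Ω} [IsProbabilityMeasure P]
  {D : Set ℝ} {y₀ : ℝ} {N : ℕ} {Y : ℕ → Ω → ℝ} {κ : ℕ → Kernel ℝ ℝ}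

/-- The joint law of two successive values of the chain. -/
lemma IsMarkovChain.map_prod (hY : IsMarkovChain P D y₀ N Y κ) {n : ℕ} (hn : n < N) :
    P.map (fun ω => (Y n ω, Y (n + 1) ω)) = P.map (Y n) ⊗ₘ κ n := by
  have := hY.markov_kernel n hn
  have hm0 := hY.meas n hn.le
  have hm1 := hY.meas (n + 1) hn
  have : IsProbabilityMeasure (P.map (Y n)) := Measure.isProbabilityMeasure_map hm0.aemeasurable
  have : IsProbabilityMeasure (P.map fun ω => (Y n ω, Y (n + 1) ω)) :=
    Measure.isProbabilityMeasure_map (hm0.prodMk hm1).aemeasurable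
  have hFle : (⨆ (k : ℕ) (_ : k ≤ n), MeasurableSpace.comap (Y k) inferInstance)
      ≤ ‹MeasurableSpace Ω› := iSup₂_le fun k hk => (hY.meas k (hk.trans hn.le)).comap_le
  refine Measure.ext_prod fun {A s} hA hs => ?_
  have hAF : MeasurableSet[⨆ (k : ℕ) (_ : k ≤ n), MeasurableSpace.comap (Y k) inferInstance]
      (Y n ⁻¹' A) :=
    (le_iSup₂ (f := fun (k : ℕ) (_ : k ≤ n) => MeasurableSpace.comap (Y k) inferInstance) n le_rfl)
      _ ⟨A, hA, rfl⟩
  have hs1 : MeasurableSet (Y (n + 1) ⁻¹' s) := hm1 hs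
  have h1 := setIntegral_condExp hFle (μ := P)
    (f := (Y (n + 1) ⁻¹' s).indicator (fun _ => (1 : ℝ)))
    ((integrable_const (1 : ℝ)).indicator hs1) hAF
  rw [setIntegral_congr_ae (hFle _ hAF) ((hY.markov n hn s hs).mono fun ω hω _ => hω),
    setIntegral_indicator hs1, setIntegral_const, smul_eq_mul, mul_one] at h1
  rw [Measure.compProd_apply_prod hA hs, Measure.map_apply (hm0.prodMk hm1) (hA.prod hs),
    setLIntegral_map hA (Kernel.measurable_coe _ hs) hm0]
  have h2 : ∫⁻ ω in Y n ⁻¹' A, κ n (Y n ω) s ∂P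
      = ENNReal.ofReal (∫ ω in Y n ⁻¹' A, (κ n (Y n ω)).real s ∂P) := by
    have hmeas : Measurable fun ω => κ n (Y n ω) s := (Kernel.measurable_coe _ hs).comp hm0
    rw [ofReal_integral_eq_lintegral_ofReal]
    · exact lintegral_congr fun ω => by rw [measureReal_def, ENNReal.ofReal_toReal (measure_ne_top _ _)]
    · refine Integrable.of_bound hmeas.ennreal_toReal.aestronglyMeasurable 1
        (Eventually.of_forall fun ω => ?_)
      rw [Real.norm_eq_abs, abs_of_nonneg measureReal_nonneg]
      exact measureReal_le_one
    · exact Eventually.of_forall fun ω => ENNReal.toReal_nonneg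
  rw [h2, h1, ofReal_measureReal]
  rfl

/-- A null set of the law at time `n + 1` is null for the transition law from almost every state at
time `n`. -/
lemma IsMarkovChain.ae_kernel (hY : IsMarkovChain P D y₀ N Y κ) {n : ℕ} (hn : n < N)
    {p : ℝ → Prop} (h : ∀ᵐ z ∂P.map (Y (n + 1)), p z) :
    ∀ᵐ y ∂P.map (Y n), ∀ᵐ z ∂κ n y, p z := by
  have := hY.markov_kernel n hn
  have hm0 := hY.meas n hn.le
  have hm1 := hY.meas (n + 1) hn
  refine Measure.ae_ae_of_ae_compProd (p := fun x : ℝ × ℝ => p x.2) ?_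
  rw [← hY.map_prod hn]
  have e : P.map (Y (n + 1)) = (P.map fun ω => (Y n ω, Y (n + 1) ω)).map Prod.snd := by
    rw [Measure.map_map measurable_snd (hm0.prodMk hm1)]; rfl
  rw [e] at h
  exact ae_of_ae_map measurable_snd.aemeasurable h

/-- Fubini for the joint law of two successive values. -/
lemma IsMarkovChain.integrable_kernel (hY : IsMarkovChain P D y₀ N Y κ) {n : ℕ} (hn : n < N)
    {F : ℝ × ℝ → ℝ} (hF : Measurable F)
    (hi : Integrable (fun ω => F (Y n ω, Y (n + 1) ω)) P) :
    (∀ᵐ y ∂P.map (Y n), Integrable (fun z => F (y, z)) (κ n y)) ∧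
      Integrable (fun y => ∫ z, F (y, z) ∂κ n y) (P.map (Y n)) ∧
      ∫ y, ∫ z, F (y, z) ∂κ n y ∂P.map (Y n) = ∫ ω, F (Y n ω, Y (n + 1) ω) ∂P := by
  have := hY.markov_kernel n hn
  have hm := (hY.meas n hn.le).prodMk (hY.meas (n + 1) hn)
  have h1 : Integrable F (P.map (Y n) ⊗ₘ κ n) := by
    rw [← hY.map_prod hn]
    exact (integrable_map_measure hF.aestronglyMeasurable hm.aemeasurable).2 hi
  have h2 := (Measure.integrable_compProd_iff h1.aestronglyMeasurable).1 h1
  refine ⟨h2.1, h2.2.mono' hF.stronglyMeasurable.integral_kernel_prod_right'.aestronglyMeasurable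
    (Eventually.of_forall fun y => norm_integral_le_integral_norm _), ?_⟩
  rw [← Measure.integral_compProd h1, ← hY.map_prod hn,
    integral_map hm.aemeasurable hF.aestronglyMeasurable]

/-- The conditional moments given `Y n` are the moments of the transition law. -/
lemma IsMarkovChain.integral_eq_of_condExp (hY : IsMarkovChain P D y₀ N Y κ) {n : ℕ} (hn : n < N)
    {F : ℝ × ℝ → ℝ} (hF : Measurable F)
    (hi : Integrable (fun ω => F (Y n ω, Y (n + 1) ω)) P) {φ : ℝ → ℝ} (hφ : Measurable φ)
    (hc : P[fun ω => F (Y n ω, Y (n + 1) ω) | MeasurableSpace.comap (Y n) inferInstance]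
      =ᵐ[P] fun ω => φ (Y n ω)) :
    ∀ᵐ y ∂P.map (Y n), ∫ z, F (y, z) ∂κ n y = φ y := by
  have := hY.markov_kernel n hn
  have hm0 := hY.meas n hn.le
  have hm1 := hY.meas (n + 1) hn
  have h1 := condExp_prod_ae_eq_integral_condDistrib hm0 hm1.aemeasurable hF.stronglyMeasurable hi
  have h2 := ae_of_ae_map hm0.aemeasurable
    (condDistrib_ae_eq_of_measure_eq_compProd (Y n) hm1.aemeasurable (hY.map_prod hn))
  rw [ae_map_iff hm0.aemeasurable (measurableSet_eq_fun
    hF.stronglyMeasurable.integral_kernel_prod_right'.measurable hφ)]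
  filter_upwards [h1, h2, hc] with ω e1 e2 e3
  rw [← e3, e1, e2]

end Joint

/-! ### Moments of the chain -/

lemma integral_rpow_le_of_eLpNorm_le {Ω : Type*} [MeasurableSpace Ω] {P : Measure Ω}
    {X : Ω → ℝ} {p C : ℝ} (hp : 1 < p) (hC : 0 ≤ C) (hX : Measurable X)
    (h : eLpNorm X (ENNReal.ofReal p) P ≤ ENNReal.ofReal C) :
    Integrable (fun ω => |X ω| ^ p) P ∧ ∫ ω, |X ω| ^ p ∂P ≤ C ^ p := by
  have hp0 : 0 < p := by linarith
  have hm : MemLp X (ENNReal.ofReal p) P :=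
    ⟨hX.aestronglyMeasurable, h.trans_lt ENNReal.ofReal_lt_top⟩
  have hne : ENNReal.ofReal p ≠ 0 := by simpa using hp0
  have h1 := hm.eLpNorm_eq_integral_rpow_norm hne ENNReal.ofReal_ne_top
  have h2 := hm.integrable_norm_rpow hne ENNReal.ofReal_ne_top
  rw [ENNReal.toReal_ofReal hp0.le] at h1 h2
  refine ⟨h2, ?_⟩
  rw [h1, ENNReal.ofReal_le_ofReal_iff hC] at h
  simp only [Real.norm_eq_abs] at h
  have h0 : 0 ≤ ∫ ω, |X ω| ^ p ∂P := integral_nonneg fun _ => by positivity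
  calc ∫ ω, |X ω| ^ p ∂P = ((∫ ω, |X ω| ^ p ∂P) ^ p⁻¹) ^ p := by
        rw [← Real.rpow_mul h0, inv_mul_cancel₀ hp0.ne', Real.rpow_one]
    _ ≤ C ^ p := Real.rpow_le_rpow (by positivity) h hp0.le

lemma one_add_abs_pow_le (m : ℕ) (x : ℝ) : (1 + |x|) ^ m ≤ 2 ^ m * (1 + |x| ^ (m + 2)) := by
  have h0 := abs_nonneg x
  have h3 : 0 ≤ |x| ^ (m + 2) := by positivity
  rcases le_total |x| 1 with h | h
  · calc (1 + |x|) ^ m ≤ 2 ^ m := by gcongr; linarith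
      _ ≤ 2 ^ m * (1 + |x| ^ (m + 2)) := le_mul_of_one_le_right (by positivity) (by linarith)
  · calc (1 + |x|) ^ m ≤ (2 * |x|) ^ m := by gcongr; linarith
      _ = 2 ^ m * |x| ^ m := mul_pow _ _ _
      _ ≤ 2 ^ m * (1 + |x| ^ (m + 2)) := by
        have := pow_le_pow_right₀ h (show m ≤ m + 2 by omega)
        gcongr
        linarith

section Moments

variable {Ω : Type*} [MeasurableSpace Ω] {P : Measure Ω}

/-- The moments provided by `H₂`, uniformly over the chains with `T / N < hbar`. -/
structure MomentBounds (P : Measure Ω) (T hbar : ℝ) (Y : ℕ → ℕ → Ω → ℝ) : Prop where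
  poly : ∀ m : ℕ, ∃ C > 0, ∀ N : ℕ, 1 ≤ N → T / N < hbar → ∀ n ≤ N,
    Integrable (fun ω => (1 + |Y N n ω|) ^ m) P ∧ ∫ ω, (1 + |Y N n ω|) ^ m ∂P ≤ C
  incr : ∀ m : ℕ, 1 ≤ m → ∃ C > 0, ∀ N : ℕ, 1 ≤ N → T / N < hbar → ∀ n < N,
    Integrable (fun ω => (Y N (n + 1) ω - Y N n ω) ^ (2 * m)) P ∧
      ∫ ω, (Y N (n + 1) ω - Y N n ω) ^ (2 * m) ∂P ≤ C * (T / N) ^ m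

lemma AssumptionH2.momentBounds [IsProbabilityMeasure P] {T : ℝ} (hT : 0 ≤ T) {Y : ℕ → ℕ → Ω → ℝ}
    (hmeas : ∀ N : ℕ, 1 ≤ N → ∀ n ≤ N, Measurable (Y N n)) (h : AssumptionH2 P T Y) :
    ∃ hbar > 0, MomentBounds P T hbar Y := by
  obtain ⟨hbar, hpos, h⟩ := h
  refine ⟨hbar, hpos, fun m => ?_, fun m hm => ?_⟩
  · obtain ⟨C, hC, hb⟩ := h ((m + 2 : ℕ) : ℝ) (by exact_mod_cast (by omega : 1 < m + 2))
    refine ⟨2 ^ m * (1 + C ^ (m + 2)), by positivity, fun N hN hh n hn => ?_⟩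
    obtain ⟨h1, h2⟩ := integral_rpow_le_of_eLpNorm_le
      (by exact_mod_cast (by omega : 1 < m + 2)) hC.le (hmeas N hN n hn) ((hb N hN hh).1 n hn)
    simp only [Real.rpow_natCast] at h1 h2
    have h3 : Integrable (fun ω => 2 ^ m * (1 + |Y N n ω| ^ (m + 2))) P :=
      ((integrable_const 1).add h1).const_mul _
    have hmp : Measurable fun ω => (1 + |Y N n ω|) ^ m :=
      ((hmeas N hN n hn).abs.const_add 1).pow_const m
    have h4 : Integrable (fun ω => (1 + |Y N n ω|) ^ m) P :=
      h3.mono' hmp.aestronglyMeasurable (Eventually.of_forall fun ω => by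
        rw [Real.norm_eq_abs, abs_of_nonneg (by positivity)]
        exact one_add_abs_pow_le m _)
    refine ⟨h4, (integral_mono h4 h3 fun ω => one_add_abs_pow_le m _).trans ?_⟩
    rw [integral_const_mul, integral_add (integrable_const 1) h1]
    simp only [integral_const, probReal_univ, one_smul]
    gcongr
  · obtain ⟨C, hC, hb⟩ := h ((2 * m : ℕ) : ℝ) (by exact_mod_cast (by omega : 1 < 2 * m))
    refine ⟨C ^ (2 * m), by positivity, fun N hN hh n hn => ?_⟩
    have hTN : 0 ≤ T / N := by positivity
    obtain ⟨h1, h2⟩ := integral_rpow_le_of_eLpNorm_le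
      (by exact_mod_cast (by omega : 1 < 2 * m)) (by positivity)
      ((hmeas N hN (n + 1) hn).sub (hmeas N hN n hn.le)) ((hb N hN hh).2 n hn)
    simp only [Real.rpow_natCast, Pi.sub_apply, pow_mul, sq_abs] at h1 h2
    simp only [pow_mul]
    refine ⟨h1, h2.trans (le_of_eq ?_)⟩
    rw [mul_pow, Real.sq_sqrt hTN, mul_pow]

end Moments

/-! ### The expected local truncation error -/

lemma localBound_le {h dx Λ P ρ f g j S : ℝ} (hh : 0 ≤ h) (hh1 : h ≤ 1) (hΛ : 0 ≤ Λ) (hP : 1 ≤ P)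
    (hρ : 0 ≤ ρ) (hS : 0 ≤ S) :
    localBound h dx Λ P (P * ρ) f g j S ≤ ρ * (4 * (1 + Λ) ^ 2) *
      ((h * dx ^ 2 + h ^ 2) * P ^ 2 + P * (|f| + |g| + |j|) + P * S) := by
  have hf := abs_nonneg f
  have hg := abs_nonneg g
  have hj := abs_nonneg j
  have hP0 : 0 ≤ P := by linarith
  have hPρ : 0 ≤ P * ρ := by positivity
  set R := P * ρ * (2 * (|f| + |g| + |j|) + h ^ 2 * P + S) with hR
  have hR0 : 0 ≤ R := by positivity
  have h1 : remBound h P (P * ρ) f g j S ≤ R := by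
    unfold remBound
    refine mul_le_mul_of_nonneg_left ?_ hPρ
    nlinarith
  have h2 : 2 * Λ * h * remBound h P (P * ρ) f g j S ≤ 2 * Λ * R :=
    calc _ ≤ 2 * Λ * h * R := by gcongr
      _ ≤ 2 * Λ * 1 * R := by gcongr
      _ = _ := by ring
  have h3 : P * ρ ≤ P ^ 2 * ρ := by
    have := mul_le_mul_of_nonneg_right hP hPρ
    linarith
  have hX : h * dx ^ 2 * Λ * (P * ρ) ≤ h * dx ^ 2 * Λ * (P ^ 2 * ρ) := by gcongr
  have hZ : h ^ 2 * Λ ^ 2 * (P * ρ) ≤ h ^ 2 * Λ ^ 2 * (P ^ 2 * ρ) := by gcongr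
  have p1 : 0 ≤ h * dx ^ 2 * (P ^ 2 * ρ) := by positivity
  have p2 : 0 ≤ h ^ 2 * (P ^ 2 * ρ) := by positivity
  have p3 : 0 ≤ P * ρ * (|f| + |g| + |j|) := by positivity
  have p4 : 0 ≤ P * ρ * S := by positivity
  have q1 := mul_nonneg hΛ p1
  have q2 := mul_nonneg hΛ p2
  have q3 := mul_nonneg hΛ p3
  have q4 := mul_nonneg hΛ p4
  have r1 := mul_nonneg hΛ q1
  have r3 := mul_nonneg hΛ q3
  have r4 := mul_nonneg hΛ q4
  unfold localBound
  calc _ ≤ h * dx ^ 2 * (2 * P) * (P * ρ) + R + h * dx ^ 2 * Λ * (P ^ 2 * ρ) + (2 * Λ * R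
        + 4 * (Λ * (h ^ 2 * (P ^ 2 * ρ))) + 4 * (h ^ 2 * Λ ^ 2 * (P ^ 2 * ρ))) := by linarith
    _ ≤ _ := by rw [hR]; linarith

/-- Young's inequality, in the form that trades the integrability exponent of the error terms of
`H₁` for a moment of the chain. -/
lemma pow_mul_abs_le {p h a b : ℝ} {q : ℕ} (hp : 1 < p) (hh : 0 < h) (hb : 1 ≤ b) :
    b ^ q * |a| ≤ h ^ 2 * (|a| ^ p * ((h ^ 2) ^ p)⁻¹ + b ^ ⌈q * p.conjExponent⌉₊) := by
  have hpq : p.HolderConjugate p.conjExponent := Real.HolderConjugate.conjExponent hp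
  have hh2 : 0 < h ^ 2 := by positivity
  have hb0 : 0 ≤ b := by linarith
  have h1 := Real.young_inequality_of_nonneg (div_nonneg (abs_nonneg a) hh2.le)
    (pow_nonneg hb0 q) hpq
  have h2 : (|a| / h ^ 2) ^ p / p ≤ |a| ^ p * ((h ^ 2) ^ p)⁻¹ := by
    rw [Real.div_rpow (abs_nonneg a) hh2.le, ← div_eq_mul_inv]
    exact div_le_self (by positivity) hp.le
  have h3 : (b ^ q) ^ p.conjExponent / p.conjExponent ≤ b ^ ⌈q * p.conjExponent⌉₊ := by
    refine (div_le_self (by positivity) hpq.symm.lt.le).trans ?_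
    rw [← Real.rpow_natCast, ← Real.rpow_mul hb0, ← Real.rpow_natCast]
    exact Real.rpow_le_rpow_of_exponent_le hb (Nat.le_ceil _)
  calc b ^ q * |a| = h ^ 2 * (|a| / h ^ 2 * b ^ q) := by field_simp
    _ ≤ _ := by gcongr; linarith

section Moments

variable {Ω : Type*} [MeasurableSpace Ω] {P : Measure Ω} {T hbar : ℝ}
  {Y : ℕ → ℕ → Ω → ℝ}

lemma MomentBounds.mono (hm : MomentBounds P T hbar Y) {hbar' : ℝ} (h : hbar' ≤ hbar) :
    MomentBounds P T hbar' Y := by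
  refine ⟨fun m => ?_, fun m hm1 => ?_⟩
  · obtain ⟨C, hC, hb⟩ := hm.poly m
    exact ⟨C, hC, fun N hN hh => hb N hN (hh.trans_le h)⟩
  · obtain ⟨C, hC, hb⟩ := hm.incr m hm1
    exact ⟨C, hC, fun N hN hh => hb N hN (hh.trans_le h)⟩

/-- The `Lᵖ` bounds of `H₁`, `p > 1`, give weighted `L¹` bounds of the same order `h²`, whatever the
polynomial weight. -/
lemma MomentBounds.exists_error (hm : MomentBounds P T hbar Y) (hT : 0 < T)
    (hmeas : ∀ N : ℕ, 1 ≤ N → ∀ n ≤ N, Measurable (Y N n)) {F : ℕ → ℝ → ℝ}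
    (hF : ∀ N, Measurable (F N)) {p C : ℝ} (hp : 1 < p) (hC : 0 < C)
    (hb : ∀ N : ℕ, 1 ≤ N → T / N < hbar → ∀ n ≤ N,
      eLpNorm (fun ω => F N (Y N n ω)) (ENNReal.ofReal p) P ≤ ENNReal.ofReal (C * (T / N) ^ 2))
    (q : ℕ) : ∃ C' > 0, ∀ N : ℕ, 1 ≤ N → T / N < hbar → ∀ n ≤ N,
      Integrable (fun ω => (1 + |Y N n ω|) ^ q * |F N (Y N n ω)|) P ∧
        ∫ ω, (1 + |Y N n ω|) ^ q * |F N (Y N n ω)| ∂P ≤ C' * (T / N) ^ 2 := by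
  obtain ⟨C1, hC1, hpoly⟩ := hm.poly ⌈q * p.conjExponent⌉₊
  refine ⟨C ^ p + C1, by positivity, fun N hN hh n hn => ?_⟩
  have hN0 : (0 : ℝ) < N := by exact_mod_cast hN
  set h := T / N with hdef
  have hh0 : 0 < h := by positivity
  have hYm := hmeas N hN n hn
  have hFm : Measurable fun ω => F N (Y N n ω) := (hF N).comp hYm
  obtain ⟨i1, b1⟩ := integral_rpow_le_of_eLpNorm_le hp (by positivity) hFm (hb N hN hh n hn)
  obtain ⟨i2, b2⟩ := hpoly N hN hh n hn
  have hle : ∀ ω, (1 + |Y N n ω|) ^ q * |F N (Y N n ω)|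
      ≤ h ^ 2 * (|F N (Y N n ω)| ^ p * ((h ^ 2) ^ p)⁻¹ + (1 + |Y N n ω|) ^ ⌈q * p.conjExponent⌉₊) :=
    fun ω => pow_mul_abs_le hp hh0 (by linarith [abs_nonneg (Y N n ω)])
  have i3 : Integrable (fun ω => h ^ 2 * (|F N (Y N n ω)| ^ p * ((h ^ 2) ^ p)⁻¹
      + (1 + |Y N n ω|) ^ ⌈q * p.conjExponent⌉₊)) P := ((i1.mul_const _).add i2).const_mul _
  have hmm : Measurable fun ω => (1 + |Y N n ω|) ^ q * |F N (Y N n ω)| :=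
    ((hYm.abs.const_add 1).pow_const q).mul hFm.abs
  have i4 := i3.mono' hmm.aestronglyMeasurable (Eventually.of_forall fun ω => by
    rw [Real.norm_eq_abs, abs_of_nonneg (by positivity)]; exact hle ω)
  refine ⟨i4, (integral_mono i4 i3 hle).trans ?_⟩
  rw [integral_const_mul, integral_add (i1.mul_const _) i2, integral_mul_const, mul_comm _ (h ^ 2)]
  refine mul_le_mul_of_nonneg_left (add_le_add ?_ b2) (by positivity)
  calc (∫ ω, |F N (Y N n ω)| ^ p ∂P) * ((h ^ 2) ^ p)⁻¹
      ≤ (C * h ^ 2) ^ p * ((h ^ 2) ^ p)⁻¹ := by gcongr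
    _ = C ^ p := by
      rw [Real.mul_rpow hC.le (by positivity), mul_assoc, mul_inv_cancel₀ (by positivity), mul_one]

/-- The integrand of the weighted remainder, split by the arithmetic-geometric inequality into moments
of the chain and of its increments. The latter are of order `√h`, so every term on the right is of
order `h²` in mean. -/
lemma weighted_rem_le {h a b : ℝ} (q : ℕ) (hh : 0 < h) :
    (1 + |a|) ^ q * ((1 + |b|) ^ q * (h ^ 2 + h * (b - a) ^ 2 + (b - a) ^ 4))
      ≤ h ^ 2 * ((1 + |a|) ^ (4 * q) + (1 + |b|) ^ (4 * q)) + (b - a) ^ (2 * 2)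
        + (h ^ 2)⁻¹ * (b - a) ^ (2 * 4) := by
  set X := (1 + |a|) ^ q with hX
  set Z := (1 + |b|) ^ q with hZ
  have hX1 : 1 ≤ X := one_le_pow₀ (by linarith [abs_nonneg a])
  have hZ1 : 1 ≤ Z := one_le_pow₀ (by linarith [abs_nonneg b])
  have e1 : (1 + |a|) ^ (4 * q) = X ^ 4 := by rw [hX, ← pow_mul, mul_comm]
  have e2 : (1 + |b|) ^ (4 * q) = Z ^ 4 := by rw [hZ, ← pow_mul, mul_comm]
  -- the scaled squared increment `δ` is of order one
  obtain ⟨δ, hδ⟩ : ∃ δ, δ = (b - a) ^ 2 / h := ⟨_, rfl⟩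
  have d1 : (b - a) ^ 2 = h * δ := by rw [hδ]; field_simp
  have d2 : (b - a) ^ 4 = h ^ 2 * δ ^ 2 := by
    rw [show (b - a) ^ 4 = ((b - a) ^ 2) ^ 2 by ring, d1]; ring
  have d3 : (h ^ 2)⁻¹ * (b - a) ^ (2 * 4) = h ^ 2 * δ ^ 4 := by
    rw [show (b - a) ^ (2 * 4) = ((b - a) ^ 2) ^ 4 by ring, d1]; field_simp
  rw [e1, e2, d3, d1, d2]
  have hA : 1 ≤ X * Z := one_le_mul_of_one_le_of_one_le hX1 hZ1
  have hA2 : (X * Z) ^ 2 ≤ (X ^ 4 + Z ^ 4) / 2 := by nlinarith [sq_nonneg (X ^ 2 - Z ^ 2)]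
  have key : X * Z * (1 + δ + δ ^ 2) ≤ X ^ 4 + Z ^ 4 + δ ^ 2 + δ ^ 4 := by
    nlinarith [sq_nonneg (X * Z - δ), sq_nonneg (X * Z - δ ^ 2)]
  have := mul_le_mul_of_nonneg_left key (sq_nonneg h)
  linarith

lemma MomentBounds.exists_rem (hm : MomentBounds P T hbar Y) (hT : 0 < T)
    (hmeas : ∀ N : ℕ, 1 ≤ N → ∀ n ≤ N, Measurable (Y N n)) (q : ℕ) :
    ∃ C > 0, ∀ N : ℕ, 1 ≤ N → T / N < hbar → ∀ n < N,
      Integrable (fun ω => (1 + |Y N n ω|) ^ q * ((1 + |Y N (n + 1) ω|) ^ q *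
        ((T / N) ^ 2 + T / N * (Y N (n + 1) ω - Y N n ω) ^ 2
          + (Y N (n + 1) ω - Y N n ω) ^ 4))) P ∧
      ∫ ω, (1 + |Y N n ω|) ^ q * ((1 + |Y N (n + 1) ω|) ^ q *
        ((T / N) ^ 2 + T / N * (Y N (n + 1) ω - Y N n ω) ^ 2
          + (Y N (n + 1) ω - Y N n ω) ^ 4)) ∂P ≤ C * (T / N) ^ 2 := by
  obtain ⟨C1, hC1, h1⟩ := hm.poly (4 * q)
  obtain ⟨C2, hC2, h2⟩ := hm.incr 2 (by omega)
  obtain ⟨C3, hC3, h3⟩ := hm.incr 4 (by omega)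
  refine ⟨2 * C1 + C2 + C3, by positivity, fun N hN hh n hn => ?_⟩
  have hN0 : (0 : ℝ) < N := by exact_mod_cast hN
  obtain ⟨i0, b0⟩ := h1 N hN hh n hn.le
  obtain ⟨i1, b1⟩ := h1 N hN hh (n + 1) hn
  obtain ⟨i2, b2⟩ := h2 N hN hh n hn
  obtain ⟨i3, b3⟩ := h3 N hN hh n hn
  set h := T / N with hdef
  have hh0 : 0 < h := by positivity
  have m0 := hmeas N hN n hn.le
  have m1 := hmeas N hN (n + 1) hn
  have j1 : Integrable (fun ω => h ^ 2 * ((1 + |Y N n ω|) ^ (4 * q)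
      + (1 + |Y N (n + 1) ω|) ^ (4 * q))) P := (i0.add i1).const_mul _
  have j2 : Integrable (fun ω => h ^ 2 * ((1 + |Y N n ω|) ^ (4 * q)
      + (1 + |Y N (n + 1) ω|) ^ (4 * q)) + (Y N (n + 1) ω - Y N n ω) ^ (2 * 2)) P := j1.add i2
  have j3 : Integrable (fun ω => h ^ 2 * ((1 + |Y N n ω|) ^ (4 * q)
      + (1 + |Y N (n + 1) ω|) ^ (4 * q)) + (Y N (n + 1) ω - Y N n ω) ^ (2 * 2)
      + (h ^ 2)⁻¹ * (Y N (n + 1) ω - Y N n ω) ^ (2 * 4)) P := j2.add (i3.const_mul _)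
  have hle := fun ω => weighted_rem_le (a := Y N n ω) (b := Y N (n + 1) ω) q hh0
  have i4 := j3.mono' (Measurable.aestronglyMeasurable (f := fun ω => (1 + |Y N n ω|) ^ q *
      ((1 + |Y N (n + 1) ω|) ^ q * (h ^ 2 + h * (Y N (n + 1) ω - Y N n ω) ^ 2
        + (Y N (n + 1) ω - Y N n ω) ^ 4))) (by fun_prop)) (Eventually.of_forall fun ω => by
    rw [Real.norm_eq_abs, abs_of_nonneg (by positivity)]; exact hle ω)
  refine ⟨i4, (integral_mono i4 j3 hle).trans ?_⟩
  rw [integral_add j2 (i3.const_mul _), integral_add j1 i2, integral_const_mul,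
    integral_add i0 i1, integral_const_mul]
  have e3 : (h ^ 2)⁻¹ * ∫ ω, (Y N (n + 1) ω - Y N n ω) ^ (2 * 4) ∂P ≤ C3 * h ^ 2 := by
    calc _ ≤ (h ^ 2)⁻¹ * (C3 * h ^ 4) := by gcongr
      _ = C3 * h ^ 2 := by field_simp
  have e1 : h ^ 2 * ((∫ ω, (1 + |Y N n ω|) ^ (4 * q) ∂P)
      + ∫ ω, (1 + |Y N (n + 1) ω|) ^ (4 * q) ∂P) ≤ h ^ 2 * (C1 + C1) := by gcongr
  linarith

/-- For almost every state of the chain the transition law has the moments of `H₁`, and the local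
truncation error is of order `h (h + Δx²)` in mean. -/
lemma exists_consistency [IsProbabilityMeasure P] {M : Model} (hM : M.Standing) (hT : 0 < T) {y₀ : ℝ}
    {κ : ℕ → ℕ → Kernel ℝ ℝ} (hchain : ∀ N : ℕ, 1 ≤ N → IsMarkovChain P M.D y₀ N (Y N) (κ N))
    (hH1 : AssumptionH1 P M T Y) (hH2 : AssumptionH2 P T Y) {Λ K : ℝ} (hΛ : 0 ≤ Λ) (hK : 1 ≤ K)
    (q : ℕ) : ∃ hbar > 0, ∃ C > 0, ∀ N : ℕ, 1 ≤ N → T / N < hbar → ∀ n < N, ∀ dx : ℝ, 0 < dx →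
      ∃ ℓ : ℝ → ℝ, Measurable ℓ ∧ Integrable ℓ (P.map (Y N n)) ∧
        ∫ y, ℓ y ∂P.map (Y N n) ≤ C / √dx * (T / N * (T / N + dx ^ 2)) ∧
        ∀ᵐ y ∂P.map (Y N n), y ∈ M.D ∧ ∃ f g j,
          StepMoments M (T / N) y q (κ N n y) f g j ∧
          localBound (T / N) dx Λ (K * (1 + |y|) ^ q) (K * (1 + |y|) ^ q / √dx) f g j
            (remMoment (T / N) y q (κ N n y)) ≤ ℓ y := by
  have hmeas : ∀ N : ℕ, 1 ≤ N → ∀ n ≤ N, Measurable (Y N n) := fun N hN => (hchain N hN).meas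
  obtain ⟨hb2, hb2pos, hmom2⟩ := hH2.momentBounds hT.le hmeas
  obtain ⟨hb1, hb1pos, fh, gh, jh, hfgj, hcond, p, hp, C0, hC0, hbd⟩ := hH1
  set hbar := min (min hb1 hb2) 1 with hbar_def
  have hle1 : hbar ≤ hb1 := (min_le_left _ _).trans (min_le_left _ _)
  have hle2 : hbar ≤ hb2 := (min_le_left _ _).trans (min_le_right _ _)
  have hle3 : hbar ≤ 1 := min_le_right _ _
  have hmom := hmom2.mono hle2
  obtain ⟨C1, hC1, h1⟩ := hmom.poly (2 * q)
  obtain ⟨Cf, hCf, hf⟩ := hmom.exists_error hT hmeas (fun N => (hfgj N).1) hp hC0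
    (fun N hN hh n hn => (hbd N hN (hh.trans_le hle1) n hn).1) q
  obtain ⟨Cg, hCg, hg⟩ := hmom.exists_error hT hmeas (fun N => (hfgj N).2.1) hp hC0
    (fun N hN hh n hn => (hbd N hN (hh.trans_le hle1) n hn).2.1) q
  obtain ⟨Cj, hCj, hj⟩ := hmom.exists_error hT hmeas (fun N => (hfgj N).2.2) hp hC0
    (fun N hN hh n hn => (hbd N hN (hh.trans_le hle1) n hn).2.2) q
  obtain ⟨Cr, hCr, hr⟩ := hmom.exists_rem hT hmeas q
  obtain ⟨Cq, hCq, hq⟩ := hmom.poly q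
  obtain ⟨Ci, hCi, hi⟩ := hmom.incr 1 le_rfl
  refine ⟨hbar, by positivity, 4 * (1 + Λ) ^ 2 * (K ^ 2 * C1 + K * (Cf + Cg + Cj) + K * Cr),
    by positivity, fun N hN hh n hn dx hdx => ?_⟩
  have hN0 : (0 : ℝ) < N := by exact_mod_cast hN
  obtain ⟨c1, c2, c3, c4⟩ := hcond N hN (hh.trans_le hle1) n hn
  obtain ⟨iP, bP⟩ := h1 N hN hh n hn.le
  obtain ⟨iF, bF⟩ := hf N hN hh n hn.le
  obtain ⟨iG, bG⟩ := hg N hN hh n hn.le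
  obtain ⟨iJ, bJ⟩ := hj N hN hh n hn.le
  obtain ⟨iR, bR⟩ := hr N hN hh n hn
  obtain ⟨iQ, -⟩ := hq N hN hh (n + 1) hn
  obtain ⟨iI, -⟩ := hi N hN hh n hn
  have hY := hchain N hN
  have := hY.markov_kernel n hn
  have m0 := hmeas N hN n hn.le
  have m1 := hmeas N hN (n + 1) hn
  set h := T / N with hdef
  have hh0 : 0 < h := by positivity
  have hh1 : h ≤ 1 := hh.le.trans hle3
  set μ := P.map (Y N n) with hμ
  rw [mul_one] at iI
  have iΔ : Integrable (fun ω => Y N (n + 1) ω - Y N n ω) P := by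
    refine ((integrable_const (1 : ℝ)).add iI).mono' (m1.sub m0).aestronglyMeasurable
      (Eventually.of_forall fun ω => ?_)
    simp only [Pi.add_apply]
    rw [Real.norm_eq_abs]
    nlinarith [sq_abs (Y N (n + 1) ω - Y N n ω), sq_nonneg (|Y N (n + 1) ω - Y N n ω| - 1)]
  -- The remainder moment as an integral against the joint law.
  have kR := hY.integrable_kernel hn (F := fun x : ℝ × ℝ => (1 + |x.1|) ^ q *
    ((1 + |x.2|) ^ q * (h ^ 2 + h * (x.2 - x.1) ^ 2 + (x.2 - x.1) ^ 4))) (by fun_prop) iR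
  have hSeq : ∀ y, ∫ z, (1 + |y|) ^ q *
      ((1 + |z|) ^ q * (h ^ 2 + h * (z - y) ^ 2 + (z - y) ^ 4)) ∂κ N n y
      = (1 + |y|) ^ q * remMoment h y q (κ N n y) := fun y => integral_const_mul _ _
  simp only [hSeq] at kR
  obtain ⟨kR1, kR2, kR3⟩ := kR
  have hremm : Measurable fun y => remMoment h y q (κ N n y) :=
    (StronglyMeasurable.integral_kernel_prod_right' (κ := κ N n)
      (f := fun x : ℝ × ℝ => (1 + |x.2|) ^ q * (h ^ 2 + h * (x.2 - x.1) ^ 2 + (x.2 - x.1) ^ 4))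
      (Measurable.stronglyMeasurable (by fun_prop))).measurable
  have k1 := (hY.integrable_kernel hn (F := fun x : ℝ × ℝ => x.2 - x.1) (by fun_prop) iΔ).1
  have k2 := (hY.integrable_kernel hn (F := fun x : ℝ × ℝ => (x.2 - x.1) ^ 2) (by fun_prop) iI).1
  have k3 := (hY.integrable_kernel hn (F := fun x : ℝ × ℝ => (x.2 - x.1) ^ 3) (by fun_prop) c1).1
  have kq := (hY.integrable_kernel hn (F := fun x : ℝ × ℝ => (1 + |x.2|) ^ q) (by fun_prop) iQ).1
  have e1 := hY.integral_eq_of_condExp hn (F := fun x : ℝ × ℝ => x.2 - x.1) (by fun_prop) iΔ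
    (φ := fun y => M.μY y * h + fh N y) ((hM.meas_μY.mul_const h).add (hfgj N).1) c2
  have e2 := hY.integral_eq_of_condExp hn (F := fun x : ℝ × ℝ => (x.2 - x.1) ^ 2) (by fun_prop) iI
    (φ := fun y => M.σY y ^ 2 * h + gh N y)
    (((hM.meas_σY.pow_const 2).mul_const h).add (hfgj N).2.1) c3
  have e3 := hY.integral_eq_of_condExp hn (F := fun x : ℝ × ℝ => (x.2 - x.1) ^ 3) (by fun_prop) c1
    (φ := fun y => jh N y) (hfgj N).2.2 c4
  have hD0 : ∀ᵐ y ∂μ, y ∈ M.D :=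
    (ae_map_iff m0.aemeasurable hM.domain.measurableSet).2 (hY.mem n hn.le)
  have hD1 := hY.ae_kernel hn
    ((ae_map_iff m1.aemeasurable hM.domain.measurableSet).2 (hY.mem (n + 1) hn))
  -- Transfer of the moments from `Ω` to the law of the chain.
  have tr : ∀ {F : ℝ → ℝ}, Measurable F → Integrable (fun ω => F (Y N n ω)) P →
      Integrable F μ ∧ ∫ y, F y ∂μ = ∫ ω, F (Y N n ω) ∂P := fun {F} hF hi =>
    ⟨(integrable_map_measure hF.aestronglyMeasurable m0.aemeasurable).2 hi,
      integral_map m0.aemeasurable hF.aestronglyMeasurable⟩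
  obtain ⟨tP, tP'⟩ := tr (F := fun y => (1 + |y|) ^ (2 * q)) (by fun_prop) iP
  have mpow : Measurable fun y : ℝ => (1 + |y|) ^ q := by fun_prop
  obtain ⟨tF, tF'⟩ := tr (F := fun y => (1 + |y|) ^ q * |fh N y|) (mpow.mul (hfgj N).1.abs) iF
  obtain ⟨tG, tG'⟩ := tr (F := fun y => (1 + |y|) ^ q * |gh N y|) (mpow.mul (hfgj N).2.1.abs) iG
  obtain ⟨tJ, tJ'⟩ := tr (F := fun y => (1 + |y|) ^ q * |jh N y|) (mpow.mul (hfgj N).2.2.abs) iJ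
  set ρ := 1 / √dx with hρ
  have hρ0 : 0 ≤ ρ := by positivity
  set a := (h * dx ^ 2 + h ^ 2) * K ^ 2 with ha
  have s1 : Integrable (fun y => a * (1 + |y|) ^ (2 * q)) μ := tP.const_mul a
  have s2 : Integrable (fun y => (1 + |y|) ^ q * |fh N y| + (1 + |y|) ^ q * |gh N y|) μ :=
    tF.add tG
  have s3 : Integrable (fun y => (1 + |y|) ^ q * |fh N y| + (1 + |y|) ^ q * |gh N y|
      + (1 + |y|) ^ q * |jh N y|) μ := s2.add tJ
  have s4 : Integrable (fun y => a * (1 + |y|) ^ (2 * q) + K * ((1 + |y|) ^ q * |fh N y|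
      + (1 + |y|) ^ q * |gh N y| + (1 + |y|) ^ q * |jh N y|)) μ := s1.add (s3.const_mul K)
  have s5 : Integrable (fun y => a * (1 + |y|) ^ (2 * q) + K * ((1 + |y|) ^ q * |fh N y|
      + (1 + |y|) ^ q * |gh N y| + (1 + |y|) ^ q * |jh N y|)
      + K * ((1 + |y|) ^ q * remMoment h y q (κ N n y))) μ := s4.add (kR2.const_mul K)
  refine ⟨fun y => ρ * (4 * (1 + Λ) ^ 2) * (a * (1 + |y|) ^ (2 * q)
      + K * ((1 + |y|) ^ q * |fh N y| + (1 + |y|) ^ q * |gh N y| + (1 + |y|) ^ q * |jh N y|)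
      + K * ((1 + |y|) ^ q * remMoment h y q (κ N n y))), ?_, s5.const_mul _, ?_, ?_⟩
  · have := (hfgj N).1
    have := (hfgj N).2.1
    have := (hfgj N).2.2
    fun_prop
  · rw [integral_const_mul, integral_add s4 (kR2.const_mul K), integral_add s1 (s3.const_mul K),
      integral_const_mul, integral_const_mul, integral_const_mul, integral_add s2 tJ,
      integral_add tF tG, tP', tF', tG', tJ', kR3]
    have ha0 : 0 ≤ a := by positivity
    have hdx2 : 0 ≤ h * dx ^ 2 := by positivity
    calc _ ≤ ρ * (4 * (1 + Λ) ^ 2) * (a * C1 + K * (Cf * h ^ 2 + Cg * h ^ 2 + Cj * h ^ 2)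
          + K * (Cr * h ^ 2)) := by gcongr
      _ = ρ * (4 * (1 + Λ) ^ 2) * (K ^ 2 * C1 * (h * dx ^ 2 + h ^ 2)
          + (K * (Cf + Cg + Cj) + K * Cr) * h ^ 2) := by rw [ha]; ring
      _ ≤ ρ * (4 * (1 + Λ) ^ 2) * (K ^ 2 * C1 * (h * dx ^ 2 + h ^ 2)
          + (K * (Cf + Cg + Cj) + K * Cr) * (h * dx ^ 2 + h ^ 2)) := by gcongr; linarith
      _ = _ := by rw [hρ]; ring
  · filter_upwards [hD0, hD1, k1, k2, k3, kq, kR1, e1, e2, e3] with y g1 g2 g3 g4 g5 g6 g7 g8 g9 g10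
    have hpos : (0 : ℝ) < (1 + |y|) ^ q := by positivity
    have hpow1 : (1 : ℝ) ≤ (1 + |y|) ^ q := one_le_pow₀ (by linarith [abs_nonneg y])
    refine ⟨g1, fh N y, gh N y, jh N y, ⟨inferInstance, g2, g6, ?_, g3, g4, g5, g8, g9, g10⟩, ?_⟩
    · refine (g7.const_mul ((1 + |y|) ^ q)⁻¹).congr (Eventually.of_forall fun z => ?_)
      simp only
      rw [← mul_assoc, inv_mul_cancel₀ hpos.ne', one_mul]
    · have hS : 0 ≤ remMoment h y q (κ N n y) := integral_nonneg fun z => by positivity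
      have := localBound_le (dx := dx) (f := fh N y) (g := gh N y) (j := jh N y) hh0.le hh1 hΛ
        (one_le_mul_of_one_le_of_one_le hK hpow1) hρ0 hS
      rw [show K * (1 + |y|) ^ q / √dx = K * (1 + |y|) ^ q * ρ by rw [hρ]; ring]
      refine this.trans (le_of_eq ?_)
      rw [ha]
      ring

end Moments

/-! ### Propagation of the error -/

section Global

variable {Ω : Type*} [MeasurableSpace Ω] {P : Measure Ω} [IsProbabilityMeasure P]

/-- The backward recursion of the error: an `ℓ²` bound `k y` for the error with `m` steps to go is
carried to the bound `ℓ y + (1 + 2Λh) ∫ k dκ(y)` one step earlier. Averaging over the law of the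
chain turns this into a scalar recursion, since `κ` transports the law of `Y n` to that of
`Y (n + 1)`. -/
lemma Regular.scheme_error {M : Model} {T : ℝ} {u : ℝ → ℝ → ℝ → ℝ}
    {w : ℕ → ℕ → ℕ → ℝ → ℝ → ℝ → ℝ} {K : ℝ} {q : ℕ} (hR : Regular M T u w K q) (hM : M.Standing)
    {f : ℝ → ℝ → ℝ} (hp : SolvesPIDE M T f u) {Λ dx E y₀ : ℝ} (hΛ : 0 ≤ Λ) (hdx : 0 < dx)
    (hdx1 : dx < 1) (hJ : ∀ y ∈ M.D, M.JumpBound dx y Λ) {N : ℕ} (hN : 1 ≤ N) (hT : 0 < T)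
    (hhT : T / N < T) {Y : ℕ → Ω → ℝ} {κ : ℕ → Kernel ℝ ℝ} (hY : IsMarkovChain P M.D y₀ N Y κ)
    (hE : 0 ≤ E)
    (hcons : ∀ n < N, ∃ ℓ : ℝ → ℝ, Measurable ℓ ∧ Integrable ℓ (P.map (Y n)) ∧
      ∫ y, ℓ y ∂P.map (Y n) ≤ E ∧ ∀ᵐ y ∂P.map (Y n), y ∈ M.D ∧ ∃ f₁ g₁ j₁,
          StepMoments M (T / N) y q (κ n y) f₁ g₁ j₁ ∧
          localBound (T / N) dx Λ (K * (1 + |y|) ^ q) (K * (1 + |y|) ^ q / √dx) f₁ g₁ j₁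
            (remMoment (T / N) y q (κ n y)) ≤ ℓ y) (x : ℝ) :
    ∀ m ≤ N, (∀ i, AEMeasurable (fun y => M.scheme (T / N) dx x f N κ m i y)
        (P.map (Y (N - m)))) ∧
      ∃ k : ℝ → ℝ, Measurable k ∧ Integrable k (P.map (Y (N - m))) ∧
        (∀ᵐ y ∂P.map (Y (N - m)), L2Bound (fun i : ℤ => u ((N - m : ℕ) * (T / N)) (x + i * dx) y
          - M.scheme (T / N) dx x f N κ m i y) (k y)) ∧
        ∫ y, k y ∂P.map (Y (N - m)) ≤ m * (1 + 2 * Λ * (T / N)) ^ m * E := by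
  have hN0 : (0 : ℝ) < N := by exact_mod_cast hN
  have hNT : (N : ℝ) * (T / N) = T := by field_simp
  set h := T / N with hh
  have hh0 : 0 < h := by positivity
  have hmemD : ∀ n ≤ N, ∀ᵐ y ∂P.map (Y n), y ∈ M.D := fun n hn =>
    (ae_map_iff (hY.meas n hn).aemeasurable hM.domain.measurableSet).2 (hY.mem n hn)
  intro m
  induction m with
  | zero =>
    intro _
    have hfu : ∀ i : ℤ, ∀ᵐ y ∂P.map (Y N), u T (x + i * dx) y = f (x + i * dx) y := fun i =>
      (hmemD N le_rfl).mono fun y hy => hp.terminal _ y hy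
    refine ⟨fun i => ?_, 0, measurable_const, integrable_zero _ _ _, ?_, by simp⟩
    · exact ((hR.aestronglyMeasurable_u hM hp hT (hmemD N le_rfl) hT.le le_rfl
        (x + i * dx)).congr (hfu i)).aemeasurable
    · rw [Nat.sub_zero]
      filter_upwards [ae_all_iff.2 hfu] with y hy
      refine L2Bound.zero.of_eq ?_
      funext i
      rw [hNT, hy i]
      simp [Model.scheme]
  | succ m ih =>
    intro hm
    obtain ⟨hvm, k, hkm, hki, hkb, hkE⟩ := ih (by omega)
    obtain ⟨n, hn⟩ : ∃ n, n = N - (m + 1) := ⟨_, rfl⟩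
    have hnN : n < N := by omega
    have hns : N - m = n + 1 := by omega
    rw [hns] at hvm hki hkb hkE
    rw [← hn]
    have := hY.markov_kernel n hnN
    obtain ⟨ℓ, hℓm, hℓi, hℓE, hℓ⟩ := hcons n hnN
    obtain ⟨hk1, hk2, hk3⟩ := hY.integrable_kernel hnN (F := fun z => k z.2)
      (hkm.comp measurable_snd)
      ((integrable_map_measure hkm.aestronglyMeasurable (hY.meas (n + 1) hnN).aemeasurable).1 hki)
    rw [← integral_map (hY.meas (n + 1) hnN).aemeasurable hkm.aestronglyMeasurable] at hk3
    have htime : ((n + 1 : ℕ) : ℝ) * h = n * h + h := by push_cast; ring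
    have hnT : (n : ℝ) * h + h ≤ T := by
      rw [← htime, ← hNT]
      gcongr
      exact hnN
    rw [htime] at hkb
    -- The scheme at time `n + 1` is measurable only up to null sets; a measurable version has the
    -- same integrals under almost every transition law.
    have hvk : ∀ᵐ y ∂P.map (Y n), ∀ i, ∀ᵐ z ∂κ n y,
        M.scheme h dx x f N κ m i z = (hvm i).mk _ z :=
      ae_all_iff.2 fun i => hY.ae_kernel hnN (hvm i).ae_eq_mk
    have hstep : ∀ᵐ y ∂P.map (Y n), WeightBound M h dx y Λ ∧
        (fun i => M.scheme h dx x f N κ (m + 1) i y) = M.step h dx y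
          (fun j => ∫ z, (hvm j).mk _ z ∂κ n y) ∧
        L2Bound (fun i : ℤ => u (n * h) (x + i * dx) y - M.scheme h dx x f N κ (m + 1) i y)
          (ℓ y + (1 + 2 * Λ * h) * ∫ z, k z ∂κ n y) ∧
        L2Bound (fun j => ∫ z, (hvm j).mk _ z ∂κ n y)
          (∫ z, (K * (1 + |z|) ^ q / √dx + k z) ∂κ n y) := by
      filter_upwards [hvk, hℓ, hY.ae_kernel hnN hkb, hk1] with y hvy hy hby hiy
      obtain ⟨hyD, f₁, g₁, j₁, hmom, hloc⟩ := hy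
      have hae : ∀ i, AEMeasurable (fun z => M.scheme h dx x f N κ m i z) (κ n y) := fun i =>
        ⟨_, (hvm i).measurable_mk, hvy i⟩
      have hint : ∀ i, ∫ z, M.scheme h dx x f N κ m i z ∂κ n y = ∫ z, (hvm i).mk _ z ∂κ n y :=
        fun i => integral_congr_ae (hvy i)
      obtain ⟨e1, e2, e3⟩ := hR.error_step hM hp (hJ y hyD) hmom (by positivity) hh0 hnT hhT hyD
        hdx hdx1 x hae hby hiy
      have e0 : ∀ i, M.scheme h dx x f N κ (m + 1) i y
          = ∫ z, M.step h dx y (fun j => M.scheme h dx x f N κ m j z) i ∂κ n y := fun i => by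
        rw [Model.scheme, hn]
      refine ⟨(hJ y hyD).weightBound hh0.le, ?_, ?_, ?_⟩
      · simp only [e0, e1, hint]
      · simp only [e0]
        exact e2.mono (by linarith)
      · simpa only [hint] using e3
    refine ⟨fun i => ?_, fun y => ℓ y + (1 + 2 * Λ * h) * ∫ z, k z ∂κ n y,
      hℓm.add (hkm.stronglyMeasurable.integral_kernel.measurable.const_mul _),
      hℓi.add (hk2.const_mul _), hstep.mono fun y hy => hy.2.2.1, ?_⟩
    · refine (aemeasurable_step hM (h := h) (dx := dx) (y := fun y : ℝ => y)
        (v := fun j y => ∫ z, (hvm j).mk _ z ∂κ n y) measurable_id (hstep.mono fun y hy => hy.1)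
        (fun j => ?_) (hstep.mono fun y hy => hy.2.2.2) i).congr ?_
      · exact (hvm j).measurable_mk.stronglyMeasurable.integral_kernel.measurable.aemeasurable
      · exact hstep.mono fun y hy => (congrFun hy.2.1 i).symm
    · rw [integral_add hℓi (hk2.const_mul _), integral_const_mul, hk3]
      have hr : 1 ≤ 1 + 2 * Λ * h := by
        have := mul_nonneg (mul_nonneg zero_le_two hΛ) hh0.le
        linarith
      have hr1 : 1 ≤ (1 + 2 * Λ * h) ^ (m + 1) := one_le_pow₀ hr
      calc ∫ y, ℓ y ∂P.map (Y n) + (1 + 2 * Λ * h) * ∫ z, k z ∂P.map (Y (n + 1))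
          ≤ (1 + 2 * Λ * h) ^ (m + 1) * E
            + (1 + 2 * Λ * h) * (m * (1 + 2 * Λ * h) ^ m * E) :=
          add_le_add (hℓE.trans (le_mul_of_one_le_left hE hr1))
            (mul_le_mul_of_nonneg_left hkE (by linarith))
        _ = ((m + 1 : ℕ) : ℝ) * (1 + 2 * Λ * h) ^ (m + 1) * E := by push_cast; ring

end Global

end Hybrid

theorem theorem4p5
    (M : Hybrid.Model) (hM : M.Standing) (hν : M.LevyRegular)
    (T : NNReal) (hT : 0 < T) (x₀ y₀ : ℝ) (hy₀ : y₀ ∈ M.D)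
    (f : ℝ → ℝ → ℝ) (u : ℝ → ℝ → ℝ → ℝ)
    (hwp : Hybrid.WellPosed M T)
    (hu : Hybrid.IsValueFunction M T f u)
    (hpide : Hybrid.SolvesPIDE M T f u)
    (hreg : Hybrid.MemCpolT 2 6 T M.D u)
    {Ω : Type*} [MeasurableSpace Ω] (P : MeasureTheory.Measure Ω)
    [MeasureTheory.IsProbabilityMeasure P]
    (Y : ℕ → ℕ → Ω → ℝ) (κ : ℕ → ℕ → ProbabilityTheory.Kernel ℝ ℝ)
    (hchain : ∀ N : ℕ, 1 ≤ N → Hybrid.IsMarkovChain P M.D y₀ N (Y N) (κ N))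
    (hH1 : Hybrid.AssumptionH1 P M T Y)
    (hH2 : Hybrid.AssumptionH2 P T Y) :
    ∃ hbar > 0, ∃ C > 0, ∀ N : ℕ, 1 ≤ N → (T : ℝ) / N < hbar → ∀ dx : ℝ, 0 < dx → dx < 1 →
      Hybrid.MemL2 (fun i : ℤ => u 0 (x₀ + i * dx) y₀ - M.uh (T / N) dx x₀ f N (κ N) 0 i y₀) ∧
      Hybrid.l2norm dx
          (fun i : ℤ => u 0 (x₀ + i * dx) y₀ - M.uh (T / N) dx x₀ f N (κ N) 0 i y₀)
        ≤ C * T * (T / N + dx ^ 2) := by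
  have hT' : (0 : ℝ) < T := hT
  obtain ⟨Λ, hΛ, hJ⟩ := Hybrid.Model.exists_jumpBound hM hν
  obtain ⟨w, K, q, hR⟩ := Hybrid.exists_regular hM hreg
  obtain ⟨hbar, hpos, C, hC, hcons⟩ :=
    Hybrid.exists_consistency hM hT' hchain hH1 hH2 hΛ.le hR.one_le q
  -- `h < T` excludes a single step from time `0` to maturity, where the local error is not available
  refine ⟨min hbar T, lt_min hpos hT', C * Real.exp (2 * Λ * T), by positivity,
    fun N hN hh dx hdx hdx1 => ?_⟩
  have hY := hchain N hN
  have hN0 : (0 : ℝ) < N := by exact_mod_cast hN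
  obtain ⟨-, k, hkm, hki, hkb, hkE⟩ := hR.scheme_error hM hpide hΛ.le hdx hdx1
    (fun y hy => hJ y hy dx hdx hdx1) hN hT' (lt_min_iff.1 hh).2 hY
    (E := C / √dx * (T / N * (T / N + dx ^ 2))) (by positivity)
    (fun n hn => hcons N hN (lt_min_iff.1 hh).1 n hn dx hdx) x₀ N le_rfl
  simp only [Nat.sub_self, Nat.cast_zero, zero_mul] at hki hkb hkE
  -- the law of `Y 0` is the point mass at `y₀`
  obtain ⟨ω, hω, hωk⟩ := (hY.init.and
    (ae_of_ae_map (hY.meas 0 (Nat.zero_le N)).aemeasurable hkb)).exists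
  rw [hω] at hωk
  have hk0 : ∫ y, k y ∂P.map (Y N 0) = k y₀ := by
    rw [integral_map (hY.meas 0 (Nat.zero_le N)).aemeasurable hkm.aestronglyMeasurable,
      integral_congr_ae (g := fun _ => k y₀) (hY.init.mono fun ω hω => by simp only [hω])]
    simp
  rw [hk0] at hkE
  have hs : 0 < √dx := Real.sqrt_pos.2 hdx
  refine ⟨hωk.memL2, ?_⟩
  have hpow : (1 + 2 * Λ * (T / N)) ^ N ≤ Real.exp (2 * Λ * T) := by
    have h1 : 1 + 2 * Λ * (T / N) ≤ Real.exp (2 * Λ * (T / N)) := by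
      rw [add_comm]; exact Real.add_one_le_exp _
    calc (1 + 2 * Λ * (T / N)) ^ N ≤ Real.exp (2 * Λ * (T / N)) ^ N := by gcongr
      _ = Real.exp (2 * Λ * T) := by
        rw [← Real.exp_nat_mul]
        congr 1
        field_simp
  have hkC : k y₀ * √dx ≤ C * Real.exp (2 * Λ * T) * T * (T / N + dx ^ 2) := by
    calc k y₀ * √dx ≤ N * (1 + 2 * Λ * (T / N)) ^ N * (C / √dx * (T / N * (T / N + dx ^ 2))) * √dx :=
          mul_le_mul_of_nonneg_right hkE hs.le
      _ ≤ N * Real.exp (2 * Λ * T) * (C / √dx * (T / N * (T / N + dx ^ 2))) * √dx := by gcongr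
      _ = C * Real.exp (2 * Λ * T) * T * (T / N + dx ^ 2) := by field_simp
  refine le_trans ?_ hkC
  rw [Hybrid.l2norm, tsum_mul_right, Real.sqrt_mul' _ hdx.le]
  refine mul_le_mul_of_nonneg_right ?_ hs.le
  exact (Real.sqrt_le_sqrt hωk.tsum_sq_le).trans_eq (Real.sqrt_sq hωk.nonneg)
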